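/- **Setting.** Let $K,M,N,d$ be positive integers, $\boldsymbol H_k\in\mathbb C^{N\times M}$, $\alpha_k\ge 0$ for $k=1,\dots,K$, and $\sigma^2>0$, $P>0$. For $\boldsymbol V=(\boldsymbol V_k)_k$ with $\boldsymbol V_k\in\mathbb C^{M\times d}$, $\boldsymbol U=(\boldsymbol U_k)_k$ with $\boldsymbol U_k\in\mathbb C^{N\times d}$ and $\boldsymbol W=(\boldsymbol W_k)_k$ with $\boldsymbol W_k\in\mathbb C^{d\times d}$ Hermitian, put $p(\boldsymbol V)=\sum_{m}\mathrm{Tr}(\boldsymbol V_m\boldsymbol V_m^H)$, $$R_k=\log\det\Big(\boldsymbol I+\boldsymbol H_k\boldsymbol V_k\boldsymbol V_k^H\boldsymbol H_k^H\big(\textstyle\sum_{m\ne k}\boldsymbol H_k\boldsymbol V_m\boldsymbol V_m^H\boldsymbol H_k^H+\sigma^2\boldsymbol I\big)^{-1}\Big),$$ $$\boldsymbol E_k(v)=(\boldsymbol I-\boldsymbol U_k^H\boldsymbol H_k\boldsymbol V_k)(\boldsymbol I-\boldsymbol U_k^H\boldsymbol H_k\boldsymbol V_k)^H+\sum_{m\ne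 k}\boldsymbol U_k^H\boldsymbol H_k\boldsymbol V_m\boldsymbol V_m^H\boldsymbol H_k^H\boldsymbol U_k+v\,\boldsymbol U_k^H\boldsymbol U_k,$$ $\widetilde{\boldsymbol E}_k=\boldsymbol E_k(\sigma^2)$ and $\boldsymbol E_k=\boldsymbol E_k\big(\sigma^2p(\boldsymbol V)/P\big)$. Consider * (WSR) maximise $\sum_k\alpha_kR_k$ over $\boldsymbol V$ subject to $p(\boldsymbol V)\le P$; * (WMMSE) minimise $\sum_k\alpha_k\{\mathrm{Tr}(\boldsymbol W_k\widetilde{\boldsymbol E}_k)-\log\det\boldsymbol W_k\}$ over $(\boldsymbol U,\boldsymbol W,\boldsymbol V)$ subject to $\boldsymbol W_k\succeq0$ for all $k$ and $p(\boldsymbol V)\le P$. A stationary point of the minimisation of $g$ over a convex set $\mathcal X$ is a point $\overline{\boldsymbol X}\in\mathcal X$ at which $g$ is defined and differentiable, with $\langle\nabla g(\overline{\boldsymbol X}),\boldsymbol X-\overline{\boldsymbol X}\rangle\ge0$ for all $\boldsymbol X\in\mathcal X$; here complex matrices are identified with real vectors through real and imaginary parts, and $\langle\cdot,\cdot\rangle$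 is the Euclidean inner product. (For WMMSE, $g$ being defined means that every $\overline{\boldsymbol W}_k$ is positive definite; for WSR, $g=-\sum_k\alpha_kR_k$.) **Algorithm.** Let $f=\sum_k\alpha_k\{\mathrm{Tr}(\boldsymbol W_k\boldsymbol E_k)-\log\det\boldsymbol W_k\}$ and $$\nabla_uf(\boldsymbol U_k)=2\alpha_k\Big(-\boldsymbol H_k\boldsymbol V_k+\sum_m\boldsymbol H_k\boldsymbol V_m\boldsymbol V_m^H\boldsymbol H_k^H\boldsymbol U_k\Big)\boldsymbol W_k+\frac{2\alpha_k\sigma^2}{P}p(\boldsymbol V)\,\boldsymbol U_k\boldsymbol W_k,$$ $$\nabla_vf(\boldsymbol V_k)=\sum_m2\alpha_m\boldsymbol H_m^H\boldsymbol U_m\boldsymbol W_m\boldsymbol U_m^H\boldsymbol H_m\boldsymbol V_k-2\alpha_k\boldsymbol H_k^H\boldsymbol U_k\boldsymbol W_k+2\boldsymbol V_k\frac{\sigma^2}{P}\sum_m\alpha_m\mathrm{Tr}(\boldsymbol W_m\boldsymbol U_m^H\boldsymbol U_m).$$ Start from $\boldsymbol U=\boldsymbol 0$, $\boldsymbol W=\boldsymbol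 I$ and any $\boldsymbol V$ with $p(\boldsymbol V)=P$. One outer iteration consists of $J_u\ge1$ steps $\boldsymbol U_k\leftarrow\boldsymbol U_k-\gamma_u\nabla_uf(\boldsymbol U_k)$ (all $k$), then $J_w\ge1$ steps $\boldsymbol W_k\leftarrow\boldsymbol W_k(2\boldsymbol I-\boldsymbol E_k\boldsymbol W_k)$ (all $k$), then $J_v\ge1$ steps, each of which replaces $\boldsymbol V_k$ by $\boldsymbol V_k-\gamma_v\nabla_vf(\boldsymbol V_k)$ (all $k$) and then $(\boldsymbol U,\boldsymbol V)$ by $(\beta^{-1}\boldsymbol U,\beta\boldsymbol V)$ with $\beta=\sqrt{P/p(\boldsymbol V)}$. Let $(\boldsymbol U,\boldsymbol W,\boldsymbol V)^l$ be the triple after $l$ outer iterations. **Step sizes.** Let $\|\boldsymbol H_k\|_2^2\le\kappa$ and $\alpha_k\le\bar\alpha$ for all $k$, let $\delta$ be the unique solution of $x-x^2-\log(2-x)=0$ in $1<x<2$, and put $$L_u=\frac{2\bar\alpha\delta(P\kappa+\sigma^2)^2}{\sigma^2},\qquad L_v=\frac{2\bar\alpha K\delta(P\kappa+d\sigma^2)}{P\sigma^2},$$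 $$\mu_u=2\bar\alpha\delta\sqrt{P\kappa+\sigma^2}\Big(1+\frac{P\kappa+\sqrt{P\kappa(P\kappa+\sigma^2)}}{\sigma^2}\Big),\qquad \mu_v=2\bar\alpha\delta\,\frac{KP\kappa+\sqrt{P\kappa(P\kappa+\sigma^2)}+Kd\sigma^2}{\sqrt P\,\sigma^2},$$ $$L_c=\mu_u^2\frac{\delta(P\kappa+\sigma^2)^2}{\sigma^2},\qquad L_d=2\mu_u\delta(P\kappa+\sigma^2)\frac{\sqrt{P\kappa}+\sqrt{P\kappa+\sigma^2}}{\sigma^2},$$ $$L_a=\frac{K\mu_v^2\delta(\kappa+\frac{d\sigma^2}{P})}{\sigma^2},\qquad L_b=\frac{2K\sqrt P\mu_v\delta(\kappa+\frac{\sqrt d\sigma^2}{P})+2\mu_v\delta\sqrt{\kappa(P\kappa+\sigma^2)}}{\sigma^2},$$ $$\nu_u=\frac{-L_d+\sqrt{L_d^2+4L_c\frac{\delta-1}{J_u+J_v}}}{2L_c},\qquad \nu_v=\frac{-L_b+\sqrt{L_b^2+4L_a\frac{\delta-1}{J_u+J_v}}}{2L_a}.$$ **Theorem.** Suppose $0<\gamma_u\le\min(1/L_u,\nu_u)$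 and $0<\gamma_v\le\min(1/L_v,\nu_v)$. Then every limit point $(\overline{\boldsymbol U},\overline{\boldsymbol W},\overline{\boldsymbol V})$ of the sequence $(\boldsymbol U,\boldsymbol W,\boldsymbol V)^l$, $l\to\infty$, is a stationary point of (WMMSE), and $\overline{\boldsymbol V}$ is a stationary point of (WSR). Conversely, if $\overline{\boldsymbol V}$ is a stationary point of (WSR), then there are $\overline{\boldsymbol U}$ and $\overline{\boldsymbol W}$ such that $(\overline{\boldsymbol U},\overline{\boldsymbol W},\overline{\boldsymbol V})$ is a stationary point of (WMMSE). -/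

import Mathlib

open scoped Matrix ComplexOrder

namespace WMMSE

/-- Data of a downlink system with `K` users, `M` transmit antennas, `N` receive antennas per user
and `d` streams per user: channels `H k`, priorities `α k`, noise standard deviation `σ` (so the
noise variance is `σ ^ 2`) and transmit power budget `P`. -/
structure System (K M N d : ℕ) where
  H : Fin K → Matrix (Fin N) (Fin M) ℂ
  α : Fin K → ℝ
  σ : ℝ
  P : ℝ

/-- Receive filters, one `N × d` matrix per user. -/
abbrev Receivers (K N d : ℕ) := Fin K → Matrix (Fin N) (Fin d) ℂ

/-- Weight matrices, one `d × d` matrix per user. -/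
abbrev Weights (K d : ℕ) := Fin K → Matrix (Fin d) (Fin d) ℂ

/-- Transmit beamformers, one `M × d` matrix per user. -/
abbrev Beamformers (K M d : ℕ) := Fin K → Matrix (Fin M) (Fin d) ℂ

/-- A triple `(U, W, V)`. -/
abbrev Point (K M N d : ℕ) := Receivers K N d × Weights K d × Beamformers K M d

/-- `X` is a stationary point of the minimisation of `f` over the set `𝒳`: it is feasible, `f` is
differentiable at `X`, and `⟨∇f(X), Y - X⟩ ≥ 0` for all `Y ∈ 𝒳`. Complex matrices are regarded as
real vectors (real and imaginary parts), and `⟨∇f(X), Z⟩` is the real Fréchet derivative of `f` at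
`X` in the direction `Z`. -/
def IsStationaryPoint {E : Type*} [AddCommGroup E] [Module ℝ E] [TopologicalSpace E]
    (f : E → ℝ) (𝒳 : Set E) (X : E) : Prop :=
  X ∈ 𝒳 ∧ DifferentiableAt ℝ f X ∧ ∀ Y ∈ 𝒳, 0 ≤ fderiv ℝ f X (Y - X)

/-- Total transmit power `∑ₖ Tr(Vₖ Vₖᴴ)` (a sum of real numbers). -/
noncomputable def power {K M d : ℕ} (V : Beamformers K M d) : ℝ :=
  ∑ k, (Matrix.trace (V k * (V k)ᴴ)).re

namespace System

variable {K M N d : ℕ} (S : System K M N d)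

/-! ### The two optimisation problems -/

/-- Interference plus noise covariance `∑_{m ≠ k} Hₖ Vₘ Vₘᴴ Hₖᴴ + σ² I` of user `k`. -/
noncomputable def interference (V : Beamformers K M d) (k : Fin K) :
    Matrix (Fin N) (Fin N) ℂ :=
  ∑ m ∈ Finset.univ.erase k, S.H k * V m * (V m)ᴴ * (S.H k)ᴴ +
    (S.σ ^ 2) • (1 : Matrix (Fin N) (Fin N) ℂ)

/-- Rate `Rₖ = log det (I + Hₖ Vₖ Vₖᴴ Hₖᴴ (∑_{m ≠ k} Hₖ Vₘ Vₘᴴ Hₖᴴ + σ² I)⁻¹)`; the determinant is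
a positive real number when `σ ≠ 0`. -/
noncomputable def rate (V : Beamformers K M d) (k : Fin K) : ℝ :=
  Real.log (Matrix.det (1 + S.H k * V k * (V k)ᴴ * (S.H k)ᴴ * (S.interference V k)⁻¹)).re

/-- Weighted sum rate `∑ₖ αₖ Rₖ`. -/
noncomputable def weightedSumRate (V : Beamformers K M d) : ℝ :=
  ∑ k, S.α k * S.rate V k

/-- Beamformers that satisfy the power constraint. -/
def feasibleBeamformers : Set (Beamformers K M d) :=
  {V | power V ≤ S.P}

/-- Stationary point of the weighted-sum-rate problem: maximise `∑ₖ αₖ Rₖ` subject to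
`∑ₖ Tr(Vₖ Vₖᴴ) ≤ P`. -/
def IsStationaryWSR (V : Beamformers K M d) : Prop :=
  IsStationaryPoint (fun V' => -S.weightedSumRate V') S.feasibleBeamformers V

/-- Error covariance of user `k` when the noise variance is `v`:
`(I - Uₖᴴ Hₖ Vₖ)(I - Uₖᴴ Hₖ Vₖ)ᴴ + ∑_{m ≠ k} Uₖᴴ Hₖ Vₘ Vₘᴴ Hₖᴴ Uₖ + v Uₖᴴ Uₖ`. -/
noncomputable def errorCov (v : ℝ) (U : Receivers K N d) (V : Beamformers K M d) (k : Fin K) :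
    Matrix (Fin d) (Fin d) ℂ :=
  (1 - (U k)ᴴ * S.H k * V k) * (1 - (U k)ᴴ * S.H k * V k)ᴴ +
    ∑ m ∈ Finset.univ.erase k, (U k)ᴴ * S.H k * V m * (V m)ᴴ * (S.H k)ᴴ * U k +
    v • ((U k)ᴴ * U k)

/-- The mean square error matrix `Ẽₖ` of user `k`, with noise variance `σ²`. -/
noncomputable def mse (U : Receivers K N d) (V : Beamformers K M d) (k : Fin K) :
    Matrix (Fin d) (Fin d) ℂ :=
  S.errorCov (S.σ ^ 2) U V k

/-- The matrix `Eₖ`, in which `σ²` is replaced by `σ² (∑ₘ Tr(Vₘ Vₘᴴ)) / P`. -/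
noncomputable def scaledMse (U : Receivers K N d) (V : Beamformers K M d) (k : Fin K) :
    Matrix (Fin d) (Fin d) ℂ :=
  S.errorCov (power V / S.P * S.σ ^ 2) U V k

/-- Objective `∑ₖ αₖ {Tr(Wₖ Ẽₖ) - log det Wₖ}` of the reformulated problem. For Hermitian positive
definite `Wₖ` the trace and the determinant are real, and taking real parts extends the objective
differentiably to a neighbourhood in the space of all complex matrices. -/
noncomputable def wmmseCost (X : Point K M N d) : ℝ :=
  ∑ k, S.α k * ((Matrix.trace (X.2.1 k * S.mse X.1 X.2.2 k)).re
    - Real.log (Matrix.det (X.2.1 k)).re)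

/-- Triples `(U, W, V)` with every `Wₖ` positive semidefinite and `∑ₖ Tr(Vₖ Vₖᴴ) ≤ P`. -/
def feasiblePoints : Set (Point K M N d) :=
  {X | (∀ k, (X.2.1 k).PosSemidef) ∧ power X.2.2 ≤ S.P}

/-- Stationary point of the reformulated problem: minimise `∑ₖ αₖ {Tr(Wₖ Ẽₖ) - log det Wₖ}` subject
to `Wₖ ⪰ 0` and `∑ₖ Tr(Vₖ Vₖᴴ) ≤ P`. A stationary point has to lie in the domain of the objective,
which on `Wₖ ⪰ 0` means that every `Wₖ` is positive definite. -/
def IsStationaryWMMSE (X : Point K M N d) : Prop :=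
  (∀ k, (X.2.1 k).PosDef) ∧ IsStationaryPoint S.wmmseCost S.feasiblePoints X

/-! ### The matrix-inverse-free WMMSE algorithm -/

/-- Gradient in `Uₖ` of `∑ₖ αₖ {Tr(Wₖ Eₖ) - log det Wₖ}`. -/
noncomputable def gradU (X : Point K M N d) (k : Fin K) : Matrix (Fin N) (Fin d) ℂ :=
  (2 * S.α k) • ((-(S.H k * X.2.2 k) +
      (∑ m, S.H k * X.2.2 m * (X.2.2 m)ᴴ) * (S.H k)ᴴ * X.1 k) * X.2.1 k) +
    (2 * S.α k * S.σ ^ 2 / S.P * power X.2.2) • (X.1 k * X.2.1 k)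

/-- Gradient in `Vₖ` of `∑ₖ αₖ {Tr(Wₖ Eₖ) - log det Wₖ}`. -/
noncomputable def gradV (X : Point K M N d) (k : Fin K) : Matrix (Fin M) (Fin d) ℂ :=
  ∑ m, (2 * S.α m) • ((S.H m)ᴴ * X.1 m * X.2.1 m * (X.1 m)ᴴ * S.H m * X.2.2 k) -
    (2 * S.α k) • ((S.H k)ᴴ * X.1 k * X.2.1 k) +
    (2 * (S.σ ^ 2 / S.P *
      ∑ m, S.α m * (Matrix.trace (X.2.1 m * (X.1 m)ᴴ * X.1 m)).re)) • X.2.2 k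

/-- One gradient step on `U` with step size `γ`. -/
noncomputable def stepU (γ : ℝ) (X : Point K M N d) : Point K M N d :=
  (fun k => X.1 k - γ • S.gradU X k, X.2.1, X.2.2)

/-- One Schulz iteration on `W`. -/
noncomputable def stepW (X : Point K M N d) : Point K M N d :=
  (X.1, fun k => X.2.1 k * ((2 : ℝ) • (1 : Matrix (Fin d) (Fin d) ℂ)
    - S.scaledMse X.1 X.2.2 k * X.2.1 k), X.2.2)

/-- The rescaling `V ← β V`, `U ← β⁻¹ U` with `β = √(P / ∑ₘ Tr(Vₘ Vₘᴴ))`. -/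
noncomputable def rescale (X : Point K M N d) : Point K M N d :=
  (fun k => (1 / Real.sqrt (S.P / power X.2.2)) • X.1 k, X.2.1,
    fun k => Real.sqrt (S.P / power X.2.2) • X.2.2 k)

/-- One gradient step on `V` with step size `γ`, followed by the rescaling. -/
noncomputable def stepV (γ : ℝ) (X : Point K M N d) : Point K M N d :=
  S.rescale (X.1, X.2.1, fun k => X.2.2 k - γ • S.gradV X k)

/-- One outer iteration: `Ju` steps on `U`, then `Jw` steps on `W`, then `Jv` steps on `V`. -/
noncomputable def outerIteration (γu γv : ℝ) (Ju Jw Jv : ℕ) (X : Point K M N d) :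
    Point K M N d :=
  (S.stepV γv)^[Jv] (S.stepW^[Jw] ((S.stepU γu)^[Ju] X))

/-- The triple after `l` outer iterations, started at `U = 0`, `W = I`, `V = V₀`. -/
noncomputable def iterates (γu γv : ℝ) (Ju Jw Jv : ℕ) (V₀ : Beamformers K M d) (l : ℕ) :
    Point K M N d :=
  (S.outerIteration γu γv Ju Jw Jv)^[l] (0, 1, V₀)

/-! ### Step-size bounds

`κ` bounds the squared spectral norms of the channels, `a` bounds the priorities, and `δ` is the
root of `x - x² - log (2 - x)` in `(1, 2)`. -/

/-- Smoothness constant of the objective in `U`. -/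
noncomputable def Lu (κ a δ : ℝ) : ℝ :=
  2 * a * δ * (S.P * κ + S.σ ^ 2) ^ 2 / S.σ ^ 2

/-- Smoothness constant of the objective in `V`. -/
noncomputable def Lv (κ a δ : ℝ) : ℝ :=
  2 * a * K * δ * (S.P * κ + d * S.σ ^ 2) / (S.P * S.σ ^ 2)

/-- Bound on the gradient in `U`. -/
noncomputable def μu (κ a δ : ℝ) : ℝ :=
  2 * a * δ * √(S.P * κ + S.σ ^ 2) *
    (1 + (S.P * κ + √(S.P * κ * (S.P * κ + S.σ ^ 2))) / S.σ ^ 2)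

/-- Bound on the gradient in `V`. -/
noncomputable def μv (κ a δ : ℝ) : ℝ :=
  2 * a * δ * ((K * S.P * κ + √(S.P * κ * (S.P * κ + S.σ ^ 2)) + K * d * S.σ ^ 2) /
    (√S.P * S.σ ^ 2))

noncomputable def Lc (κ a δ : ℝ) : ℝ :=
  S.μu κ a δ ^ 2 * (δ * (S.P * κ + S.σ ^ 2) ^ 2 / S.σ ^ 2)

noncomputable def Ld (κ a δ : ℝ) : ℝ :=
  2 * S.μu κ a δ * δ * (S.P * κ + S.σ ^ 2) *
    ((√(S.P * κ) + √(S.P * κ + S.σ ^ 2)) / S.σ ^ 2)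

noncomputable def La (κ a δ : ℝ) : ℝ :=
  K * S.μv κ a δ ^ 2 * δ * (κ + d * S.σ ^ 2 / S.P) / S.σ ^ 2

noncomputable def Lb (κ a δ : ℝ) : ℝ :=
  (2 * K * √S.P * S.μv κ a δ * δ * (κ + √(d : ℝ) * S.σ ^ 2 / S.P) +
    2 * S.μv κ a δ * δ * √(κ * (S.P * κ + S.σ ^ 2))) / S.σ ^ 2

/-- Positive root `γ` of `Lc γ² + Ld γ = (δ - 1) / (Ju + Jv)`. -/
noncomputable def νu (κ a δ : ℝ) (Ju Jv : ℕ) : ℝ :=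
  (-S.Ld κ a δ + √(S.Ld κ a δ ^ 2 + 4 * S.Lc κ a δ * ((δ - 1) / ((Ju : ℝ) + Jv)))) /
    (2 * S.Lc κ a δ)

/-- Positive root `γ` of `La γ² + Lb γ = (δ - 1) / (Ju + Jv)`. -/
noncomputable def νv (κ a δ : ℝ) (Ju Jv : ℕ) : ℝ :=
  (-S.Lb κ a δ + √(S.Lb κ a δ ^ 2 + 4 * S.La κ a δ * ((δ - 1) / ((Ju : ℝ) + Jv)))) /
    (2 * S.La κ a δ)

end System

/-- Spectral norm of a rectangular complex matrix: its operator norm between Euclidean spaces. -/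
noncomputable def spectralNorm {m n : ℕ} (A : Matrix (Fin m) (Fin n) ℂ) : ℝ :=
  ‖LinearMap.toContinuousLinearMap (Matrix.toEuclideanLin A)‖

end WMMSE

/-!
Why the theorem is true.

*The cost and its invariance.* The algorithm decreases the cost
`f = ∑ₖ αₖ {Tr(Wₖ Eₖ) - log det Wₖ}`, which does not change under `(U, V) ↦ (β⁻¹ U, β V)` and agrees
with the objective of the reformulated problem when the power constraint is active. It is a convex
quadratic polynomial in `U` and in `V`, so gradient steps shorter than `1 / L` decrease it by at least
`γ / 2` times the squared gradient. A Schulz step acts on each eigenvalue `x` of `Wₖ Eₖ` by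
`x ↦ x (2 - x)` and changes the cost by `x - x² - log (2 - x)`; this is nonpositive on `(0, δ]`, and on
`(0, δ)` it vanishes only at `x = 1`.

*The invariant region.* What has to be controlled is that the eigenvalues of `Wₖ Eₖ` stay below `δ`
(`System.Admissible`). Schulz steps bring them to at most `1`. Writing `Wₖ = F Fᴴ` and `Eₖ` as a Gram
matrix `Tᴴ T`, where `T` is affine in `U` and in `V`, the largest eigenvalue of `Wₖ Eₖ` is the squared
norm of `T F`. A gradient step moves `T F` by at most `γ √Lc`, respectively `γ √La`, so it raises the
eigenvalue bound by at most `Lc γ² + Ld γ`, respectively `La γ² + Lb γ`, hence by at most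
`(δ - 1) / (Ju + Jv)`. The `Ju + Jv` gradient steps between two rounds of Schulz steps therefore keep
it below `δ` (`System.Admissible.outerIteration`).

*Limit points.* The region is closed, once the bound on the cost is used to keep the determinants of
the weights away from zero. One outer iteration is continuous there, so it does not decrease the cost
at a limit point. At the start of an outer iteration the eigenvalue bound is strictly smaller than
`δ`; the first steps in `U`, `W` and `V` being strict unless stationary, it follows that
`∇ᵤ f = 0`, `Wₖ = Eₖ⁻¹` and `∇ᵥ f = 0` (`System.stationary_of_mapClusterPt`).

*Relating the two problems.* For positive definite weights the objective of the reformulated problem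
is at least `∑ₖ αₖ (d - Rₖ)`, with equality when `Uₖ` is the MMSE receiver and `Wₖ` the inverse error
covariance (`System.Matched`). At such a point the difference of the two sides is minimal, so their
derivatives agree in all feasible directions (`System.fderiv_wmmseCost_eq`), and stationarity in one
problem is stationarity in the other. At a limit point the beamformers minimise the convex quadratic
`f` over all `V`, hence the reformulated objective over the power constraint; this gives the
stationarity inequality. In the converse direction one chooses the matched `U` and `W`.
-/

namespace WMMSE

/-! ### Simultaneous diagonalization and the Schulz iteration -/

section Diagonalization

variable {n : Type*} [Fintype n] [DecidableEq n]

lemma exists_unitary_diagonalization {A : Matrix n n ℂ} (hA : A.IsHermitian) :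
    ∃ C : Matrix n n ℂ, C * Cᴴ = 1 ∧ Cᴴ * C = 1 ∧
      A = C * Matrix.diagonal (fun i => (hA.eigenvalues i : ℂ)) * Cᴴ := by
  refine ⟨hA.eigenvectorUnitary, ?_, ?_, ?_⟩
  · exact Matrix.mem_unitaryGroup_iff.mp hA.eigenvectorUnitary.2
  · exact Matrix.mem_unitaryGroup_iff'.mp hA.eigenvectorUnitary.2
  · conv_lhs => rw [hA.spectral_theorem]
    rfl

/-- A positive definite `W` and a Hermitian `E` are diagonalized by one congruence:
`W = S Sᴴ` and `Sᴴ E S` is diagonal. Its entries are the eigenvalues of `W E`. -/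
lemma exists_simultaneous_diagonalization {W E : Matrix n n ℂ} (hW : W.PosDef)
    (hE : E.IsHermitian) :
    ∃ (S : Matrix n n ℂ) (l : n → ℝ), IsUnit S ∧ W = S * Sᴴ ∧
      Sᴴ * E * S = Matrix.diagonal (fun i => (l i : ℂ)) := by
  obtain ⟨C, hC, hC', hWC⟩ := exists_unitary_diagonalization hW.isHermitian
  set R : Matrix n n ℂ := C * Matrix.diagonal (fun i => (√(hW.isHermitian.eigenvalues i) : ℂ))
    with hR
  have hRR : W = R * Rᴴ := by
    rw [hR, Matrix.conjTranspose_mul, Matrix.diagonal_conjTranspose, Matrix.mul_assoc,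
      ← Matrix.mul_assoc (Matrix.diagonal _), Matrix.diagonal_mul_diagonal, ← Matrix.mul_assoc]
    conv_lhs => rw [hWC]
    congr 3
    ext i
    have := (hW.eigenvalues_pos i).le
    simp only [Pi.star_apply, RCLike.star_def, Complex.conj_ofReal]
    rw [← Complex.ofReal_mul, Real.mul_self_sqrt this]
  have hQ : (Rᴴ * E * R).IsHermitian := Matrix.isHermitian_conjTranspose_mul_mul R hE
  obtain ⟨D, hD, hD', hQD⟩ := exists_unitary_diagonalization hQ
  have hU : IsUnit R := by
    have := hW.isUnit
    rw [hRR] at this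
    exact isUnit_of_mul_isUnit_left this
  refine ⟨R * D, hQ.eigenvalues, hU.mul (IsUnit.of_mul_eq_one _ hD), ?_, ?_⟩
  · rw [Matrix.conjTranspose_mul, Matrix.mul_assoc, ← Matrix.mul_assoc D, hD, Matrix.one_mul, hRR]
  · rw [Matrix.conjTranspose_mul]
    calc Dᴴ * Rᴴ * E * (R * D) = Dᴴ * (Rᴴ * E * R) * D := by simp only [Matrix.mul_assoc]
      _ = (Dᴴ * D) * Matrix.diagonal (fun i => (hQ.eigenvalues i : ℂ)) * (Dᴴ * D) := by
        conv_lhs => rw [hQD]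
        simp only [Matrix.mul_assoc]
      _ = _ := by rw [hD', Matrix.one_mul, Matrix.mul_one]

variable {W E S : Matrix n n ℂ} {l : n → ℝ}

lemma mul_diagonal_mul_conjTranspose_posSemidef_iff (hS : IsUnit S) (m : n → ℝ) :
    (S * Matrix.diagonal (fun i => (m i : ℂ)) * Sᴴ).PosSemidef ↔ ∀ i, 0 ≤ m i := by
  rw [← Matrix.star_eq_conjTranspose, Matrix.IsUnit.posSemidef_star_right_conjugate_iff hS,
    Matrix.posSemidef_diagonal_iff]
  exact forall_congr' fun i => by rw [Complex.zero_le_real]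

lemma mul_diagonal_mul_conjTranspose_posDef_iff (hS : IsUnit S) (m : n → ℝ) :
    (S * Matrix.diagonal (fun i => (m i : ℂ)) * Sᴴ).PosDef ↔ ∀ i, 0 < m i := by
  rw [← Matrix.star_eq_conjTranspose, Matrix.IsUnit.posDef_star_right_conjugate_iff hS,
    Matrix.posDef_diagonal_iff]
  exact forall_congr' fun i => by rw [Complex.zero_lt_real]

lemma eq_mul_diagonal_one (hW : W = S * Sᴴ) :
    W = S * Matrix.diagonal (fun _ => ((1 : ℝ) : ℂ)) * Sᴴ := by
  simp [hW]

lemma mul_mul_self_eq (hW : W = S * Sᴴ)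
    (hl : Sᴴ * E * S = Matrix.diagonal (fun i => (l i : ℂ))) :
    W * E * W = S * Matrix.diagonal (fun i => (l i : ℂ)) * Sᴴ := by
  rw [← hl, hW]; simp only [Matrix.mul_assoc]

lemma smul_sub_mul_mul_self_eq (hW : W = S * Sᴴ)
    (hl : Sᴴ * E * S = Matrix.diagonal (fun i => (l i : ℂ))) (c : ℝ) :
    c • W - W * E * W = S * Matrix.diagonal (fun i => ((c - l i : ℝ) : ℂ)) * Sᴴ := by
  have h : Matrix.diagonal (fun i => ((c - l i : ℝ) : ℂ))
      = c • (1 : Matrix n n ℂ) - Matrix.diagonal (fun i => (l i : ℂ)) := by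
    ext i j
    by_cases hij : i = j
    · subst hij; simp
    · simp [hij]
  rw [mul_mul_self_eq hW hl, h, hW, Matrix.mul_sub, Matrix.sub_mul]
  simp

/-- The condition `W E W ⪯ c W` says that the eigenvalues of `W E` are at most `c`. -/
lemma posSemidef_smul_sub_iff (hS : IsUnit S) (hW : W = S * Sᴴ)
    (hl : Sᴴ * E * S = Matrix.diagonal (fun i => (l i : ℂ))) (c : ℝ) :
    (c • W - W * E * W).PosSemidef ↔ ∀ i, l i ≤ c := by
  rw [smul_sub_mul_mul_self_eq hW hl, mul_diagonal_mul_conjTranspose_posSemidef_iff hS]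
  simp

lemma diagonalization_pos (hS : IsUnit S) (hE : E.PosDef)
    (hl : Sᴴ * E * S = Matrix.diagonal (fun i => (l i : ℂ))) (i : n) : 0 < l i := by
  have h := hE.conjTranspose_mul_mul_same (Matrix.mulVec_injective_of_isUnit hS)
  rw [hl, Matrix.posDef_diagonal_iff] at h
  exact Complex.zero_lt_real.mp (h i)

lemma trace_mul_eq_sum (m : n → ℝ)
    (hl : Sᴴ * E * S = Matrix.diagonal (fun i => (l i : ℂ))) :
    (Matrix.trace (S * Matrix.diagonal (fun i => (m i : ℂ)) * Sᴴ * E)).re = ∑ i, m i * l i := by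
  have h1 : S * Matrix.diagonal (fun i => (m i : ℂ)) * Sᴴ * E
      = S * (Matrix.diagonal (fun i => (m i : ℂ)) * Sᴴ * E) := by
    simp only [Matrix.mul_assoc]
  have h2 : Matrix.diagonal (fun i => (m i : ℂ)) * Sᴴ * E * S
      = Matrix.diagonal (fun i => (m i : ℂ)) * (Sᴴ * E * S) := by
    simp only [Matrix.mul_assoc]
  rw [h1, Matrix.trace_mul_comm, h2, hl, Matrix.diagonal_mul_diagonal, Matrix.trace_diagonal,
    Complex.re_sum]
  exact Finset.sum_congr rfl fun i _ => by rw [← Complex.ofReal_mul, Complex.ofReal_re]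

lemma det_re_pos (hW : W.PosDef) : 0 < W.det.re := (Complex.lt_def.mp hW.det_pos).1

lemma det_im_eq_zero (hW : W.IsHermitian) : W.det.im = 0 := by
  have h : (starRingEnd ℂ) W.det = W.det := by
    have := Matrix.det_conjTranspose W
    rw [hW.eq] at this
    exact this.symm
  exact Complex.conj_eq_iff_im.mp h

lemma det_re_mul (hW : W.PosDef) (hE : E.IsHermitian) :
    (W * E).det.re = W.det.re * E.det.re := by
  rw [Matrix.det_mul, Complex.mul_re, det_im_eq_zero hW.isHermitian, det_im_eq_zero hE]
  ring

lemma log_det_mul_diagonal (hS : IsUnit S) {m : n → ℝ} (hm : ∀ i, 0 < m i) :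
    Real.log (S * Matrix.diagonal (fun i => (m i : ℂ)) * Sᴴ).det.re
      = Real.log (S * Sᴴ).det.re + ∑ i, Real.log (m i) := by
  have h1 : (S * Matrix.diagonal (fun i => (m i : ℂ)) * Sᴴ).det
      = (S * Sᴴ).det * ((∏ i, m i : ℝ) : ℂ) := by
    rw [Matrix.det_mul, Matrix.det_mul, Matrix.det_diagonal, Matrix.det_mul]
    push_cast
    ring
  have h2 : (S * Sᴴ).PosDef := by
    have := (mul_diagonal_mul_conjTranspose_posDef_iff hS (fun _ => 1)).mpr fun _ => one_pos
    simpa using this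
  rw [h1, Complex.re_mul_ofReal, Real.log_mul (det_re_pos h2).ne'
    (Finset.prod_pos fun i _ => hm i).ne', Real.log_prod (fun i _ => (hm i).ne')]

/-- `Tr (W E) - log det W ≥ d + log det E`, from `x - log x ≥ 1` for the eigenvalues of `W E`. -/
lemma card_add_log_det_le (hW : W.PosDef) (hE : E.PosDef) :
    (Fintype.card n : ℝ) + Real.log E.det.re
      ≤ (Matrix.trace (W * E)).re - Real.log W.det.re := by
  obtain ⟨S, l, hS, hWS, hl⟩ := exists_simultaneous_diagonalization hW hE.isHermitian
  have hpos := diagonalization_pos hS hE hl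
  have h1 : (Matrix.trace (W * E)).re = ∑ i, l i := by
    conv_lhs => rw [eq_mul_diagonal_one hWS]
    rw [trace_mul_eq_sum _ hl]; simp
  have h2 : Real.log W.det.re + Real.log E.det.re = ∑ i, Real.log (l i) := by
    rw [← Real.log_mul (det_re_pos hW).ne' (det_re_pos hE).ne', ← det_re_mul hW hE.isHermitian,
      hWS, Matrix.mul_assoc, Matrix.det_mul_comm, hl, Matrix.det_diagonal,
      ← Complex.ofReal_prod, Complex.ofReal_re, Real.log_prod (fun i _ => (hpos i).ne')]
  have h3 : ∑ i, (1 + Real.log (l i)) ≤ ∑ i, l i :=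
    Finset.sum_le_sum fun i _ => by linarith [Real.log_le_sub_one_of_pos (hpos i)]
  rw [Finset.sum_add_distrib] at h3
  simp only [Finset.sum_const, Finset.card_univ, nsmul_eq_mul, mul_one] at h3
  linarith

lemma trace_sub_log_det_eq (hW : W.PosDef) (hE : E.PosDef) (h : W * E = 1) :
    (Matrix.trace (W * E)).re - Real.log W.det.re
      = (Fintype.card n : ℝ) + Real.log E.det.re := by
  have h1 : W.det.re * E.det.re = 1 := by
    rw [← det_re_mul hW hE.isHermitian, h]; simp
  have h2 : Real.log W.det.re + Real.log E.det.re = 0 := by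
    rw [← Real.log_mul (det_re_pos hW).ne' (det_re_pos hE).ne', h1, Real.log_one]
  rw [h, Matrix.trace_one]
  simp only [Complex.natCast_re]
  linarith

/-- Along a Hermitian direction, positive definiteness persists for small times. -/
lemma eventually_posDef_add_smul (hW : W.PosDef) {D : Matrix n n ℂ} (hD : D.IsHermitian) :
    ∀ᶠ t : ℝ in nhds 0, (W + t • D).PosDef := by
  obtain ⟨S, l, hS, hWS, hl⟩ := exists_simultaneous_diagonalization hW.inv hD
  have hSi : IsUnit S⁻¹ := (Matrix.isUnit_nonsing_inv_iff).mpr hS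
  have hSd : IsUnit S.det := (Matrix.isUnit_iff_isUnit_det S).mp hS
  have hSHd : IsUnit Sᴴ.det := by rw [Matrix.det_conjTranspose]; exact hSd.star
  have hWd : IsUnit W.det := (Matrix.isUnit_iff_isUnit_det W).mp hW.isUnit
  have hW' : W = Sᴴ⁻¹ * S⁻¹ := by
    rw [← Matrix.mul_inv_rev, ← hWS, Matrix.nonsing_inv_nonsing_inv _ hWd]
  have hD' : D = Sᴴ⁻¹ * Matrix.diagonal (fun i => (l i : ℂ)) * S⁻¹ := by
    rw [← hl, Matrix.mul_assoc, Matrix.mul_assoc, Matrix.mul_nonsing_inv _ hSd, Matrix.mul_one,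
      ← Matrix.mul_assoc, Matrix.nonsing_inv_mul _ hSHd, Matrix.one_mul]
  have key : ∀ t : ℝ, W + t • D = Sᴴ⁻¹ * Matrix.diagonal (fun i => ((1 + t * l i : ℝ) : ℂ))
      * (Sᴴ⁻¹)ᴴ := by
    intro t
    have h : Matrix.diagonal (fun i => ((1 + t * l i : ℝ) : ℂ))
        = 1 + t • Matrix.diagonal (fun i => (l i : ℂ)) := by
      ext i j
      by_cases hij : i = j
      · subst hij; simp
      · simp [hij]
    have h' : (Sᴴ⁻¹)ᴴ = S⁻¹ := by
      rw [Matrix.conjTranspose_nonsing_inv, Matrix.conjTranspose_conjTranspose]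
    rw [h, h', Matrix.mul_add, Matrix.add_mul, Matrix.mul_one, ← hW']
    congr 1
    rw [hD']
    simp
  have hu : IsUnit Sᴴ⁻¹ := by
    rw [← Matrix.conjTranspose_nonsing_inv]
    exact hSi.star
  have : ∀ i, ∀ᶠ t : ℝ in nhds 0, 0 < 1 + t * l i := fun i => by
    have hc : ContinuousAt (fun t : ℝ => 1 + t * l i) 0 := by fun_prop
    exact hc.eventually (lt_mem_nhds (by simp))
  filter_upwards [Filter.eventually_all.mpr this] with t ht
  rw [key, mul_diagonal_mul_conjTranspose_posDef_iff hu]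
  exact ht

end Diagonalization

/-- The change of `x - log x` caused by a Schulz step `x ↦ x (2 - x)`. -/
noncomputable def schulzGain (x : ℝ) : ℝ := x - x ^ 2 - Real.log (2 - x)

lemma hasDerivAt_schulzGain {x : ℝ} (hx : x < 2) :
    HasDerivAt schulzGain ((2 * x - 3) * (x - 1) / (2 - x)) x := by
  have h2 : (2 - x) ≠ 0 := by linarith
  have h := ((hasDerivAt_id x).sub (hasDerivAt_pow 2 x)).sub
    (((hasDerivAt_id x).const_sub 2).log h2)
  refine h.congr_deriv ?_
  simp only [id]
  field_simp
  ring

lemma schulzGain_neg {δ : ℝ} (hδ2 : δ < 2) (hδ : schulzGain δ = 0) {x : ℝ}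
    (hx0 : 0 < x) (hx : x < δ) (hx1 : x ≠ 1) : schulzGain x < 0 := by
  have hone : schulzGain 1 = 0 := by norm_num [schulzGain]
  have hcont : ∀ s : Set ℝ, (∀ y ∈ s, y < 2) → ContinuousOn schulzGain s := fun s hs y hy =>
    (hasDerivAt_schulzGain (hs y hy)).continuousAt.continuousWithinAt
  rcases lt_or_gt_of_ne hx1 with h1 | h1
  · have hm : StrictMonoOn schulzGain (Set.Icc 0 1) := by
      refine strictMonoOn_of_deriv_pos (convex_Icc _ _)
        (hcont _ fun y hy => by linarith [hy.2]) fun y hy => ?_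
      rw [interior_Icc] at hy
      rw [(hasDerivAt_schulzGain (by linarith [hy.2])).deriv]
      exact div_pos (mul_pos_of_neg_of_neg (by linarith [hy.2]) (by linarith [hy.2]))
        (by linarith [hy.2])
    have := hm ⟨hx0.le, h1.le⟩ ⟨zero_le_one, le_refl 1⟩ h1
    linarith
  · rcases le_or_gt x (3 / 2) with h3 | h3
    · have hm : StrictAntiOn schulzGain (Set.Icc 1 (3 / 2)) := by
        refine strictAntiOn_of_deriv_neg (convex_Icc _ _)
          (hcont _ fun y hy => by linarith [hy.2]) fun y hy => ?_
        rw [interior_Icc] at hy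
        rw [(hasDerivAt_schulzGain (by linarith [hy.2])).deriv]
        exact div_neg_of_neg_of_pos (mul_neg_of_neg_of_pos (by linarith [hy.2])
          (by linarith [hy.1])) (by linarith [hy.2])
      have := hm ⟨le_refl 1, by norm_num⟩ ⟨h1.le, h3⟩ h1
      linarith
    · have hm : StrictMonoOn schulzGain (Set.Icc (3 / 2) δ) := by
        refine strictMonoOn_of_deriv_pos (convex_Icc _ _)
          (hcont _ fun y hy => by linarith [hy.2]) fun y hy => ?_
        rw [interior_Icc] at hy
        rw [(hasDerivAt_schulzGain (by linarith [hy.2])).deriv]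
        exact div_pos (mul_pos (by linarith [hy.1]) (by linarith [hy.1])) (by linarith [hy.2])
      have := hm ⟨h3.le, hx.le⟩ ⟨(h3.trans hx).le, le_refl δ⟩ hx
      linarith

lemma schulzGain_nonpos {δ : ℝ} (hδ2 : δ < 2) (hδ : schulzGain δ = 0) {x : ℝ}
    (hx0 : 0 < x) (hx : x ≤ δ) : schulzGain x ≤ 0 := by
  rcases hx.eq_or_lt with rfl | h
  · exact hδ.le
  · by_cases h1 : x = 1
    · subst h1; norm_num [schulzGain]
    · exact (schulzGain_neg hδ2 hδ hx0 h h1).le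

section Schulz

variable {n : Type*} [Fintype n] [DecidableEq n] {W E S : Matrix n n ℂ} {l : n → ℝ} {c δ : ℝ}

/-- One Schulz iteration for the inverse of `E`. -/
noncomputable def schulz (E W : Matrix n n ℂ) : Matrix n n ℂ :=
  W * ((2 : ℝ) • (1 : Matrix n n ℂ) - E * W)

lemma schulz_eq (hW : W = S * Sᴴ)
    (hl : Sᴴ * E * S = Matrix.diagonal (fun i => (l i : ℂ))) :
    schulz E W = S * Matrix.diagonal (fun i => ((2 - l i : ℝ) : ℂ)) * Sᴴ := by
  rw [← smul_sub_mul_mul_self_eq hW hl, schulz, Matrix.mul_sub, Matrix.mul_assoc]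
  simp

lemma schulz_posDef (hW : W.PosDef) (hE : E.IsHermitian) (hc : c < 2)
    (h : (c • W - W * E * W).PosSemidef) : (schulz E W).PosDef := by
  obtain ⟨S, l, hS, hWS, hl⟩ := exists_simultaneous_diagonalization hW hE
  rw [posSemidef_smul_sub_iff hS hWS hl] at h
  rw [schulz_eq hWS hl, mul_diagonal_mul_conjTranspose_posDef_iff hS]
  intro i
  linarith [h i]

/-- After a Schulz step the eigenvalues `x (2 - x) = 1 - (1 - x)²` of `W E` are at most `1`. -/
lemma schulz_bound (hW : W.PosDef) (hE : E.IsHermitian) (hc : c < 2)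
    (h : (c • W - W * E * W).PosSemidef) :
    ((1 : ℝ) • schulz E W - schulz E W * E * schulz E W).PosSemidef := by
  obtain ⟨S, l, hS, hWS, hl⟩ := exists_simultaneous_diagonalization hW hE
  rw [posSemidef_smul_sub_iff hS hWS hl] at h
  have h1 : schulz E W * E * schulz E W
      = S * Matrix.diagonal (fun i => ((2 - l i) * l i * (2 - l i) : ℝ) : n → ℂ) * Sᴴ := by
    have : schulz E W * E * schulz E W
      = S * (Matrix.diagonal (fun i => ((2 - l i : ℝ) : ℂ)) * (Sᴴ * E * S)
        * Matrix.diagonal (fun i => ((2 - l i : ℝ) : ℂ))) * Sᴴ := by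
      rw [schulz_eq hWS hl]; simp only [Matrix.mul_assoc]
    rw [this, hl, Matrix.diagonal_mul_diagonal, Matrix.diagonal_mul_diagonal]
    congr 3
    ext i
    push_cast
    ring
  have h2 : (1 : ℝ) • schulz E W - schulz E W * E * schulz E W
      = S * Matrix.diagonal (fun i => ((2 - l i) * (1 - l i) ^ 2 : ℝ) : n → ℂ) * Sᴴ := by
    rw [h1, one_smul, schulz_eq hWS hl, ← Matrix.sub_mul, ← Matrix.mul_sub, Matrix.diagonal_sub]
    congr 3
    ext i
    push_cast
    ring
  rw [h2, mul_diagonal_mul_conjTranspose_posSemidef_iff hS]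
  intro i
  exact mul_nonneg (by linarith [h i]) (sq_nonneg _)

lemma schulz_gain (hS : IsUnit S) (hWS : W = S * Sᴴ)
    (hl : Sᴴ * E * S = Matrix.diagonal (fun i => (l i : ℂ))) (hl2 : ∀ i, l i < 2) :
    (Matrix.trace (schulz E W * E)).re - Real.log (schulz E W).det.re
      = (Matrix.trace (W * E)).re - Real.log W.det.re + ∑ i, schulzGain (l i) := by
  have h1 : (Matrix.trace (W * E)).re = ∑ i, l i := by
    conv_lhs => rw [eq_mul_diagonal_one hWS]
    rw [trace_mul_eq_sum _ hl]; simp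
  rw [schulz_eq hWS hl, trace_mul_eq_sum _ hl,
    log_det_mul_diagonal hS (fun i => by linarith [hl2 i]), h1, ← hWS]
  have : ∑ i, (2 - l i) * l i = ∑ i, l i + ∑ i, schulzGain (l i) + ∑ i, Real.log (2 - l i) := by
    rw [← Finset.sum_add_distrib, ← Finset.sum_add_distrib]
    exact Finset.sum_congr rfl fun i _ => by unfold schulzGain; ring
  linarith

lemma schulz_descent (hW : W.PosDef) (hE : E.PosDef) (hδ2 : δ < 2) (hδ : schulzGain δ = 0)
    (h : (δ • W - W * E * W).PosSemidef) :
    (Matrix.trace (schulz E W * E)).re - Real.log (schulz E W).det.re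
      ≤ (Matrix.trace (W * E)).re - Real.log W.det.re := by
  obtain ⟨S, l, hS, hWS, hl⟩ := exists_simultaneous_diagonalization hW hE.isHermitian
  have hpos := diagonalization_pos hS hE hl
  rw [posSemidef_smul_sub_iff hS hWS hl] at h
  rw [schulz_gain hS hWS hl fun i => by linarith [h i]]
  have : ∑ i, schulzGain (l i) ≤ 0 :=
    Finset.sum_nonpos fun i _ => schulzGain_nonpos hδ2 hδ (hpos i) (h i)
  linarith

/-- A Schulz step that starts strictly inside the admissible region and gains nothing starts at
the inverse of `E`. -/
lemma mul_eq_one_of_schulz_stationary (hW : W.PosDef) (hE : E.PosDef) (hδ2 : δ < 2)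
    (hδ : schulzGain δ = 0) (hc : c < δ) (h : (c • W - W * E * W).PosSemidef)
    (hge : (Matrix.trace (W * E)).re - Real.log W.det.re
      ≤ (Matrix.trace (schulz E W * E)).re - Real.log (schulz E W).det.re) :
    W * E = 1 := by
  obtain ⟨S, l, hS, hWS, hl⟩ := exists_simultaneous_diagonalization hW hE.isHermitian
  have hpos := diagonalization_pos hS hE hl
  rw [posSemidef_smul_sub_iff hS hWS hl] at h
  rw [schulz_gain hS hWS hl fun i => by linarith [h i]] at hge
  have hnp : ∀ i ∈ Finset.univ, schulzGain (l i) ≤ 0 := fun i _ =>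
    schulzGain_nonpos hδ2 hδ (hpos i) ((h i).trans hc.le)
  have hz := (Finset.sum_eq_zero_iff_of_nonpos hnp).mp
    (le_antisymm (Finset.sum_nonpos hnp) (by linarith))
  have hl1 : ∀ i, l i = 1 := fun i => by
    by_contra hne
    exact absurd (hz i (Finset.mem_univ i))
      (schulzGain_neg hδ2 hδ (hpos i) ((h i).trans_lt hc) hne).ne
  have h1 : Sᴴ * E * S = 1 := by rw [hl]; simp [hl1]
  have h2 : S * (Sᴴ * E) = 1 := mul_eq_one_comm.mp h1
  rw [hWS, Matrix.mul_assoc, h2]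

end Schulz

/-! ### Euclidean norms, spectral norms and Frobenius norms -/

section Norms

open scoped Matrix.Norms.L2Operator

/-- Euclidean norm of a complex coordinate vector. -/
noncomputable def vnorm {n : Type*} [Fintype n] (x : n → ℂ) : ℝ := ‖WithLp.toLp 2 x‖

/-- Squared Frobenius norm. -/
noncomputable def frob {m n : Type*} [Fintype m] [Fintype n] (A : Matrix m n ℂ) : ℝ :=
  (Matrix.trace (A * Aᴴ)).re

variable {l m n : Type*} [Fintype l] [Fintype m] [Fintype n]

lemma vnorm_nonneg (x : n → ℂ) : 0 ≤ vnorm x := norm_nonneg _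

lemma vnorm_sq (x : n → ℂ) : vnorm x ^ 2 = ∑ i, ‖x i‖ ^ 2 :=
  EuclideanSpace.norm_sq_eq (WithLp.toLp 2 x)

lemma vnorm_add_le (x y : n → ℂ) : vnorm (x + y) ≤ vnorm x + vnorm y := by
  unfold vnorm; rw [WithLp.toLp_add]; exact norm_add_le _ _

lemma vnorm_neg (x : n → ℂ) : vnorm (-x) = vnorm x := by
  unfold vnorm; rw [WithLp.toLp_neg]; exact norm_neg _

lemma vnorm_sq_eq_dotProduct (x : n → ℂ) : vnorm x ^ 2 = (star x ⬝ᵥ x).re := by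
  rw [vnorm_sq, dotProduct, Complex.re_sum]
  refine Finset.sum_congr rfl fun i _ => ?_
  rw [Pi.star_apply, RCLike.star_def, ← Complex.normSq_eq_conj_mul_self, Complex.ofReal_re,
    Complex.normSq_eq_norm_sq]

lemma re_dotProduct_conjTranspose_mul_self (A : Matrix m n ℂ) (x : n → ℂ) :
    (star x ⬝ᵥ ((Aᴴ * A) *ᵥ x)).re = vnorm (A *ᵥ x) ^ 2 := by
  rw [vnorm_sq_eq_dotProduct, ← Matrix.mulVec_mulVec, Matrix.dotProduct_mulVec, Matrix.star_mulVec]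

lemma frob_eq_sum (A : Matrix m n ℂ) : frob A = ∑ i, ∑ j, ‖A i j‖ ^ 2 := by
  unfold frob
  simp only [Matrix.trace, Matrix.diag_apply, Matrix.mul_apply, Matrix.conjTranspose_apply,
    Complex.re_sum]
  refine Finset.sum_congr rfl fun i _ => Finset.sum_congr rfl fun j _ => ?_
  rw [RCLike.star_def, Complex.mul_conj, Complex.ofReal_re, Complex.normSq_eq_norm_sq]

lemma frob_nonneg (A : Matrix m n ℂ) : 0 ≤ frob A := by
  rw [frob_eq_sum]; positivity

lemma eq_zero_of_frob_eq_zero {A : Matrix m n ℂ} (h : frob A = 0) : A = 0 := by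
  rw [frob_eq_sum, Finset.sum_eq_zero_iff_of_nonneg (fun _ _ => by positivity)] at h
  ext i j
  have := (Finset.sum_eq_zero_iff_of_nonneg (fun _ _ => by positivity)).mp (h i (Finset.mem_univ i))
    j (Finset.mem_univ j)
  simpa using this

lemma frob_conjTranspose (A : Matrix m n ℂ) : frob Aᴴ = frob A := by
  rw [frob_eq_sum, frob_eq_sum, Finset.sum_comm]
  simp

lemma re_trace_conjTranspose_mul_self (A : Matrix m n ℂ) : (Matrix.trace (Aᴴ * A)).re = frob A := by
  rw [← frob_conjTranspose, frob, Matrix.conjTranspose_conjTranspose]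

lemma frob_smul (r : ℝ) (A : Matrix m n ℂ) : frob (r • A) = r ^ 2 * frob A := by
  rw [frob_eq_sum, frob_eq_sum, Finset.mul_sum]
  refine Finset.sum_congr rfl fun i _ => ?_
  rw [Finset.mul_sum]
  refine Finset.sum_congr rfl fun j _ => ?_
  rw [Matrix.smul_apply, norm_smul, mul_pow, Real.norm_eq_abs, sq_abs]

lemma frob_eq_sum_col (A : Matrix m n ℂ) : frob A = ∑ j, vnorm (fun i => A i j) ^ 2 := by
  rw [frob_eq_sum, Finset.sum_comm]
  exact Finset.sum_congr rfl fun j _ => (vnorm_sq _).symm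

lemma vnorm_mulVec_le [DecidableEq n] (A : Matrix m n ℂ) (x : n → ℂ) : vnorm (A *ᵥ x) ≤ ‖A‖ * vnorm x :=
  Matrix.l2_opNorm_mulVec A (WithLp.toLp 2 x)

lemma norm_le_of_vnorm_mulVec_le [DecidableEq n] {A : Matrix m n ℂ} {c : ℝ} (hc : 0 ≤ c)
    (h : ∀ x, vnorm (A *ᵥ x) ≤ c * vnorm x) : ‖A‖ ≤ c := by
  rw [Matrix.l2_opNorm_def]
  exact ContinuousLinearMap.opNorm_le_bound _ hc fun x => h x.ofLp

lemma norm_real_smul [DecidableEq n] (r : ℝ) (A : Matrix m n ℂ) : ‖r • A‖ = |r| * ‖A‖ := by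
  have : r • A = (r : ℂ) • A := by ext i j; simp
  rw [this, norm_smul, Complex.norm_real, Real.norm_eq_abs]

lemma norm_mul_conjTranspose_self [DecidableEq m] [DecidableEq n] (A : Matrix m n ℂ) : ‖A * Aᴴ‖ = ‖A‖ ^ 2 := by
  have := Matrix.l2_opNorm_conjTranspose_mul_self Aᴴ
  rw [Matrix.conjTranspose_conjTranspose, Matrix.l2_opNorm_conjTranspose] at this
  rw [this, sq]

lemma frob_mul_le [DecidableEq m] (A : Matrix l m ℂ) (B : Matrix m n ℂ) : frob (A * B) ≤ ‖A‖ ^ 2 * frob B := by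
  rw [frob_eq_sum_col, frob_eq_sum_col, Finset.mul_sum]
  refine Finset.sum_le_sum fun j _ => ?_
  rw [← mul_pow]
  exact pow_le_pow_left₀ (vnorm_nonneg _) (vnorm_mulVec_le A fun i => B i j) 2

lemma frob_mul_le' [DecidableEq m] [DecidableEq n] (A : Matrix l m ℂ) (B : Matrix m n ℂ) : frob (A * B) ≤ frob A * ‖B‖ ^ 2 := by
  rw [← frob_conjTranspose, Matrix.conjTranspose_mul, ← frob_conjTranspose A,
    ← Matrix.l2_opNorm_conjTranspose B, mul_comm]
  exact frob_mul_le _ _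

lemma frob_le_card_mul [DecidableEq n] (A : Matrix m n ℂ) : frob A ≤ Fintype.card n * ‖A‖ ^ 2 := by
  have h : frob (1 : Matrix n n ℂ) = Fintype.card n := by simp [frob]
  have := frob_mul_le A (1 : Matrix n n ℂ)
  rwa [Matrix.mul_one, h, mul_comm] at this

lemma norm_sq_le_frob [DecidableEq n] (A : Matrix m n ℂ) : ‖A‖ ^ 2 ≤ frob A := by
  have h : ‖A‖ ≤ √(frob A) := by
    refine norm_le_of_vnorm_mulVec_le (Real.sqrt_nonneg _) fun x => ?_
    have h2 : vnorm (A *ᵥ x) ^ 2 ≤ (√(frob A) * vnorm x) ^ 2 := by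
      rw [mul_pow, Real.sq_sqrt (frob_nonneg A), vnorm_sq, vnorm_sq, frob_eq_sum, Finset.sum_mul]
      refine Finset.sum_le_sum fun i _ => ?_
      refine le_trans ?_ (Finset.sum_mul_sq_le_sq_mul_sq _ _ _)
      refine pow_le_pow_left₀ (norm_nonneg _) ?_ 2
      refine (norm_sum_le _ _).trans_eq ?_
      simp
    exact le_of_sq_le_sq h2 (mul_nonneg (Real.sqrt_nonneg _) (vnorm_nonneg _))
  calc ‖A‖ ^ 2 ≤ √(frob A) ^ 2 := pow_le_pow_left₀ (norm_nonneg _) h 2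
    _ = frob A := Real.sq_sqrt (frob_nonneg A)

end Norms

/-- Minkowski's inequality in the plane, for squared lengths. -/
lemma sq_add_sq_le_of_le {a b a' b' t r : ℝ} (ht : 0 ≤ t) (hr : 0 ≤ r)
    (h : a ^ 2 + b ^ 2 ≤ t ^ 2) (h' : a' ^ 2 + b' ^ 2 ≤ r ^ 2) :
    (a + a') ^ 2 + (b + b') ^ 2 ≤ (t + r) ^ 2 := by
  have hcs : a * a' + b * b' ≤ t * r := by
    refine abs_le_of_sq_le_sq' ?_ (mul_nonneg ht hr) |>.2
    calc (a * a' + b * b') ^ 2 ≤ (a ^ 2 + b ^ 2) * (a' ^ 2 + b' ^ 2) := by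
          nlinarith [sq_nonneg (a * b' - b * a')]
      _ ≤ t ^ 2 * r ^ 2 := by gcongr
      _ = (t * r) ^ 2 := by ring
  nlinarith

section Power

variable {K M d : ℕ}

lemma power_eq_sum_frob (V : Beamformers K M d) : power V = ∑ k, frob (V k) := rfl

lemma power_nonneg (V : Beamformers K M d) : 0 ≤ power V :=
  Finset.sum_nonneg fun k _ => frob_nonneg (V k)

lemma power_smul (r : ℝ) (V : Beamformers K M d) : power (fun k => r • V k) = r ^ 2 * power V := by
  simp only [power_eq_sum_frob, frob_smul, Finset.mul_sum]

lemma sqrt_power_eq_vnorm (V : Beamformers K M d) :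
    √(power V) = vnorm (fun p : Fin K × Fin M × Fin d => V p.1 p.2.1 p.2.2) := by
  rw [← Real.sqrt_sq (vnorm_nonneg _), vnorm_sq, power_eq_sum_frob]
  simp only [frob_eq_sum, Fintype.sum_prod_type]

lemma sqrt_power_add_le (V D : Beamformers K M d) :
    √(power (V + D)) ≤ √(power V) + √(power D) := by
  simp only [sqrt_power_eq_vnorm]
  exact vnorm_add_le _ _

/-- All beamformers side by side, as one `M × (K d)` matrix. -/
def stack (V : Beamformers K M d) : Matrix (Fin M) (Fin K × Fin d) ℂ :=
  Matrix.of fun i p => V p.1 i p.2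

/-- The columns of the identity of size `K d` that belong to user `k`. -/
def userBlock (d : ℕ) (k : Fin K) : Matrix (Fin K × Fin d) (Fin d) ℂ :=
  Matrix.of fun p j => if p.1 = k ∧ p.2 = j then 1 else 0

lemma stack_add (V D : Beamformers K M d) : stack (V + D) = stack V + stack D := rfl

lemma stack_mul_conjTranspose (V : Beamformers K M d) :
    stack V * (stack V)ᴴ = ∑ m, V m * (V m)ᴴ := by
  ext i j
  simp [stack, Matrix.mul_apply, Matrix.sum_apply, Fintype.sum_prod_type]

lemma stack_mul_userBlock (V : Beamformers K M d) (k : Fin K) :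
    stack V * userBlock d k = V k := by
  ext i j
  simp [stack, userBlock, Matrix.mul_apply, Fintype.sum_prod_type, ite_and]

lemma userBlock_conjTranspose_mul_self (k : Fin K) :
    (userBlock d k)ᴴ * userBlock d k = 1 := by
  ext i j
  simp [userBlock, Matrix.mul_apply, Fintype.sum_prod_type, ite_and, Matrix.one_apply, eq_comm]

open scoped Matrix.Norms.L2Operator

lemma norm_stack_sq_le_power (V : Beamformers K M d) : ‖stack V‖ ^ 2 ≤ power V := by
  refine (norm_sq_le_frob _).trans_eq ?_
  rw [frob, stack_mul_conjTranspose, Matrix.trace_sum, Complex.re_sum]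
  rfl

lemma norm_stack_sq_le_sum (V : Beamformers K M d) : ‖stack V‖ ^ 2 ≤ ∑ k, ‖V k‖ ^ 2 := by
  rw [← norm_mul_conjTranspose_self, stack_mul_conjTranspose]
  refine (norm_sum_le _ _).trans_eq ?_
  simp only [norm_mul_conjTranspose_self]

end Power

/-! ### The error covariance as a Gram matrix -/

section ErrorCov

open scoped Matrix.Norms.L2Operator

variable {K M N d : ℕ} (S : System K M N d)

/-- Covariance `Hₖ (∑ₘ Vₘ Vₘᴴ) Hₖᴴ + v I` of the signal received by user `k` when the noise variance
is `v`. -/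
noncomputable def System.receivedCov (v : ℝ) (V : Beamformers K M d) (k : Fin K) :
    Matrix (Fin N) (Fin N) ℂ :=
  S.H k * (∑ m, V m * (V m)ᴴ) * (S.H k)ᴴ + v • (1 : Matrix (Fin N) (Fin N) ℂ)

/-- Adjoint of the noise-free map from all `K d` transmitted symbols to the estimation error of
user `k`. Its Gram matrix is the noise-free part of the error covariance. -/
noncomputable def System.residual (U : Receivers K N d) (V : Beamformers K M d) (k : Fin K) :
    Matrix (Fin K × Fin d) (Fin d) ℂ :=
  userBlock d k - (stack V)ᴴ * ((S.H k)ᴴ * U k)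

lemma System.receivedCov_isHermitian (v : ℝ) (V : Beamformers K M d) (k : Fin K) :
    (S.receivedCov v V k).IsHermitian := by
  unfold System.receivedCov Matrix.IsHermitian
  simp [Matrix.conjTranspose_sum, Matrix.mul_assoc]

lemma System.errorCov_eq (v : ℝ) (U : Receivers K N d) (V : Beamformers K M d) (k : Fin K) :
    S.errorCov v U V k = 1 - (U k)ᴴ * (S.H k * V k) - (S.H k * V k)ᴴ * U k
      + (U k)ᴴ * S.receivedCov v V k * U k := by
  have h : ∑ m, (U k)ᴴ * S.H k * V m * (V m)ᴴ * (S.H k)ᴴ * U k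
      = (U k)ᴴ * (S.H k * (∑ m, V m * (V m)ᴴ) * (S.H k)ᴴ) * U k := by
    simp only [Matrix.mul_sum, Matrix.sum_mul, Matrix.mul_assoc]
  rw [← Finset.add_sum_erase _ _ (Finset.mem_univ k)] at h
  rw [System.errorCov, System.receivedCov, Matrix.mul_add, Matrix.add_mul, ← h]
  simp only [Matrix.conjTranspose_sub, Matrix.conjTranspose_one, Matrix.conjTranspose_mul,
    Matrix.conjTranspose_conjTranspose, Matrix.sub_mul, Matrix.mul_sub, Matrix.one_mul,
    Matrix.mul_one, Matrix.mul_smul, Matrix.smul_mul, Matrix.mul_assoc]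
  abel

lemma System.errorCov_eq_residual (v : ℝ) (U : Receivers K N d) (V : Beamformers K M d)
    (k : Fin K) :
    S.errorCov v U V k
      = (S.residual U V k)ᴴ * S.residual U V k + v • ((U k)ᴴ * U k) := by
  have h1 : (userBlock d k)ᴴ * ((stack V)ᴴ * ((S.H k)ᴴ * U k)) = (S.H k * V k)ᴴ * U k := by
    rw [← Matrix.mul_assoc, ← Matrix.conjTranspose_mul, stack_mul_userBlock,
      Matrix.conjTranspose_mul]
    simp only [Matrix.mul_assoc]
  have h2 : ((U k)ᴴ * (S.H k * stack V)) * userBlock d k = (U k)ᴴ * (S.H k * V k) := by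
    rw [Matrix.mul_assoc, Matrix.mul_assoc, stack_mul_userBlock]
  have h3 : (U k)ᴴ * (S.H k * stack V) * ((stack V)ᴴ * ((S.H k)ᴴ * U k))
      = (U k)ᴴ * (S.H k * (∑ m, V m * (V m)ᴴ) * (S.H k)ᴴ) * U k := by
    rw [← stack_mul_conjTranspose]; simp only [Matrix.mul_assoc]
  rw [S.errorCov_eq, System.residual, System.receivedCov]
  simp only [Matrix.conjTranspose_sub, Matrix.conjTranspose_mul,
    Matrix.conjTranspose_conjTranspose, Matrix.sub_mul, Matrix.mul_sub, Matrix.mul_add,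
    Matrix.add_mul, Matrix.mul_smul, Matrix.smul_mul, Matrix.mul_one]
  rw [h1, userBlock_conjTranspose_mul_self]
  simp only [Matrix.mul_assoc] at h1 h2 h3 ⊢
  rw [h2, h3]
  simp only [Matrix.conjTranspose_mul, Matrix.mul_assoc]
  abel

lemma System.errorCov_isHermitian (v : ℝ) (U : Receivers K N d) (V : Beamformers K M d)
    (k : Fin K) : (S.errorCov v U V k).IsHermitian := by
  rw [S.errorCov_eq_residual]
  unfold Matrix.IsHermitian
  simp

lemma System.re_dotProduct_errorCov (v : ℝ) (U : Receivers K N d) (V : Beamformers K M d)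
    (k : Fin K) (x : Fin d → ℂ) :
    (star x ⬝ᵥ (S.errorCov v U V k *ᵥ x)).re
      = vnorm (S.residual U V k *ᵥ x) ^ 2 + v * vnorm (U k *ᵥ x) ^ 2 := by
  rw [S.errorCov_eq_residual, Matrix.add_mulVec, dotProduct_add, Complex.add_re,
    re_dotProduct_conjTranspose_mul_self, Matrix.smul_mulVec, dotProduct_smul, Complex.smul_re,
    re_dotProduct_conjTranspose_mul_self]
  rfl

lemma System.residual_mulVec (U : Receivers K N d) (V : Beamformers K M d) (k : Fin K)
    (x : Fin d → ℂ) :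
    S.residual U V k *ᵥ x
      = userBlock d k *ᵥ x - ((stack V)ᴴ * (S.H k)ᴴ) *ᵥ (U k *ᵥ x) := by
  rw [System.residual, Matrix.sub_mulVec, Matrix.mulVec_mulVec, Matrix.mul_assoc]

lemma vnorm_userBlock_mulVec (k : Fin K) (x : Fin d → ℂ) :
    vnorm (userBlock d k *ᵥ x) = vnorm x := by
  have h := re_dotProduct_conjTranspose_mul_self (userBlock d k) x
  rw [userBlock_conjTranspose_mul_self, Matrix.one_mulVec, ← vnorm_sq_eq_dotProduct] at h
  exact ((sq_eq_sq₀ (vnorm_nonneg _) (vnorm_nonneg _)).mp h).symm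

lemma vnorm_stack_mulVec_le {κ : ℝ} {k : Fin K} (hκ : ‖S.H k‖ ^ 2 ≤ κ) (V : Beamformers K M d)
    (z : Fin N → ℂ) :
    vnorm (((stack V)ᴴ * (S.H k)ᴴ) *ᵥ z) ≤ ‖stack V‖ * √κ * vnorm z := by
  refine (vnorm_mulVec_le _ _).trans ?_
  have h1 : ‖S.H k‖ ≤ √κ := Real.le_sqrt_of_sq_le hκ
  have h2 : ‖(stack V)ᴴ * (S.H k)ᴴ‖ ≤ ‖stack V‖ * √κ := by
    refine (Matrix.l2_opNorm_mul _ _).trans ?_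
    rw [Matrix.l2_opNorm_conjTranspose, Matrix.l2_opNorm_conjTranspose]
    gcongr
  exact mul_le_mul_of_nonneg_right h2 (vnorm_nonneg _)

lemma norm_stack_le_sqrt_power (V : Beamformers K M d) : ‖stack V‖ ≤ √(power V) :=
  Real.le_sqrt_of_sq_le (norm_stack_sq_le_power V)

/-- Lower bound `Eₖ ⪰ v / (v + p κ)`, where `p` is the transmit power. -/
lemma System.vnorm_sq_le_errorCov {κ v : ℝ} {k : Fin K} (hκ : ‖S.H k‖ ^ 2 ≤ κ) (hv : 0 < v)
    (U : Receivers K N d) (V : Beamformers K M d) (x : Fin d → ℂ) :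
    vnorm x ^ 2
      ≤ (1 + power V * κ / v) * (star x ⬝ᵥ (S.errorCov v U V k *ᵥ x)).re := by
  have hκ0 : 0 ≤ κ := (sq_nonneg _).trans hκ
  have hp := power_nonneg V
  rw [S.re_dotProduct_errorCov]
  set t := vnorm (S.residual U V k *ᵥ x)
  set u := vnorm (U k *ᵥ x)
  have hu : 0 ≤ u := vnorm_nonneg _
  have ht : 0 ≤ t := vnorm_nonneg _
  set q := √(power V * κ) with hq
  have hq2 : q ^ 2 = power V * κ := Real.sq_sqrt (by positivity)
  have h1 : vnorm x ≤ t + q * u := by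
    have hx : userBlock d k *ᵥ x = S.residual U V k *ᵥ x
        + ((stack V)ᴴ * (S.H k)ᴴ) *ᵥ (U k *ᵥ x) := by
      rw [S.residual_mulVec, sub_add_cancel]
    rw [← vnorm_userBlock_mulVec k x, hx]
    refine (vnorm_add_le _ _).trans (add_le_add le_rfl ?_)
    refine (vnorm_stack_mulVec_le S hκ V _).trans ?_
    refine mul_le_mul_of_nonneg_right ?_ hu
    rw [hq, Real.sqrt_mul hp]
    exact mul_le_mul_of_nonneg_right (norm_stack_le_sqrt_power V) (Real.sqrt_nonneg _)
  have h2 : vnorm x ^ 2 ≤ (t + q * u) ^ 2 := pow_le_pow_left₀ (vnorm_nonneg _) h1 2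
  refine h2.trans ?_
  rw [← hq2]
  have h3 : (1 + q ^ 2 / v) * (t ^ 2 + v * u ^ 2) - (t + q * u) ^ 2 = (q * t - v * u) ^ 2 / v := by
    field_simp
    ring
  have h4 : 0 ≤ (q * t - v * u) ^ 2 / v := by positivity
  linarith

lemma System.errorCov_posDef {v : ℝ} (hv : 0 < v) (U : Receivers K N d) (V : Beamformers K M d)
    (k : Fin K) : (S.errorCov v U V k).PosDef := by
  have hH := S.errorCov_isHermitian v U V k
  refine Matrix.PosDef.of_dotProduct_mulVec_pos hH fun x hx => ?_
  have hx0 : 0 < vnorm x := by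
    refine norm_pos_iff.mpr fun h => hx ?_
    simpa using h
  have h1 := S.vnorm_sq_le_errorCov (le_refl (‖S.H k‖ ^ 2)) hv U V x
  have h2 : 0 < 1 + power V * ‖S.H k‖ ^ 2 / v := by
    have := power_nonneg V
    positivity
  have h3 : 0 < (star x ⬝ᵥ (S.errorCov v U V k *ᵥ x)).re := by
    by_contra hneg
    push Not at hneg
    nlinarith [mul_nonpos_of_nonneg_of_nonpos h2.le hneg, pow_pos hx0 2]
  exact Complex.lt_def.mpr ⟨h3, by
    have := hH.im_star_dotProduct_mulVec_self x
    simpa using this.symm⟩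

/-- The eigenvalue bound `W E W ⪯ c W` for `W = F Fᴴ` as a bound on a quadratic form. -/
lemma posSemidef_smul_sub_iff_forall {n : Type*} [Fintype n] [DecidableEq n]
    {W E F : Matrix n n ℂ} (hF : IsUnit F) (hW : W = F * Fᴴ) (hE : E.IsHermitian) (c : ℝ) :
    (c • W - W * E * W).PosSemidef ↔
      ∀ y, (star (F *ᵥ y) ⬝ᵥ (E *ᵥ (F *ᵥ y))).re ≤ c * vnorm y ^ 2 := by
  have h1 : c • W - W * E * W = F * (c • (1 : Matrix n n ℂ) - Fᴴ * E * F) * star F := by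
    rw [hW, Matrix.mul_sub, Matrix.sub_mul, Matrix.star_eq_conjTranspose]
    simp [Matrix.mul_assoc]
  have h2 : (c • (1 : Matrix n n ℂ) - Fᴴ * E * F).IsHermitian := by
    refine Matrix.IsHermitian.sub ?_ (Matrix.isHermitian_conjTranspose_mul_mul F hE)
    unfold Matrix.IsHermitian
    simp
  have h3 : ∀ y, (star y ⬝ᵥ ((c • (1 : Matrix n n ℂ) - Fᴴ * E * F) *ᵥ y)).re
      = c * vnorm y ^ 2 - (star (F *ᵥ y) ⬝ᵥ (E *ᵥ (F *ᵥ y))).re := by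
    intro y
    rw [Matrix.sub_mulVec, dotProduct_sub, Complex.sub_re, Matrix.smul_mulVec, dotProduct_smul,
      Complex.smul_re, Matrix.one_mulVec, ← vnorm_sq_eq_dotProduct, Matrix.star_mulVec,
      ← Matrix.dotProduct_mulVec, Matrix.mulVec_mulVec, Matrix.mulVec_mulVec, smul_eq_mul,
      Matrix.mul_assoc]
  rw [h1, Matrix.IsUnit.posSemidef_star_right_conjugate_iff hF,
    Matrix.posSemidef_iff_dotProduct_mulVec]
  constructor
  · intro h y
    have := (Complex.le_def.mp (h.2 y)).1
    rw [h3] at this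
    simp only [Complex.zero_re] at this
    linarith
  · intro h
    refine ⟨h2, fun y => Complex.le_def.mpr ⟨?_, ?_⟩⟩
    · rw [h3]; simp only [Complex.zero_re]; linarith [h y]
    · have := h2.im_star_dotProduct_mulVec_self y
      simpa using this.symm

end ErrorCov

/-! ### The admissible region and the size of the gradients -/

section Region

variable {K M N d : ℕ}

/-- The hypotheses on the system and on the constants `κ`, `a`, `δ` that enter the step sizes. -/
structure System.Regime (S : System K M N d) (κ a δ : ℝ) : Prop where
  norm_sq_le : ∀ k, spectralNorm (S.H k) ^ 2 ≤ κ
  α_nonneg : ∀ k, 0 ≤ S.α k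
  α_le : ∀ k, S.α k ≤ a
  σ_pos : 0 < S.σ
  P_pos : 0 < S.P
  κ_nonneg : 0 ≤ κ
  a_pos : 0 < a
  users_pos : 1 ≤ K
  streams_pos : 1 ≤ d
  one_lt : 1 < δ
  lt_two : δ < 2
  gain_eq_zero : schulzGain δ = 0

/-- The region in which the iterates live: full power, positive definite weights, and all
eigenvalues of `Wₖ Eₖ` at most `c`. A user of zero priority keeps its initial `Uₖ = 0` and
`Wₖ = I`, which the cost function does not control. -/
structure System.Admissible (S : System K M N d) (c : ℝ) (X : Point K M N d) : Prop where
  power_eq : power X.2.2 = S.P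
  posDef : ∀ k, (X.2.1 k).PosDef
  bound : ∀ k, (c • X.2.1 k - X.2.1 k * S.scaledMse X.1 X.2.2 k * X.2.1 k).PosSemidef
  inactive : ∀ k, S.α k = 0 → X.1 k = 0 ∧ X.2.1 k = 1

variable {S : System K M N d} {κ a δ c : ℝ}

lemma System.scaledMse_eq_mse (hP : 0 < S.P) (U : Receivers K N d) {V : Beamformers K M d}
    (hV : power V = S.P) (k : Fin K) : S.scaledMse U V k = S.mse U V k := by
  rw [System.scaledMse, hV, div_self hP.ne', one_mul, System.mse]

lemma System.Admissible.mono {X : Point K M N d} (h : S.Admissible c X) {c' : ℝ} (hc : c ≤ c') :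
    S.Admissible c' X := by
  refine ⟨h.power_eq, h.posDef, fun k => ?_, h.inactive⟩
  have h1 : ((c' - c) • X.2.1 k).PosSemidef := by
    have h0 : (0 : ℂ) ≤ ((c' - c : ℝ) : ℂ) := Complex.zero_le_real.mpr (by linarith)
    have := (h.posDef k).posSemidef.smul h0
    have e : ((c' - c : ℝ) : ℂ) • X.2.1 k = (c' - c) • X.2.1 k := by ext i j; simp
    rwa [e] at this
  have := (h.bound k).add h1
  convert this using 1
  rw [sub_smul]
  abel

open scoped Matrix.Norms.L2Operator

/-- Bounds on `U`, `W` and the residual, in terms of a factor `F` of the weight `W = F Fᴴ`, that hold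
on the admissible region. -/
structure System.FactorBound (S : System K M N d) (κ c : ℝ) (X : Point K M N d) (k : Fin K)
    (F : Matrix (Fin d) (Fin d) ℂ) : Prop where
  isUnit : IsUnit F
  eq : X.2.1 k = F * Fᴴ
  quad : ∀ y, vnorm (S.residual X.1 X.2.2 k *ᵥ (F *ᵥ y)) ^ 2
    + (S.σ * vnorm (X.1 k *ᵥ (F *ᵥ y))) ^ 2 ≤ (√c * vnorm y) ^ 2
  norm_residual : ‖S.residual X.1 X.2.2 k * F‖ ≤ √c
  norm_receiver : ‖X.1 k * F‖ ≤ √c / S.σ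
  norm_factor : ‖F‖ ≤ √c * √(S.P * κ + S.σ ^ 2) / S.σ

lemma System.Admissible.exists_factor (hR : S.Regime κ a δ) (hc : 0 ≤ c) {X : Point K M N d}
    (h : S.Admissible c X) (k : Fin K) :
    ∃ F, S.FactorBound κ c X k F := by
  obtain ⟨F, -, hF, hW, -⟩ := exists_simultaneous_diagonalization (h.posDef k)
    (Matrix.isHermitian_one)
  have hσ := hR.σ_pos
  have hP := hR.P_pos
  have hκ := hR.κ_nonneg
  have hb := h.bound k
  have hE : S.scaledMse X.1 X.2.2 k = S.errorCov (S.σ ^ 2) X.1 X.2.2 k :=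
    S.scaledMse_eq_mse hR.P_pos X.1 h.power_eq k
  rw [hE, posSemidef_smul_sub_iff_forall hF hW (S.errorCov_isHermitian _ _ _ _)] at hb
  have hq : ∀ y, vnorm (S.residual X.1 X.2.2 k *ᵥ (F *ᵥ y)) ^ 2
      + (S.σ * vnorm (X.1 k *ᵥ (F *ᵥ y))) ^ 2 ≤ (√c * vnorm y) ^ 2 := fun y => by
    have := hb y
    rw [S.re_dotProduct_errorCov] at this
    rw [mul_pow, mul_pow, Real.sq_sqrt hc]
    exact this
  have hr : ∀ y : Fin d → ℂ, 0 ≤ √c * vnorm y := fun y =>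
    mul_nonneg (Real.sqrt_nonneg _) (vnorm_nonneg _)
  refine ⟨F, hF, hW, hq, ?_, ?_, ?_⟩
  · refine norm_le_of_vnorm_mulVec_le (Real.sqrt_nonneg _) fun y => ?_
    rw [← Matrix.mulVec_mulVec]
    refine le_of_sq_le_sq ?_ (hr y)
    linarith [hq y, sq_nonneg (S.σ * vnorm (X.1 k *ᵥ (F *ᵥ y)))]
  · refine norm_le_of_vnorm_mulVec_le (by positivity) fun y => ?_
    rw [← Matrix.mulVec_mulVec, div_mul_eq_mul_div, le_div_iff₀ hσ, mul_comm]
    refine le_of_sq_le_sq ?_ (hr y)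
    linarith [hq y, sq_nonneg (vnorm (S.residual X.1 X.2.2 k *ᵥ (F *ᵥ y)))]
  · refine norm_le_of_vnorm_mulVec_le (by positivity) fun y => ?_
    refine le_of_sq_le_sq ?_ (mul_nonneg (by positivity) (vnorm_nonneg _))
    have hH : ‖S.H k‖ ^ 2 ≤ κ := hR.norm_sq_le k
    refine (S.vnorm_sq_le_errorCov hH (pow_pos hσ 2) X.1 X.2.2 (F *ᵥ y)).trans ?_
    rw [h.power_eq]
    have h0 : 0 ≤ 1 + S.P * κ / S.σ ^ 2 := by positivity
    refine (mul_le_mul_of_nonneg_left (hb y) h0).trans_eq ?_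
    rw [mul_pow, div_pow, mul_pow, Real.sq_sqrt hc, Real.sq_sqrt (by positivity)]
    field_simp
    ring

lemma System.Regime.norm_channel_le (hR : S.Regime κ a δ) (k : Fin K) : ‖S.H k‖ ≤ √κ :=
  Real.le_sqrt_of_sq_le (hR.norm_sq_le k)

lemma System.gradU_eq (hP : 0 < S.P) {X : Point K M N d} (hX : power X.2.2 = S.P) (k : Fin K)
    {F : Matrix (Fin d) (Fin d) ℂ} (hW : X.2.1 k = F * Fᴴ) :
    S.gradU X k = (2 * S.α k) • ((-(S.H k * stack X.2.2 * (S.residual X.1 X.2.2 k * F))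
      + S.σ ^ 2 • (X.1 k * F)) * Fᴴ) := by
  have h1 : S.H k * stack X.2.2 * S.residual X.1 X.2.2 k = S.H k * X.2.2 k -
      S.H k * (∑ m, X.2.2 m * (X.2.2 m)ᴴ) * (S.H k)ᴴ * X.1 k := by
    rw [System.residual, Matrix.mul_sub, Matrix.mul_assoc, stack_mul_userBlock,
      ← stack_mul_conjTranspose]
    simp only [Matrix.mul_assoc]
  have h2 : (∑ m, S.H k * X.2.2 m * (X.2.2 m)ᴴ) = S.H k * ∑ m, X.2.2 m * (X.2.2 m)ᴴ := by
    simp only [Matrix.mul_sum, Matrix.mul_assoc]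
  have h3 : 2 * S.α k * S.σ ^ 2 / S.P * S.P = 2 * S.α k * S.σ ^ 2 := by
    field_simp
  rw [System.gradU, hX, h3, h2, ← Matrix.mul_assoc (S.H k * stack X.2.2), h1, hW, Matrix.add_mul,
    smul_add]
  simp only [Matrix.neg_mul, Matrix.sub_mul, Matrix.add_mul, Matrix.smul_mul, Matrix.mul_assoc,
    smul_smul, smul_sub, smul_add, smul_neg]
  abel

lemma System.Admissible.norm_gradU_le (hR : S.Regime κ a δ) (hc : 0 ≤ c) (hcδ : c ≤ δ)
    {X : Point K M N d} (h : S.Admissible c X) (k : Fin K) :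
    ‖S.gradU X k‖ ≤ S.μu κ a δ := by
  obtain ⟨F, hF⟩ := h.exists_factor hR hc k
  have hσ := hR.σ_pos
  have hP := hR.P_pos
  have hκ := hR.κ_nonneg
  have ha := hR.a_pos
  have hα := hR.α_nonneg k
  set A := √(S.P * κ) with hA
  set B := √(S.P * κ + S.σ ^ 2) with hB
  have hA0 : 0 ≤ A := Real.sqrt_nonneg _
  have hB0 : 0 ≤ B := Real.sqrt_nonneg _
  have hBσ : S.σ ≤ B := Real.le_sqrt_of_sq_le (by nlinarith [mul_nonneg hP.le hκ])
  have hc2 : √c * √c = c := Real.mul_self_sqrt hc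
  have hHV : ‖S.H k * stack X.2.2‖ ≤ A := by
    refine (Matrix.l2_opNorm_mul _ _).trans ?_
    rw [hA, mul_comm S.P κ, Real.sqrt_mul hκ]
    have := norm_stack_le_sqrt_power X.2.2
    rw [h.power_eq] at this
    exact mul_le_mul (hR.norm_channel_le k) this (norm_nonneg _) (Real.sqrt_nonneg _)
  have h1 : ‖-(S.H k * stack X.2.2 * (S.residual X.1 X.2.2 k * F)) + S.σ ^ 2 • (X.1 k * F)‖
      ≤ A * √c + S.σ * √c := by
    refine (norm_add_le _ _).trans (add_le_add ?_ ?_)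
    · rw [norm_neg]
      refine (Matrix.l2_opNorm_mul _ _).trans ?_
      exact mul_le_mul hHV hF.norm_residual (norm_nonneg _) hA0
    · rw [norm_real_smul, abs_of_nonneg (by positivity)]
      refine (mul_le_mul_of_nonneg_left hF.norm_receiver (by positivity)).trans_eq ?_
      field_simp
  rw [System.gradU_eq hP h.power_eq k hF.eq, norm_real_smul, abs_of_nonneg (by positivity)]
  calc 2 * S.α k * ‖(-(S.H k * stack X.2.2 * (S.residual X.1 X.2.2 k * F))
        + S.σ ^ 2 • (X.1 k * F)) * Fᴴ‖
      ≤ 2 * a * ((A * √c + S.σ * √c) * (√c * B / S.σ)) := by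
        have h2 := hR.α_le k
        refine mul_le_mul (by linarith) ?_ (norm_nonneg _) (by linarith)
        refine (Matrix.l2_opNorm_mul _ _).trans ?_
        rw [Matrix.l2_opNorm_conjTranspose]
        exact mul_le_mul h1 hF.norm_factor (norm_nonneg _) (by positivity)
    _ = 2 * a * (√c * √c) * B * (1 + A / S.σ) := by
        field_simp
        ring
    _ = 2 * a * c * B * (1 + A / S.σ) := by rw [hc2]
    _ ≤ 2 * a * δ * B * (1 + (S.P * κ + √(S.P * κ * (S.P * κ + S.σ ^ 2))) / S.σ ^ 2) := by
        have h3 : A / S.σ ≤ (S.P * κ + √(S.P * κ * (S.P * κ + S.σ ^ 2))) / S.σ ^ 2 := by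
          rw [Real.sqrt_mul (by positivity), ← hA, ← hB, div_le_div_iff₀ hσ (by positivity)]
          have h4 : 0 ≤ S.P * κ := by positivity
          nlinarith [mul_nonneg (mul_nonneg hA0 hσ.le) (sub_nonneg.mpr hBσ), mul_nonneg h4 hσ.le]
        have hδ : 0 ≤ δ := hc.trans hcδ
        gcongr
    _ = S.μu κ a δ := rfl

lemma re_trace_weight_mul_eq_frob {X : Point K M N d} {k : Fin K} {F : Matrix (Fin d) (Fin d) ℂ}
    (hW : X.2.1 k = F * Fᴴ) :
    (Matrix.trace (X.2.1 k * (X.1 k)ᴴ * X.1 k)).re = frob (X.1 k * F) := by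
  rw [hW, ← re_trace_conjTranspose_mul_self, Matrix.conjTranspose_mul,
    show F * Fᴴ * (X.1 k)ᴴ * X.1 k = F * (Fᴴ * (X.1 k)ᴴ * X.1 k) by simp only [Matrix.mul_assoc],
    Matrix.trace_mul_comm]
  simp only [Matrix.mul_assoc]

lemma System.Admissible.re_trace_weight_nonneg_le (hR : S.Regime κ a δ) (hc : 0 ≤ c)
    {X : Point K M N d} (h : S.Admissible c X) (k : Fin K) :
    0 ≤ (Matrix.trace (X.2.1 k * (X.1 k)ᴴ * X.1 k)).re ∧
    (Matrix.trace (X.2.1 k * (X.1 k)ᴴ * X.1 k)).re ≤ d * (c / S.σ ^ 2) := by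
  obtain ⟨F, hF⟩ := h.exists_factor hR hc k
  rw [re_trace_weight_mul_eq_frob hF.eq]
  refine ⟨frob_nonneg _, (frob_le_card_mul _).trans ?_⟩
  rw [Fintype.card_fin]
  refine mul_le_mul_of_nonneg_left ?_ (Nat.cast_nonneg _)
  refine (pow_le_pow_left₀ (norm_nonneg _) hF.norm_receiver 2).trans_eq ?_
  rw [div_pow, Real.sq_sqrt hc]

lemma System.Admissible.norm_gradV_le (hR : S.Regime κ a δ) (hc : 0 ≤ c) (hcδ : c ≤ δ)
    {X : Point K M N d} (h : S.Admissible c X) (k : Fin K) :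
    ‖S.gradV X k‖ ≤ S.μv κ a δ := by
  choose F hF using fun k => h.exists_factor hR hc k
  have hσ := hR.σ_pos
  have hP := hR.P_pos
  have hκ := hR.κ_nonneg
  have ha := hR.a_pos
  have hc2 : √c ^ 2 = c := Real.sq_sqrt hc
  have hκ2 : √κ ^ 2 = κ := Real.sq_sqrt hκ
  have hV : ‖X.2.2 k‖ ≤ √S.P := by
    refine Real.le_sqrt_of_sq_le ((norm_sq_le_frob _).trans ?_)
    rw [← h.power_eq, power_eq_sum_frob]
    exact Finset.single_le_sum (f := fun k => frob (X.2.2 k)) (fun m _ => frob_nonneg _)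
      (Finset.mem_univ k)
  have hHUF : ∀ m, ‖(S.H m)ᴴ * (X.1 m * F m)‖ ≤ √κ * (√c / S.σ) := fun m => by
    refine (Matrix.l2_opNorm_mul _ _).trans ?_
    rw [Matrix.l2_opNorm_conjTranspose]
    exact mul_le_mul (hR.norm_channel_le m) (hF m).norm_receiver (norm_nonneg _)
      (Real.sqrt_nonneg _)
  set B := √(S.P * κ + S.σ ^ 2) with hB
  have t1 : ‖∑ m, (2 * S.α m) • ((S.H m)ᴴ * X.1 m * X.2.1 m * (X.1 m)ᴴ * S.H m * X.2.2 k)‖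
      ≤ K * (2 * a * (κ * (c / S.σ ^ 2) * √S.P)) := by
    refine (norm_sum_le _ _).trans ?_
    have : ∀ m ∈ Finset.univ, ‖(2 * S.α m) • ((S.H m)ᴴ * X.1 m * X.2.1 m * (X.1 m)ᴴ * S.H m
        * X.2.2 k)‖ ≤ 2 * a * (κ * (c / S.σ ^ 2) * √S.P) := fun m _ => by
      have hα := hR.α_nonneg m
      have hαa := hR.α_le m
      have e : (S.H m)ᴴ * X.1 m * X.2.1 m * (X.1 m)ᴴ * S.H m
          = ((S.H m)ᴴ * (X.1 m * F m)) * ((S.H m)ᴴ * (X.1 m * F m))ᴴ := by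
        rw [(hF m).eq]
        simp [Matrix.mul_assoc]
      rw [norm_real_smul, abs_of_nonneg (by positivity), e]
      refine mul_le_mul (by linarith) ?_ (norm_nonneg _) (by linarith)
      refine (Matrix.l2_opNorm_mul _ _).trans ?_
      refine mul_le_mul ?_ hV (norm_nonneg _) (by positivity)
      rw [norm_mul_conjTranspose_self]
      refine (pow_le_pow_left₀ (norm_nonneg _) (hHUF m) 2).trans_eq ?_
      rw [mul_pow, div_pow, hκ2, hc2]
    refine (Finset.sum_le_sum this).trans_eq ?_
    simp
  have t2 : ‖(2 * S.α k) • ((S.H k)ᴴ * X.1 k * X.2.1 k)‖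
      ≤ 2 * a * (√κ * (√c / S.σ) * (√c * B / S.σ)) := by
    have hα := hR.α_nonneg k
    have hαa := hR.α_le k
    have e : (S.H k)ᴴ * X.1 k * X.2.1 k = (S.H k)ᴴ * (X.1 k * F k) * (F k)ᴴ := by
      rw [(hF k).eq]
      simp only [Matrix.mul_assoc]
    rw [norm_real_smul, abs_of_nonneg (by positivity), e]
    refine mul_le_mul (by linarith) ?_ (norm_nonneg _) (by linarith)
    refine (Matrix.l2_opNorm_mul _ _).trans ?_
    rw [Matrix.l2_opNorm_conjTranspose]
    exact mul_le_mul (hHUF k) (hF k).norm_factor (norm_nonneg _) (by positivity)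
  have t3 : ‖(2 * (S.σ ^ 2 / S.P *
      ∑ m, S.α m * (Matrix.trace (X.2.1 m * (X.1 m)ᴴ * X.1 m)).re)) • X.2.2 k‖
      ≤ 2 * (S.σ ^ 2 / S.P * (K * (a * (d * (c / S.σ ^ 2))))) * √S.P := by
    have hs : ∀ m ∈ Finset.univ, S.α m * (Matrix.trace (X.2.1 m * (X.1 m)ᴴ * X.1 m)).re
        ≤ a * (d * (c / S.σ ^ 2)) := fun m _ =>
      mul_le_mul (hR.α_le m) (h.re_trace_weight_nonneg_le hR hc m).2
        (h.re_trace_weight_nonneg_le hR hc m).1 ha.le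
    have hs0 : 0 ≤ ∑ m, S.α m * (Matrix.trace (X.2.1 m * (X.1 m)ᴴ * X.1 m)).re :=
      Finset.sum_nonneg fun m _ =>
        mul_nonneg (hR.α_nonneg m) (h.re_trace_weight_nonneg_le hR hc m).1
    have hs1 := Finset.sum_le_sum hs
    simp only [Finset.sum_const, Finset.card_univ, Fintype.card_fin, nsmul_eq_mul] at hs1
    rw [norm_real_smul, abs_of_nonneg (by positivity)]
    gcongr
  have hPs : √S.P ^ 2 = S.P := Real.sq_sqrt hP.le
  have hsP : 0 < √S.P := Real.sqrt_pos.mpr hP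
  calc ‖S.gradV X k‖ ≤ K * (2 * a * (κ * (c / S.σ ^ 2) * √S.P))
        + 2 * a * (√κ * (√c / S.σ) * (√c * B / S.σ))
        + 2 * (S.σ ^ 2 / S.P * (K * (a * (d * (c / S.σ ^ 2))))) * √S.P := by
        refine (norm_add_le _ _).trans (add_le_add ((norm_sub_le _ _).trans (add_le_add t1 t2)) t3)
    _ = 2 * a * c * ((K * S.P * κ + √S.P * √κ * B + K * d * S.σ ^ 2) / (√S.P * S.σ ^ 2)) := by
        have e1 : √κ * (√c / S.σ) * (√c * B / S.σ) = √κ * √c ^ 2 * B / S.σ ^ 2 := by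
          field_simp
        rw [e1, hc2]
        have e2 : S.σ ^ 2 / S.P * (K * (a * (d * (c / S.σ ^ 2)))) = K * a * d * c / √S.P ^ 2 := by
          rw [hPs]; field_simp
        have e3 : (K : ℝ) * S.P * κ = K * √S.P ^ 2 * κ := by rw [hPs]
        rw [e2, e3]
        field_simp
    _ ≤ 2 * a * δ * ((K * S.P * κ + √(S.P * κ * (S.P * κ + S.σ ^ 2)) + K * d * S.σ ^ 2) /
          (√S.P * S.σ ^ 2)) := by
        rw [Real.sqrt_mul (mul_nonneg hP.le hκ), Real.sqrt_mul hP.le]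
        gcongr
    _ = S.μv κ a δ := rfl

end Region

/-! ### One step changes the eigenvalues of `W E` by a controlled amount -/

/-- The positive root of `A γ² + B γ = η` bounds the region where `A γ² + B γ ≤ η`. -/
lemma quadratic_le_of_le_root {A B η γ : ℝ} (hA : 0 < A) (hB : 0 ≤ B) (hη : 0 ≤ η) (hγ : 0 ≤ γ)
    (h : γ ≤ (-B + √(B ^ 2 + 4 * A * η)) / (2 * A)) : A * γ ^ 2 + B * γ ≤ η := by
  rw [le_div_iff₀ (by positivity)] at h
  have h1 : γ * (2 * A) + B ≤ √(B ^ 2 + 4 * A * η) := by linarith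
  have h2 := Real.sq_sqrt (show 0 ≤ B ^ 2 + 4 * A * η by positivity)
  have h3 : (γ * (2 * A) + B) ^ 2 ≤ √(B ^ 2 + 4 * A * η) ^ 2 :=
    pow_le_pow_left₀ (by positivity) h1 2
  rw [h2] at h3
  nlinarith

/-- If the square root of an eigenvalue bound `c ≤ δ` grows by at most `γ √A`, the bound grows
by at most `η`. -/
lemma sq_sqrt_add_le {A B η γ c δ : ℝ} (hA : 0 ≤ A) (hγ : 0 ≤ γ) (hc : 0 ≤ c) (hcδ : c ≤ δ)
    (hAB : 2 * √δ * √A ≤ B) (h : A * γ ^ 2 + B * γ ≤ η) : (√c + γ * √A) ^ 2 ≤ c + η := by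
  have h1 : √c ≤ √δ := Real.sqrt_le_sqrt hcδ
  have h2 : 2 * √c * √A * γ ≤ B * γ := by
    refine mul_le_mul_of_nonneg_right (le_trans ?_ hAB) hγ
    gcongr
  have h3 : (√c + γ * √A) ^ 2 = √c ^ 2 + 2 * √c * √A * γ + √A ^ 2 * γ ^ 2 := by ring
  rw [h3, Real.sq_sqrt hc, Real.sq_sqrt hA]
  linarith

section StepBounds

variable {K M N d : ℕ} {S : System K M N d} {κ a δ c γ η : ℝ}

lemma System.Regime.μu_pos (hR : S.Regime κ a δ) : 0 < S.μu κ a δ := by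
  have := hR.σ_pos
  have := hR.P_pos
  have := hR.κ_nonneg
  have := hR.a_pos
  have : 0 < δ := by linarith [hR.one_lt]
  have : 0 < √(S.P * κ + S.σ ^ 2) := Real.sqrt_pos.mpr (by positivity)
  unfold System.μu
  positivity

lemma System.Regime.μv_pos (hR : S.Regime κ a δ) : 0 < S.μv κ a δ := by
  have := hR.σ_pos
  have := Real.sqrt_pos.mpr hR.P_pos
  have := hR.P_pos
  have := hR.κ_nonneg
  have := hR.a_pos
  have : 0 < δ := by linarith [hR.one_lt]
  have : (0 : ℝ) < K := by exact_mod_cast hR.users_pos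
  have : (0 : ℝ) < d := by exact_mod_cast hR.streams_pos
  unfold System.μv
  positivity

lemma System.Regime.Lc_pos (hR : S.Regime κ a δ) : 0 < S.Lc κ a δ := by
  have := hR.σ_pos
  have := hR.P_pos
  have := hR.κ_nonneg
  have := hR.μu_pos
  have : 0 < δ := by linarith [hR.one_lt]
  unfold System.Lc
  positivity

lemma System.Regime.La_pos (hR : S.Regime κ a δ) : 0 < S.La κ a δ := by
  have := hR.σ_pos
  have := hR.P_pos
  have := hR.κ_nonneg
  have := hR.μv_pos
  have : 0 < δ := by linarith [hR.one_lt]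
  have : (0 : ℝ) < K := by exact_mod_cast hR.users_pos
  have : (0 : ℝ) < d := by exact_mod_cast hR.streams_pos
  unfold System.La
  positivity

lemma System.Regime.sqrt_Lc_le (hR : S.Regime κ a δ) : 2 * √δ * √(S.Lc κ a δ) ≤ S.Ld κ a δ := by
  have hσ := hR.σ_pos
  have hP := hR.P_pos
  have hκ := hR.κ_nonneg
  have hμ := hR.μu_pos
  have hδ : 0 < δ := by linarith [hR.one_lt]
  have h1 : S.Lc κ a δ = (S.μu κ a δ * √δ * (S.P * κ + S.σ ^ 2) / S.σ) ^ 2 := by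
    rw [System.Lc, div_pow, mul_pow, mul_pow, Real.sq_sqrt hδ.le]
    ring
  have h2 : 1 / S.σ ≤ (√(S.P * κ) + √(S.P * κ + S.σ ^ 2)) / S.σ ^ 2 := by
    rw [div_le_div_iff₀ hσ (by positivity)]
    have h3 : S.σ ≤ √(S.P * κ + S.σ ^ 2) :=
      Real.le_sqrt_of_sq_le (by nlinarith [mul_nonneg hP.le hκ])
    nlinarith [Real.sqrt_nonneg (S.P * κ)]
  rw [h1, Real.sqrt_sq (by positivity), System.Ld]
  calc 2 * √δ * (S.μu κ a δ * √δ * (S.P * κ + S.σ ^ 2) / S.σ)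
      = 2 * S.μu κ a δ * √δ ^ 2 * (S.P * κ + S.σ ^ 2) * (1 / S.σ) := by ring
    _ = 2 * S.μu κ a δ * δ * (S.P * κ + S.σ ^ 2) * (1 / S.σ) := by rw [Real.sq_sqrt hδ.le]
    _ ≤ _ := by gcongr

lemma System.Regime.sqrt_La_le (hR : S.Regime κ a δ) : 2 * √δ * √(S.La κ a δ) ≤ S.Lb κ a δ := by
  have hσ := hR.σ_pos
  have hP := hR.P_pos
  have hκ := hR.κ_nonneg
  have hμ := hR.μv_pos
  have hδ : 0 < δ := by linarith [hR.one_lt]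
  have hK : (1 : ℝ) ≤ K := by exact_mod_cast hR.users_pos
  have hd : (1 : ℝ) ≤ d := by exact_mod_cast hR.streams_pos
  have hd2 : √(d : ℝ) ^ 2 = d := Real.sq_sqrt (by positivity)
  have hP2 : √S.P ^ 2 = S.P := Real.sq_sqrt hP.le
  set q := √(d : ℝ)
  have hq : 0 ≤ q := Real.sqrt_nonneg _
  have h0 : 0 ≤ 2 * S.μv κ a δ * δ * √(κ * (S.P * κ + S.σ ^ 2)) := by positivity
  have h1 : 2 * K * √S.P * S.μv κ a δ * δ * (κ + q * S.σ ^ 2 / S.P) / S.σ ^ 2 ≤ S.Lb κ a δ := by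
    unfold System.Lb
    gcongr
    linarith
  refine le_trans ?_ h1
  rw [mul_assoc, ← Real.sqrt_mul hδ.le]
  have h2 : δ * S.La κ a δ
      ≤ (K * √S.P * S.μv κ a δ * δ * (κ + q * S.σ ^ 2 / S.P) / S.σ ^ 2) ^ 2 := by
    have h3 : (κ + d * S.σ ^ 2 / S.P) ≤ K * S.P * (κ + q * S.σ ^ 2 / S.P) ^ 2 / S.σ ^ 2 := by
      have h4 : S.P * (κ + q * S.σ ^ 2 / S.P) ^ 2 / S.σ ^ 2
          = S.P * κ ^ 2 / S.σ ^ 2 + 2 * κ * q + q ^ 2 * S.σ ^ 2 / S.P := by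
        field_simp
        ring
      have h5 : 1 ≤ q := by
        rw [← Real.sqrt_one]
        exact Real.sqrt_le_sqrt hd
      have h6 : κ + d * S.σ ^ 2 / S.P ≤ S.P * (κ + q * S.σ ^ 2 / S.P) ^ 2 / S.σ ^ 2 := by
        rw [h4, hd2]
        have : 0 ≤ S.P * κ ^ 2 / S.σ ^ 2 := by positivity
        nlinarith [mul_nonneg hκ (sub_nonneg.mpr h5)]
      have h7 : 0 ≤ S.P * (κ + q * S.σ ^ 2 / S.P) ^ 2 / S.σ ^ 2 := by positivity
      calc κ + d * S.σ ^ 2 / S.P ≤ 1 * (S.P * (κ + q * S.σ ^ 2 / S.P) ^ 2 / S.σ ^ 2) := by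
            rw [one_mul]; exact h6
        _ ≤ K * (S.P * (κ + q * S.σ ^ 2 / S.P) ^ 2 / S.σ ^ 2) :=
            mul_le_mul_of_nonneg_right hK h7
        _ = _ := by ring
    calc δ * S.La κ a δ
        = K * S.μv κ a δ ^ 2 * δ ^ 2 / S.σ ^ 2 * (κ + d * S.σ ^ 2 / S.P) := by
          rw [System.La]; ring
      _ ≤ K * S.μv κ a δ ^ 2 * δ ^ 2 / S.σ ^ 2
          * (K * S.P * (κ + q * S.σ ^ 2 / S.P) ^ 2 / S.σ ^ 2) := by gcongr
      _ = K * S.μv κ a δ ^ 2 * δ ^ 2 / S.σ ^ 2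
          * (K * √S.P ^ 2 * (κ + q * S.σ ^ 2 / S.P) ^ 2 / S.σ ^ 2) := by rw [hP2]
      _ = _ := by ring
  have h3 := Real.sqrt_le_sqrt h2
  rw [Real.sqrt_sq (by positivity)] at h3
  calc 2 * √(δ * S.La κ a δ)
      ≤ 2 * (K * √S.P * S.μv κ a δ * δ * (κ + q * S.σ ^ 2 / S.P) / S.σ ^ 2) := by linarith
    _ = _ := by ring

lemma gradU_eq_zero_of_inactive {X : Point K M N d} {k : Fin K} (h : S.α k = 0) :
    S.gradU X k = 0 := by
  simp [System.gradU, h]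

open scoped Matrix.Norms.L2Operator

lemma System.Admissible.stepU (hR : S.Regime κ a δ) (hc : 0 ≤ c) (hcδ : c ≤ δ)
    {X : Point K M N d} (h : S.Admissible c X) (hγ : 0 ≤ γ)
    (hη : S.Lc κ a δ * γ ^ 2 + S.Ld κ a δ * γ ≤ η) :
    S.Admissible (c + η) (S.stepU γ X) := by
  have hσ := hR.σ_pos
  have hP := hR.P_pos
  have hκ := hR.κ_nonneg
  have hμ := hR.μu_pos
  have hδ : 0 < δ := by linarith [hR.one_lt]
  refine ⟨h.power_eq, h.posDef, fun k => ?_, fun k hk => ?_⟩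
  · obtain ⟨F, hF⟩ := h.exists_factor hR hc k
    have hpw : power (S.stepU γ X).2.2 = S.P := h.power_eq
    have hE : S.scaledMse (S.stepU γ X).1 (S.stepU γ X).2.2 k
        = S.errorCov (S.σ ^ 2) (S.stepU γ X).1 X.2.2 k :=
      S.scaledMse_eq_mse hP _ hpw k
    have hW : (S.stepU γ X).2.1 k = F * Fᴴ := hF.eq
    rw [hE, posSemidef_smul_sub_iff_forall hF.isUnit hW (S.errorCov_isHermitian _ _ _ _)]
    intro y
    set G := S.gradU X k with hG
    set z : Fin N → ℂ := (-(γ • G)) *ᵥ (F *ᵥ y) with hz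
    have e1 : (S.stepU γ X).1 k *ᵥ (F *ᵥ y) = X.1 k *ᵥ (F *ᵥ y) + z := by
      rw [hz, ← Matrix.add_mulVec, ← sub_eq_add_neg]
      rfl
    have e2 : S.residual (S.stepU γ X).1 X.2.2 k *ᵥ (F *ᵥ y)
        = S.residual X.1 X.2.2 k *ᵥ (F *ᵥ y) + -(((stack X.2.2)ᴴ * (S.H k)ᴴ) *ᵥ z) := by
      rw [S.residual_mulVec, S.residual_mulVec, e1, Matrix.mulVec_add]
      abel
    have hzn : vnorm z ≤ γ * S.μu κ a δ * (√δ * √(S.P * κ + S.σ ^ 2) / S.σ) * vnorm y := by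
      refine (vnorm_mulVec_le _ _).trans ?_
      have h1 : ‖-(γ • G)‖ ≤ γ * S.μu κ a δ := by
        rw [norm_neg, norm_real_smul, abs_of_nonneg hγ]
        exact mul_le_mul_of_nonneg_left (h.norm_gradU_le hR hc hcδ k) hγ
      have h2 : vnorm (F *ᵥ y) ≤ (√δ * √(S.P * κ + S.σ ^ 2) / S.σ) * vnorm y := by
        refine (vnorm_mulVec_le _ _).trans (mul_le_mul_of_nonneg_right ?_ (vnorm_nonneg _))
        refine hF.norm_factor.trans ?_
        gcongr
      rw [mul_assoc (γ * _)]
      exact mul_le_mul h1 h2 (vnorm_nonneg _) (by positivity)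
    have hzH : vnorm (((stack X.2.2)ᴴ * (S.H k)ᴴ) *ᵥ z) ≤ √(S.P * κ) * vnorm z := by
      refine (vnorm_stack_mulVec_le S (hR.norm_sq_le k) _ _).trans ?_
      refine mul_le_mul_of_nonneg_right ?_ (vnorm_nonneg _)
      rw [Real.sqrt_mul hP.le, ← h.power_eq]
      exact mul_le_mul_of_nonneg_right (norm_stack_le_sqrt_power _) (Real.sqrt_nonneg _)
    have hy0 : 0 ≤ vnorm y := vnorm_nonneg y
    have hz0 : 0 ≤ vnorm z := vnorm_nonneg z
    have hpert : (√(S.P * κ) * vnorm z) ^ 2 + (S.σ * vnorm z) ^ 2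
        ≤ (γ * √(S.Lc κ a δ) * vnorm y) ^ 2 := by
      have h1 : (√(S.P * κ) * vnorm z) ^ 2 + (S.σ * vnorm z) ^ 2
          = (S.P * κ + S.σ ^ 2) * vnorm z ^ 2 := by
        rw [mul_pow, mul_pow, Real.sq_sqrt (by positivity)]; ring
      rw [h1, mul_pow, mul_pow, Real.sq_sqrt hR.Lc_pos.le]
      refine (mul_le_mul_of_nonneg_left (pow_le_pow_left₀ hz0 hzn 2)
        (by positivity)).trans_eq ?_
      rw [mul_pow, mul_pow, mul_pow, div_pow, mul_pow, Real.sq_sqrt hδ.le,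
        Real.sq_sqrt (by positivity), System.Lc]
      ring
    have hmink := sq_add_sq_le_of_le (mul_nonneg (Real.sqrt_nonneg c) hy0)
      (by positivity) (hF.quad y) hpert
    rw [S.re_dotProduct_errorCov, e1, e2]
    have h3 : vnorm (S.residual X.1 X.2.2 k *ᵥ (F *ᵥ y) + -(((stack X.2.2)ᴴ * (S.H k)ᴴ) *ᵥ z))
        ≤ vnorm (S.residual X.1 X.2.2 k *ᵥ (F *ᵥ y)) + √(S.P * κ) * vnorm z := by
      refine (vnorm_add_le _ _).trans ?_
      rw [vnorm_neg]
      exact add_le_add le_rfl hzH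
    have h4 : S.σ * vnorm (X.1 k *ᵥ (F *ᵥ y) + z)
        ≤ S.σ * vnorm (X.1 k *ᵥ (F *ᵥ y)) + S.σ * vnorm z := by
      rw [← mul_add]
      exact mul_le_mul_of_nonneg_left (vnorm_add_le _ _) hσ.le
    calc _ = vnorm (S.residual X.1 X.2.2 k *ᵥ (F *ᵥ y)
            + -(((stack X.2.2)ᴴ * (S.H k)ᴴ) *ᵥ z)) ^ 2
          + (S.σ * vnorm (X.1 k *ᵥ (F *ᵥ y) + z)) ^ 2 := by rw [mul_pow]
      _ ≤ _ := add_le_add (pow_le_pow_left₀ (vnorm_nonneg _) h3 2)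
          (pow_le_pow_left₀ (mul_nonneg hσ.le (vnorm_nonneg _)) h4 2)
      _ ≤ _ := hmink
      _ = (√c + γ * √(S.Lc κ a δ)) ^ 2 * vnorm y ^ 2 := by ring
      _ ≤ (c + η) * vnorm y ^ 2 := mul_le_mul_of_nonneg_right
          (sq_sqrt_add_le hR.Lc_pos.le hγ hc hcδ hR.sqrt_Lc_le hη) (sq_nonneg _)
  · refine ⟨?_, (h.inactive k hk).2⟩
    have e : (S.stepU γ X).1 k = X.1 k - γ • S.gradU X k := rfl
    rw [e, gradU_eq_zero_of_inactive hk, (h.inactive k hk).1]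
    simp

/-- The unscaled part of a step on `V`. -/
noncomputable def System.descendV (S : System K M N d) (γ : ℝ) (X : Point K M N d) :
    Point K M N d :=
  (X.1, X.2.1, fun k => X.2.2 k - γ • S.gradV X k)

lemma System.Admissible.sum_norm_sq_le (hR : S.Regime κ a δ) (hc : 0 ≤ c) (hcδ : c ≤ δ)
    {X : Point K M N d} (h : S.Admissible c X) :
    ∑ k, ‖-(γ • S.gradV X k)‖ ^ 2 ≤ K * (γ ^ 2 * S.μv κ a δ ^ 2) := by
  have : ∀ k ∈ Finset.univ, ‖-(γ • S.gradV X k)‖ ^ 2 ≤ γ ^ 2 * S.μv κ a δ ^ 2 := fun k _ => by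
    rw [norm_neg, norm_real_smul, mul_pow, sq_abs]
    exact mul_le_mul_of_nonneg_left
      (pow_le_pow_left₀ (norm_nonneg _) (h.norm_gradV_le hR hc hcδ k) 2) (sq_nonneg _)
  refine (Finset.sum_le_sum this).trans_eq ?_
  simp

lemma System.Admissible.power_step_le (hR : S.Regime κ a δ) (hc : 0 ≤ c) (hcδ : c ≤ δ)
    {X : Point K M N d} (h : S.Admissible c X) :
    power (fun k => -(γ • S.gradV X k)) ≤ d * (K * (γ ^ 2 * S.μv κ a δ ^ 2)) := by
  have h1 : power (fun k => -(γ • S.gradV X k)) ≤ ∑ k, (d : ℝ) * ‖-(γ • S.gradV X k)‖ ^ 2 :=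
    Finset.sum_le_sum fun k _ => by
      have := frob_le_card_mul (-(γ • S.gradV X k))
      rwa [Fintype.card_fin] at this
  rw [← Finset.mul_sum] at h1
  exact h1.trans (mul_le_mul_of_nonneg_left (h.sum_norm_sq_le hR hc hcδ) (Nat.cast_nonneg _))

/-- The step size is too small for a step on `V` to reach `V = 0`, so the rescaling is
well-defined. -/
lemma System.Admissible.power_descendV_pos (hR : S.Regime κ a δ) (hc : 0 ≤ c) (hcδ : c ≤ δ)
    {X : Point K M N d} (h : S.Admissible c X) (hγ : 0 ≤ γ)
    (hη : S.La κ a δ * γ ^ 2 + S.Lb κ a δ * γ ≤ η) (hη1 : η < 1) :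
    0 < power (S.descendV γ X).2.2 := by
  have hσ := hR.σ_pos
  have hP := hR.P_pos
  have hκ := hR.κ_nonneg
  have hμ := hR.μv_pos
  have hδ : 1 < δ := hR.one_lt
  have hLb : 0 ≤ S.Lb κ a δ := le_trans (by positivity) hR.sqrt_La_le
  have h1 : S.La κ a δ * γ ^ 2 < 1 := by nlinarith [mul_nonneg hLb hγ]
  have h2 : d * (K * (γ ^ 2 * S.μv κ a δ ^ 2)) / S.P ≤ S.La κ a δ * γ ^ 2 := by
    have h3 : S.La κ a δ * γ ^ 2
        = δ * (K * (γ ^ 2 * S.μv κ a δ ^ 2) * κ / S.σ ^ 2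
          + d * (K * (γ ^ 2 * S.μv κ a δ ^ 2)) / S.P) := by
      rw [System.La]; field_simp
    rw [h3]
    have h4 : 0 ≤ K * (γ ^ 2 * S.μv κ a δ ^ 2) * κ / S.σ ^ 2 := by positivity
    have h5 : 0 ≤ d * (K * (γ ^ 2 * S.μv κ a δ ^ 2)) / S.P := by positivity
    nlinarith
  have h6 : power (fun k => -(γ • S.gradV X k)) < S.P := by
    refine (h.power_step_le hR hc hcδ).trans_lt ?_
    have := h2.trans_lt h1
    rwa [div_lt_one hP] at this
  by_contra hneg
  have h7 : power (S.descendV γ X).2.2 = 0 := le_antisymm (not_lt.mp hneg) (power_nonneg _)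
  have h8 := sqrt_power_add_le (S.descendV γ X).2.2 (fun k => -(-(γ • S.gradV X k)))
  have h9 : (S.descendV γ X).2.2 + (fun k => -(-(γ • S.gradV X k))) = X.2.2 := by
    funext k
    simp [System.descendV]
  have h10 : power (fun k => -(-(γ • S.gradV X k))) = power (fun k => -(γ • S.gradV X k)) := by
    have := power_smul (-1) (fun k => -(γ • S.gradV X k))
    simpa using this
  rw [h9, h7, Real.sqrt_zero, zero_add, h.power_eq, h10] at h8
  exact absurd h8 (not_le.mpr (Real.sqrt_lt_sqrt (power_nonneg _) h6))

lemma System.Admissible.descendV_bound (hR : S.Regime κ a δ) (hc : 0 ≤ c) (hcδ : c ≤ δ)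
    {X : Point K M N d} (h : S.Admissible c X) (hγ : 0 ≤ γ)
    (hη : S.La κ a δ * γ ^ 2 + S.Lb κ a δ * γ ≤ η) (k : Fin K) :
    ((c + η) • X.2.1 k - X.2.1 k * S.scaledMse X.1 (S.descendV γ X).2.2 k
      * X.2.1 k).PosSemidef := by
  have hσ := hR.σ_pos
  have hP := hR.P_pos
  have hκ := hR.κ_nonneg
  have hμ := hR.μv_pos
  have hδ : 0 < δ := by linarith [hR.one_lt]
  obtain ⟨F, hF⟩ := h.exists_factor hR hc k
  set V' := (S.descendV γ X).2.2 with hV'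
  set D : Beamformers K M d := fun k => -(γ • S.gradV X k) with hD
  have hVD : V' = X.2.2 + D := by
    funext k
    simp [hV', hD, System.descendV, sub_eq_add_neg]
  rw [System.scaledMse, posSemidef_smul_sub_iff_forall hF.isUnit hF.eq
    (S.errorCov_isHermitian _ _ _ _)]
  intro y
  set x := F *ᵥ y with hx
  set u := vnorm (X.1 k *ᵥ x) with hu
  have hu0 : 0 ≤ u := vnorm_nonneg _
  have hy0 : 0 ≤ vnorm y := vnorm_nonneg _
  have e2 : S.residual X.1 V' k *ᵥ x
      = S.residual X.1 X.2.2 k *ᵥ x + -(((stack D)ᴴ * (S.H k)ᴴ) *ᵥ (X.1 k *ᵥ x)) := by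
    rw [S.residual_mulVec, S.residual_mulVec, hVD, stack_add, Matrix.conjTranspose_add,
      Matrix.add_mul, Matrix.add_mulVec]
    abel
  have h1 : vnorm (S.residual X.1 V' k *ᵥ x)
      ≤ vnorm (S.residual X.1 X.2.2 k *ᵥ x) + ‖stack D‖ * √κ * u := by
    rw [e2]
    refine (vnorm_add_le _ _).trans ?_
    rw [vnorm_neg]
    exact add_le_add le_rfl (vnorm_stack_mulVec_le S (hR.norm_sq_le k) _ _)
  have hsP : 0 < √S.P := Real.sqrt_pos.mpr hP
  have h2 : √(power V') * (S.σ / √S.P) * u ≤ S.σ * u + √(power D) * (S.σ / √S.P) * u := by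
    have h3 := sqrt_power_add_le X.2.2 D
    rw [← hVD, h.power_eq] at h3
    calc √(power V') * (S.σ / √S.P) * u ≤ (√S.P + √(power D)) * (S.σ / √S.P) * u := by gcongr
      _ = S.σ * u + √(power D) * (S.σ / √S.P) * u := by field_simp
  have hun : u ^ 2 ≤ δ / S.σ ^ 2 * vnorm y ^ 2 := by
    have h3 : u ≤ √c / S.σ * vnorm y := by
      rw [hu, hx, Matrix.mulVec_mulVec]
      exact (vnorm_mulVec_le _ _).trans (mul_le_mul_of_nonneg_right hF.norm_receiver hy0)
    refine (pow_le_pow_left₀ hu0 h3 2).trans ?_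
    rw [mul_pow, div_pow, Real.sq_sqrt hc]
    gcongr
  have hpert : (‖stack D‖ * √κ * u) ^ 2 + (√(power D) * (S.σ / √S.P) * u) ^ 2
      ≤ (γ * √(S.La κ a δ) * vnorm y) ^ 2 := by
    have hs : ‖stack D‖ ^ 2 ≤ K * (γ ^ 2 * S.μv κ a δ ^ 2) :=
      (norm_stack_sq_le_sum D).trans (h.sum_norm_sq_le hR hc hcδ)
    have hp : power D ≤ d * (K * (γ ^ 2 * S.μv κ a δ ^ 2)) := h.power_step_le hR hc hcδ
    calc _ = (‖stack D‖ ^ 2 * κ + power D * (S.σ ^ 2 / S.P)) * u ^ 2 := by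
          rw [mul_pow, mul_pow, mul_pow, mul_pow, div_pow, Real.sq_sqrt hκ,
            Real.sq_sqrt (power_nonneg _), Real.sq_sqrt hP.le]
          ring
      _ ≤ (K * (γ ^ 2 * S.μv κ a δ ^ 2) * κ
          + d * (K * (γ ^ 2 * S.μv κ a δ ^ 2)) * (S.σ ^ 2 / S.P))
          * (δ / S.σ ^ 2 * vnorm y ^ 2) := by
          have := power_nonneg D
          gcongr
      _ = _ := by
          rw [mul_pow, mul_pow, Real.sq_sqrt hR.La_pos.le, System.La]
          field_simp
  have hmink := sq_add_sq_le_of_le (mul_nonneg (Real.sqrt_nonneg c) hy0)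
    (by positivity) (hF.quad y) hpert
  rw [S.re_dotProduct_errorCov]
  calc _ = vnorm (S.residual X.1 V' k *ᵥ x) ^ 2 + (√(power V') * (S.σ / √S.P) * u) ^ 2 := by
        rw [mul_pow, mul_pow, div_pow, Real.sq_sqrt (power_nonneg _), Real.sq_sqrt hP.le]
        ring
    _ ≤ _ := add_le_add (pow_le_pow_left₀ (vnorm_nonneg _) h1 2)
        (pow_le_pow_left₀ (by positivity) h2 2)
    _ ≤ _ := hmink
    _ = (√c + γ * √(S.La κ a δ)) ^ 2 * vnorm y ^ 2 := by ring
    _ ≤ (c + η) * vnorm y ^ 2 := mul_le_mul_of_nonneg_right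
        (sq_sqrt_add_le hR.La_pos.le hγ hc hcδ hR.sqrt_La_le hη) (sq_nonneg _)

lemma System.scaledMse_rescale (hP : 0 < S.P) {X : Point K M N d} (hX : 0 < power X.2.2)
    (k : Fin K) :
    S.scaledMse (S.rescale X).1 (S.rescale X).2.2 k = S.scaledMse X.1 X.2.2 k := by
  set β := √(S.P / power X.2.2) with hβ
  have hβ0 : 0 < β := Real.sqrt_pos.mpr (by positivity)
  have hp : power (S.rescale X).2.2 = β ^ 2 * power X.2.2 := power_smul _ _
  have e1 : (S.rescale X).1 k = (1 / β) • X.1 k := rfl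
  have e2 : ∀ k, (S.rescale X).2.2 k = β • X.2.2 k := fun _ => rfl
  have e3 : S.receivedCov (power (S.rescale X).2.2 / S.P * S.σ ^ 2) (S.rescale X).2.2 k
      = β ^ 2 • S.receivedCov (power X.2.2 / S.P * S.σ ^ 2) X.2.2 k := by
    rw [System.receivedCov, System.receivedCov, hp]
    simp only [e2, Matrix.conjTranspose_smul, Matrix.smul_mul, Matrix.mul_smul, smul_smul,
      ← Finset.smul_sum, star_trivial, smul_add]
    congr 2 <;> ring
  have e4 : (1 / β) * β = 1 := by field_simp
  have e5 : (1 / β) * (β ^ 2 * (1 / β)) = 1 := by field_simp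
  rw [System.scaledMse, System.scaledMse, S.errorCov_eq, S.errorCov_eq, e3, e1, e2]
  simp only [Matrix.conjTranspose_smul, Matrix.conjTranspose_mul, Matrix.smul_mul,
    Matrix.mul_smul, smul_smul, star_trivial]
  congr 2
  · rw [mul_comm, e4, one_smul]
  · rw [e4, one_smul]
  · rw [e5, one_smul]

lemma System.power_rescale (hP : 0 < S.P) {X : Point K M N d} (hX : 0 < power X.2.2) :
    power (S.rescale X).2.2 = S.P := by
  have hp : power (S.rescale X).2.2 = √(S.P / power X.2.2) ^ 2 * power X.2.2 := power_smul _ _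
  rw [hp, Real.sq_sqrt (by positivity)]
  field_simp

lemma System.Admissible.stepV (hR : S.Regime κ a δ) (hc : 0 ≤ c) (hcδ : c ≤ δ)
    {X : Point K M N d} (h : S.Admissible c X) (hγ : 0 ≤ γ)
    (hη : S.La κ a δ * γ ^ 2 + S.Lb κ a δ * γ ≤ η) (hη1 : η < 1) :
    S.Admissible (c + η) (S.stepV γ X) := by
  have hpos := h.power_descendV_pos hR hc hcδ hγ hη hη1
  refine ⟨System.power_rescale hR.P_pos hpos, h.posDef, fun k => ?_, fun k hk => ?_⟩
  · have := h.descendV_bound hR hc hcδ hγ hη k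
    have e := System.scaledMse_rescale (S := S) hR.P_pos hpos k
    rw [show S.stepV γ X = S.rescale (S.descendV γ X) from rfl, e]
    exact this
  · refine ⟨?_, (h.inactive k hk).2⟩
    have e : (S.stepV γ X).1 k
        = (1 / √(S.P / power (S.descendV γ X).2.2)) • X.1 k := rfl
    rw [e, (h.inactive k hk).1, smul_zero]

end StepBounds

/-! ### Quadratic expansions of the cost and descent of the gradient steps -/

section Descent

variable {K M N d : ℕ}

/-- The scale-invariant cost `∑ₖ αₖ {Tr(Wₖ Eₖ) - log det Wₖ}`, which the algorithm decreases. -/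
noncomputable def System.cost (S : System K M N d) (X : Point K M N d) : ℝ :=
  ∑ k, S.α k * ((Matrix.trace (X.2.1 k * S.scaledMse X.1 X.2.2 k)).re
    - Real.log (Matrix.det (X.2.1 k)).re)

variable {S : System K M N d} {κ a δ c γ : ℝ}

lemma re_trace_conjTranspose {n : Type*} [Fintype n] (A : Matrix n n ℂ) :
    (Matrix.trace Aᴴ).re = (Matrix.trace A).re := by
  rw [Matrix.trace_conjTranspose]
  exact Complex.conj_re _

lemma re_trace_real_smul {n : Type*} [Fintype n] (r : ℝ) (A : Matrix n n ℂ) :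
    (Matrix.trace (r • A)).re = r * (Matrix.trace A).re := by
  rw [Matrix.trace_smul, Complex.smul_re, smul_eq_mul]

lemma re_trace_conjTranspose_mul_real_smul {m n : Type*} [Fintype m] [Fintype n] (r : ℝ)
    (A : Matrix m n ℂ) : (Matrix.trace ((r • A)ᴴ * A)).re = r * frob A := by
  rw [Matrix.conjTranspose_smul, star_trivial, Matrix.smul_mul, re_trace_real_smul,
    re_trace_conjTranspose_mul_self]

lemma System.gradU_eq_receivedCov (S : System K M N d) (X : Point K M N d) (k : Fin K) :
    S.gradU X k = (2 * S.α k) • ((S.receivedCov (power X.2.2 / S.P * S.σ ^ 2) X.2.2 k * X.1 k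
      - S.H k * X.2.2 k) * X.2.1 k) := by
  have h2 : (∑ m, S.H k * X.2.2 m * (X.2.2 m)ᴴ) = S.H k * ∑ m, X.2.2 m * (X.2.2 m)ᴴ := by
    simp only [Matrix.mul_sum, Matrix.mul_assoc]
  have h3 : 2 * S.α k * S.σ ^ 2 / S.P * power X.2.2
      = 2 * S.α k * (power X.2.2 / S.P * S.σ ^ 2) := by ring
  rw [System.gradU, h2, h3, System.receivedCov]
  simp only [Matrix.neg_mul, Matrix.sub_mul, Matrix.add_mul, Matrix.smul_mul, Matrix.one_mul,
    smul_smul, smul_sub, smul_add, smul_neg]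
  abel

/-- Expansion of `Tr (W E)` around a receiver. -/
lemma System.re_trace_errorCov_add (S : System K M N d) (v : ℝ) {U U' : Receivers K N d}
    (V : Beamformers K M d) {k : Fin K} {D : Matrix (Fin N) (Fin d) ℂ} (hU : U' k = U k + D)
    {W : Matrix (Fin d) (Fin d) ℂ} (hW : W.IsHermitian) :
    (Matrix.trace (W * S.errorCov v U' V k)).re = (Matrix.trace (W * S.errorCov v U V k)).re
      + 2 * (Matrix.trace (Dᴴ * ((S.receivedCov v V k * U k - S.H k * V k) * W))).re
      + (Matrix.trace (W * (Dᴴ * S.receivedCov v V k * D))).re := by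
  set R := S.receivedCov v V k with hR
  have hRh : Rᴴ = R := S.receivedCov_isHermitian v V k
  set G := R * U k - S.H k * V k with hG
  have h1 : S.errorCov v U' V k = S.errorCov v U V k + (Dᴴ * G + Gᴴ * D) + Dᴴ * R * D := by
    rw [S.errorCov_eq, S.errorCov_eq, hU, hG, ← hR]
    simp only [Matrix.conjTranspose_add, Matrix.conjTranspose_sub, Matrix.conjTranspose_mul, hRh,
      Matrix.add_mul, Matrix.mul_add, Matrix.sub_mul, Matrix.mul_sub, Matrix.mul_assoc]
    abel
  have h2 : (Matrix.trace (W * (Dᴴ * G))).re = (Matrix.trace (Dᴴ * (G * W))).re := by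
    rw [Matrix.trace_mul_comm, Matrix.mul_assoc]
  have h3 : (Matrix.trace (W * (Gᴴ * D))).re = (Matrix.trace (Dᴴ * (G * W))).re := by
    rw [← re_trace_conjTranspose]
    simp only [Matrix.conjTranspose_mul, Matrix.conjTranspose_conjTranspose, hW.eq,
      Matrix.mul_assoc]
  rw [h1, Matrix.mul_add, Matrix.mul_add, Matrix.mul_add, Matrix.trace_add, Matrix.trace_add,
    Matrix.trace_add, Complex.add_re, Complex.add_re, Complex.add_re, h2, h3]
  ring

lemma System.re_trace_receivedCov (S : System K M N d) (v : ℝ) (V : Beamformers K M d)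
    (k : Fin K) (D : Matrix (Fin N) (Fin d) ℂ) {W F : Matrix (Fin d) (Fin d) ℂ}
    (hW : W = F * Fᴴ) :
    (Matrix.trace (W * (Dᴴ * S.receivedCov v V k * D))).re
      = frob ((stack V)ᴴ * (S.H k)ᴴ * (D * F)) + v * frob (D * F) := by
  have h1 : W * (Dᴴ * S.receivedCov v V k * D)
      = F * (Fᴴ * (Dᴴ * S.receivedCov v V k * D)) := by
    rw [hW, Matrix.mul_assoc]
  have h2 : Fᴴ * (Dᴴ * S.receivedCov v V k * D) * F
      = ((stack V)ᴴ * (S.H k)ᴴ * (D * F))ᴴ * ((stack V)ᴴ * (S.H k)ᴴ * (D * F))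
        + v • ((D * F)ᴴ * (D * F)) := by
    rw [System.receivedCov, ← stack_mul_conjTranspose]
    simp only [Matrix.conjTranspose_mul, Matrix.conjTranspose_conjTranspose, Matrix.add_mul,
      Matrix.mul_add, Matrix.smul_mul, Matrix.mul_smul, Matrix.mul_assoc, Matrix.one_mul]
  rw [h1, Matrix.trace_mul_comm, h2, Matrix.trace_add, Complex.add_re,
    re_trace_conjTranspose_mul_self, re_trace_real_smul, re_trace_conjTranspose_mul_self]

/-- Hessian (up to the factor `2`) of the cost in every `Vₘ`. -/
noncomputable def System.hessV (S : System K M N d) (X : Point K M N d) :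
    Matrix (Fin M) (Fin M) ℂ :=
  ∑ k, S.α k • ((S.H k)ᴴ * X.1 k * X.2.1 k * (X.1 k)ᴴ * S.H k)
    + (S.σ ^ 2 / S.P * ∑ k, S.α k * (Matrix.trace (X.2.1 k * (X.1 k)ᴴ * X.1 k)).re) • 1

lemma System.gradV_eq_hessV (S : System K M N d) (X : Point K M N d) (k : Fin K) :
    S.gradV X k
      = (2 : ℝ) • (S.hessV X * X.2.2 k - S.α k • ((S.H k)ᴴ * X.1 k * X.2.1 k)) := by
  rw [System.gradV, System.hessV]
  simp only [Matrix.add_mul, Matrix.sum_mul, Matrix.smul_mul, Matrix.one_mul, smul_sub, smul_add,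
    smul_smul, Finset.smul_sum]
  abel

lemma System.hessV_isHermitian {X : Point K M N d} (hW : ∀ k, (X.2.1 k).IsHermitian) :
    (S.hessV X).IsHermitian := by
  unfold Matrix.IsHermitian System.hessV
  simp only [Matrix.conjTranspose_add, Matrix.conjTranspose_sum, Matrix.conjTranspose_smul,
    Matrix.conjTranspose_mul, Matrix.conjTranspose_conjTranspose, Matrix.conjTranspose_one,
    star_trivial, (hW _).eq, Matrix.mul_assoc]

/-- As a function of `V` the cost is a quadratic polynomial. -/
lemma System.cost_eq_quadratic (X : Point K M N d) (hW : ∀ k, (X.2.1 k).IsHermitian) :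
    S.cost X = ∑ k, S.α k * ((Matrix.trace (X.2.1 k)).re - Real.log (Matrix.det (X.2.1 k)).re)
      + ∑ m, ((Matrix.trace ((X.2.2 m)ᴴ * (S.hessV X * X.2.2 m))).re
        - 2 * S.α m * (Matrix.trace ((X.2.2 m)ᴴ * ((S.H m)ᴴ * X.1 m * X.2.1 m))).re) := by
  have h1 : ∀ k, (Matrix.trace (X.2.1 k * S.scaledMse X.1 X.2.2 k)).re
      = (Matrix.trace (X.2.1 k)).re
        - 2 * (Matrix.trace ((X.2.2 k)ᴴ * ((S.H k)ᴴ * X.1 k * X.2.1 k))).re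
        + ∑ m, (Matrix.trace ((X.2.2 m)ᴴ * ((S.H k)ᴴ * X.1 k * X.2.1 k * (X.1 k)ᴴ * S.H k
          * X.2.2 m))).re
        + power X.2.2 * (S.σ ^ 2 / S.P
          * (Matrix.trace (X.2.1 k * (X.1 k)ᴴ * X.1 k)).re) := by
    intro k
    have e1 : (Matrix.trace (X.2.1 k * ((S.H k * X.2.2 k)ᴴ * X.1 k))).re
        = (Matrix.trace ((X.2.2 k)ᴴ * ((S.H k)ᴴ * X.1 k * X.2.1 k))).re := by
      rw [Matrix.trace_mul_comm]
      simp only [Matrix.conjTranspose_mul, Matrix.mul_assoc]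
    have e2 : (Matrix.trace (X.2.1 k * ((X.1 k)ᴴ * (S.H k * X.2.2 k)))).re
        = (Matrix.trace ((X.2.2 k)ᴴ * ((S.H k)ᴴ * X.1 k * X.2.1 k))).re := by
      rw [← re_trace_conjTranspose]
      simp only [Matrix.conjTranspose_mul, Matrix.conjTranspose_conjTranspose, (hW k).eq,
        Matrix.mul_assoc]
    have e3 : ∀ m, (Matrix.trace (X.2.1 k * ((X.1 k)ᴴ * (S.H k * (X.2.2 m * (X.2.2 m)ᴴ)
          * (S.H k)ᴴ) * X.1 k))).re
        = (Matrix.trace ((X.2.2 m)ᴴ * ((S.H k)ᴴ * X.1 k * X.2.1 k * (X.1 k)ᴴ * S.H k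
          * X.2.2 m))).re := by
      intro m
      have : X.2.1 k * ((X.1 k)ᴴ * (S.H k * (X.2.2 m * (X.2.2 m)ᴴ) * (S.H k)ᴴ) * X.1 k)
          = (X.2.1 k * (X.1 k)ᴴ * S.H k * X.2.2 m) * ((X.2.2 m)ᴴ * (S.H k)ᴴ * X.1 k) := by
        simp only [Matrix.mul_assoc]
      rw [this, Matrix.trace_mul_comm]
      simp only [Matrix.mul_assoc]
    have e4 : (Matrix.trace (X.2.1 k * ((X.1 k)ᴴ * (S.H k * (∑ m, X.2.2 m * (X.2.2 m)ᴴ)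
          * (S.H k)ᴴ) * X.1 k))).re
        = ∑ m, (Matrix.trace ((X.2.2 m)ᴴ * ((S.H k)ᴴ * X.1 k * X.2.1 k * (X.1 k)ᴴ * S.H k
          * X.2.2 m))).re := by
      simp only [Matrix.mul_sum, Matrix.sum_mul, Matrix.trace_sum, Complex.re_sum, e3]
    rw [System.scaledMse, S.errorCov_eq, System.receivedCov, Matrix.mul_add, Matrix.mul_sub,
      Matrix.mul_sub, Matrix.mul_one, Matrix.mul_add, Matrix.add_mul, Matrix.mul_add,
      Matrix.mul_smul, Matrix.mul_one, Matrix.smul_mul, Matrix.mul_smul, Matrix.trace_add,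
      Matrix.trace_sub, Matrix.trace_sub, Matrix.trace_add, Complex.add_re, Complex.sub_re,
      Complex.sub_re, Complex.add_re, e1, e2, e4, re_trace_real_smul,
      ← Matrix.mul_assoc (X.2.1 k) (X.1 k)ᴴ (X.1 k)]
    ring
  have h2 : ∀ m, (Matrix.trace ((X.2.2 m)ᴴ * (S.hessV X * X.2.2 m))).re
      = ∑ k, S.α k * (Matrix.trace ((X.2.2 m)ᴴ * ((S.H k)ᴴ * X.1 k * X.2.1 k * (X.1 k)ᴴ * S.H k
          * X.2.2 m))).re
        + (S.σ ^ 2 / S.P * ∑ k, S.α k * (Matrix.trace (X.2.1 k * (X.1 k)ᴴ * X.1 k)).re)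
          * frob (X.2.2 m) := by
    intro m
    rw [System.hessV, Matrix.add_mul, Matrix.mul_add, Matrix.trace_add, Complex.add_re,
      Matrix.smul_mul, Matrix.mul_smul, re_trace_real_smul, Matrix.one_mul,
      re_trace_conjTranspose_mul_self, Matrix.sum_mul, Matrix.mul_sum, Matrix.trace_sum,
      Complex.re_sum]
    congr 1
    refine Finset.sum_congr rfl fun k _ => ?_
    rw [Matrix.smul_mul, Matrix.mul_smul, re_trace_real_smul]
  have h3 : ∑ m, ((Matrix.trace ((X.2.2 m)ᴴ * (S.hessV X * X.2.2 m))).re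
        - 2 * S.α m * (Matrix.trace ((X.2.2 m)ᴴ * ((S.H m)ᴴ * X.1 m * X.2.1 m))).re)
      = ∑ k, S.α k * (∑ m, (Matrix.trace ((X.2.2 m)ᴴ * ((S.H k)ᴴ * X.1 k * X.2.1 k * (X.1 k)ᴴ
          * S.H k * X.2.2 m))).re
        + power X.2.2 * (S.σ ^ 2 / S.P * (Matrix.trace (X.2.1 k * (X.1 k)ᴴ * X.1 k)).re)
        - 2 * (Matrix.trace ((X.2.2 k)ᴴ * ((S.H k)ᴴ * X.1 k * X.2.1 k))).re) := by
    simp only [h2, mul_sub, mul_add, Finset.sum_sub_distrib, Finset.sum_add_distrib]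
    rw [Finset.sum_comm, ← Finset.mul_sum, ← power_eq_sum_frob]
    simp only [Finset.mul_sum, Finset.sum_mul]
    congr 1
    · congr 1
      exact Finset.sum_congr rfl fun k _ => by ring
    · exact Finset.sum_congr rfl fun k _ => by ring
  rw [System.cost, h3, ← Finset.sum_add_distrib]
  refine Finset.sum_congr rfl fun k _ => ?_
  rw [h1]
  ring

/-- Exact second-order expansion of the cost in `V`. -/
lemma System.cost_add (X : Point K M N d) (hW : ∀ k, (X.2.1 k).IsHermitian)
    (D : Beamformers K M d) :
    S.cost (X.1, X.2.1, X.2.2 + D) = S.cost X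
      + ∑ m, (Matrix.trace ((D m)ᴴ * S.gradV X m)).re
      + ∑ m, (Matrix.trace ((D m)ᴴ * (S.hessV X * D m))).re := by
  have hH : (S.hessV X)ᴴ = S.hessV X := S.hessV_isHermitian hW
  rw [S.cost_eq_quadratic (X.1, X.2.1, X.2.2 + D) hW, S.cost_eq_quadratic X hW]
  simp only [← Finset.sum_add_distrib]
  have e0 : S.hessV (X.1, X.2.1, X.2.2 + D) = S.hessV X := rfl
  refine Finset.sum_congr rfl fun m _ => ?_
  have e1 : (Matrix.trace ((X.2.2 m)ᴴ * (S.hessV X * D m))).re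
      = (Matrix.trace ((D m)ᴴ * (S.hessV X * X.2.2 m))).re := by
    rw [← re_trace_conjTranspose]
    simp only [Matrix.conjTranspose_mul, Matrix.conjTranspose_conjTranspose, hH, Matrix.mul_assoc]
  rw [e0, S.gradV_eq_hessV]
  simp only [Pi.add_apply, Matrix.conjTranspose_add, Matrix.mul_add, Matrix.add_mul,
    Matrix.mul_sub, Matrix.mul_smul, Matrix.trace_add, Matrix.trace_sub, Complex.add_re,
    re_trace_real_smul, e1, Complex.sub_re]
  ring

lemma System.re_trace_hessV (X : Point K M N d) {F : Fin K → Matrix (Fin d) (Fin d) ℂ}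
    (hF : ∀ k, X.2.1 k = F k * (F k)ᴴ) (D : Matrix (Fin M) (Fin d) ℂ) :
    (Matrix.trace (Dᴴ * (S.hessV X * D))).re
      = ∑ k, S.α k * frob (((S.H k)ᴴ * (X.1 k * F k))ᴴ * D)
        + (S.σ ^ 2 / S.P * ∑ k, S.α k * frob (X.1 k * F k)) * frob D := by
  have h1 : ∀ k, (S.H k)ᴴ * X.1 k * X.2.1 k * (X.1 k)ᴴ * S.H k
      = ((S.H k)ᴴ * (X.1 k * F k)) * ((S.H k)ᴴ * (X.1 k * F k))ᴴ := fun k => by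
    rw [hF]
    simp [Matrix.mul_assoc]
  rw [System.hessV, Matrix.add_mul, Matrix.mul_add, Matrix.trace_add, Complex.add_re,
    Matrix.smul_mul, Matrix.mul_smul, re_trace_real_smul, Matrix.one_mul,
    re_trace_conjTranspose_mul_self, Matrix.sum_mul, Matrix.mul_sum, Matrix.trace_sum,
    Complex.re_sum]
  simp only [re_trace_weight_mul_eq_frob (hF _)]
  congr 1
  refine Finset.sum_congr rfl fun k _ => ?_
  rw [Matrix.smul_mul, Matrix.mul_smul, re_trace_real_smul, h1,
    ← re_trace_conjTranspose_mul_self]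
  simp only [Matrix.conjTranspose_mul, Matrix.conjTranspose_conjTranspose, Matrix.mul_assoc]

/-- The cost is convex in `V`, so a zero of `gradV` minimises it over all `V`. -/
lemma System.cost_le_of_gradV_eq_zero (hα : ∀ k, 0 ≤ S.α k) (hP : 0 < S.P) {X : Point K M N d}
    (hW : ∀ k, (X.2.1 k).PosDef) (hV : ∀ k, S.gradV X k = 0) (V : Beamformers K M d) :
    S.cost X ≤ S.cost (X.1, X.2.1, V) := by
  choose F _ _ hF _ using fun k =>
    exists_simultaneous_diagonalization (hW k) (E := 1) Matrix.isHermitian_one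
  have h1 := S.cost_add X (fun k => (hW k).isHermitian) (V - X.2.2)
  have h2 : ∀ m ∈ Finset.univ,
      0 ≤ (Matrix.trace (((V - X.2.2) m)ᴴ * (S.hessV X * (V - X.2.2) m))).re := fun m _ => by
    rw [S.re_trace_hessV X hF]
    have h3 : 0 ≤ ∑ k, S.α k * frob (((S.H k)ᴴ * (X.1 k * F k))ᴴ * (V - X.2.2) m) :=
      Finset.sum_nonneg fun k _ => mul_nonneg (hα k) (frob_nonneg _)
    have h4 : 0 ≤ ∑ k, S.α k * frob (X.1 k * F k) :=
      Finset.sum_nonneg fun k _ => mul_nonneg (hα k) (frob_nonneg _)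
    have h5 := frob_nonneg ((V - X.2.2) m)
    positivity
  have h6 := Finset.sum_nonneg h2
  have h7 : ∑ m, (Matrix.trace (((V - X.2.2) m)ᴴ * S.gradV X m)).re = 0 :=
    Finset.sum_eq_zero fun m _ => by rw [hV]; simp
  rw [add_sub_cancel, h7] at h1
  linarith

open scoped Matrix.Norms.L2Operator

lemma System.Admissible.cost_stepU_le (hR : S.Regime κ a δ) (hc : 0 ≤ c) (hcδ : c ≤ δ)
    {X : Point K M N d} (h : S.Admissible c X) (hγ : 0 ≤ γ) (hγL : γ ≤ 1 / S.Lu κ a δ) :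
    S.cost (S.stepU γ X) ≤ S.cost X - γ / 2 * ∑ k, frob (S.gradU X k) := by
  have hσ := hR.σ_pos
  have hP := hR.P_pos
  have hκ := hR.κ_nonneg
  have ha := hR.a_pos
  have hδ : 0 < δ := by linarith [hR.one_lt]
  have hL : 0 < S.Lu κ a δ := by unfold System.Lu; positivity
  have hγL' : S.Lu κ a δ * γ ≤ 1 := by
    rw [le_div_iff₀ hL] at hγL; linarith
  rw [System.cost, System.cost, Finset.mul_sum, ← Finset.sum_sub_distrib]
  refine Finset.sum_le_sum fun k _ => ?_
  obtain ⟨F, hF⟩ := h.exists_factor hR hc k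
  have hv : power X.2.2 / S.P * S.σ ^ 2 = S.σ ^ 2 := by
    rw [h.power_eq, div_self hP.ne', one_mul]
  have e := S.re_trace_errorCov_add (power X.2.2 / S.P * S.σ ^ 2) (U := X.1)
    (U' := (S.stepU γ X).1) X.2.2 (k := k) (D := (-γ) • S.gradU X k)
    (by simp [System.stepU, sub_eq_add_neg]) (h.posDef k).isHermitian
  rw [S.re_trace_receivedCov _ _ _ _ hF.eq, hv] at e
  set G := S.gradU X k with hG
  have hGY : G = (2 * S.α k) • ((S.receivedCov (S.σ ^ 2) X.2.2 k * X.1 k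
      - S.H k * X.2.2 k) * X.2.1 k) := by
    rw [hG, S.gradU_eq_receivedCov, hv]
  have hα := hR.α_nonneg k
  have e1 : S.α k * (2 * (Matrix.trace (((-γ) • G)ᴴ * ((S.receivedCov (S.σ ^ 2) X.2.2 k * X.1 k
      - S.H k * X.2.2 k) * X.2.1 k))).re) = -γ * frob G := by
    rw [← re_trace_conjTranspose_mul_real_smul]
    conv_rhs => rw [hGY]
    rw [Matrix.mul_smul, re_trace_real_smul, ← hGY]
    ring
  have e2 : frob ((stack X.2.2)ᴴ * (S.H k)ᴴ * ((-γ) • G * F)) + S.σ ^ 2 * frob ((-γ) • G * F)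
      ≤ (S.P * κ + S.σ ^ 2) * (γ ^ 2 * frob G * (δ * (S.P * κ + S.σ ^ 2) / S.σ ^ 2)) := by
    have hn : ‖(stack X.2.2)ᴴ * (S.H k)ᴴ‖ ^ 2 ≤ S.P * κ := by
      have h1 : ‖(stack X.2.2)ᴴ * (S.H k)ᴴ‖ ≤ ‖stack X.2.2‖ * ‖S.H k‖ := by
        refine (Matrix.l2_opNorm_mul _ _).trans ?_
        rw [Matrix.l2_opNorm_conjTranspose, Matrix.l2_opNorm_conjTranspose]
      refine (pow_le_pow_left₀ (norm_nonneg _) h1 2).trans ?_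
      rw [mul_pow]
      refine mul_le_mul ?_ (hR.norm_sq_le k) (sq_nonneg _) hP.le
      rw [← h.power_eq]
      exact norm_stack_sq_le_power _
    have hGF : frob ((-γ) • G * F)
        ≤ γ ^ 2 * frob G * (δ * (S.P * κ + S.σ ^ 2) / S.σ ^ 2) := by
      refine (frob_mul_le' _ _).trans ?_
      rw [frob_smul, neg_sq]
      refine mul_le_mul_of_nonneg_left ?_ (mul_nonneg (sq_nonneg _) (frob_nonneg _))
      refine (pow_le_pow_left₀ (norm_nonneg _) hF.norm_factor 2).trans ?_
      rw [div_pow, mul_pow, Real.sq_sqrt hc, Real.sq_sqrt (by positivity)]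
      gcongr
    have h1 := frob_mul_le ((stack X.2.2)ᴴ * (S.H k)ᴴ) ((-γ) • G * F)
    have h2 := frob_nonneg ((-γ) • G * F)
    calc _ ≤ S.P * κ * frob ((-γ) • G * F) + S.σ ^ 2 * frob ((-γ) • G * F) :=
          add_le_add (h1.trans (mul_le_mul_of_nonneg_right hn h2)) le_rfl
      _ = (S.P * κ + S.σ ^ 2) * frob ((-γ) • G * F) := by ring
      _ ≤ _ := mul_le_mul_of_nonneg_left hGF (by positivity)
  have hG0 := frob_nonneg G
  have e3 : S.α k * ((S.P * κ + S.σ ^ 2) * (γ ^ 2 * frob G * (δ * (S.P * κ + S.σ ^ 2) / S.σ ^ 2)))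
      ≤ γ / 2 * frob G := by
    calc S.α k * ((S.P * κ + S.σ ^ 2)
          * (γ ^ 2 * frob G * (δ * (S.P * κ + S.σ ^ 2) / S.σ ^ 2)))
        ≤ a * ((S.P * κ + S.σ ^ 2)
          * (γ ^ 2 * frob G * (δ * (S.P * κ + S.σ ^ 2) / S.σ ^ 2))) :=
          mul_le_mul_of_nonneg_right (hR.α_le k) (by positivity)
      _ = (S.Lu κ a δ * γ) * (γ / 2 * frob G) := by rw [System.Lu]; ring
      _ ≤ 1 * (γ / 2 * frob G) := mul_le_mul_of_nonneg_right hγL' (by positivity)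
      _ = _ := one_mul _
  have hE : S.scaledMse (S.stepU γ X).1 (S.stepU γ X).2.2 k
      = S.errorCov (S.σ ^ 2) (S.stepU γ X).1 X.2.2 k := by
    rw [← hv]; rfl
  have hE' : S.scaledMse X.1 X.2.2 k = S.errorCov (S.σ ^ 2) X.1 X.2.2 k := by
    rw [← hv]; rfl
  have hW : (S.stepU γ X).2.1 k = X.2.1 k := rfl
  rw [hE, hE', hW, e]
  have e4 := mul_le_mul_of_nonneg_left e2 hα
  nlinarith

lemma System.cost_rescale (hP : 0 < S.P) {X : Point K M N d} (hX : 0 < power X.2.2) :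
    S.cost (S.rescale X) = S.cost X := by
  rw [System.cost, System.cost]
  refine Finset.sum_congr rfl fun k _ => ?_
  rw [System.scaledMse_rescale hP hX]
  rfl

lemma System.Admissible.cost_descendV_le (hR : S.Regime κ a δ) (hc : 0 ≤ c) (hcδ : c ≤ δ)
    {X : Point K M N d} (h : S.Admissible c X) (hγ : 0 ≤ γ) (hγL : γ ≤ 1 / S.Lv κ a δ) :
    S.cost (S.descendV γ X) ≤ S.cost X - γ / 2 * ∑ k, frob (S.gradV X k) := by
  have hσ := hR.σ_pos
  have hP := hR.P_pos
  have hκ := hR.κ_nonneg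
  have ha := hR.a_pos
  have hδ : 0 < δ := by linarith [hR.one_lt]
  have hK : (0 : ℝ) < K := by exact_mod_cast hR.users_pos
  have hd : (0 : ℝ) < d := by exact_mod_cast hR.streams_pos
  have hL : 0 < S.Lv κ a δ := by unfold System.Lv; positivity
  have hγL' : S.Lv κ a δ * γ ≤ 1 := by
    rw [le_div_iff₀ hL] at hγL; linarith
  choose F hF using fun k => h.exists_factor hR hc k
  have e0 : S.descendV γ X = (X.1, X.2.1, X.2.2 + fun k => (-γ) • S.gradV X k) := by
    simp only [System.descendV]
    congr 2
    funext k
    simp [sub_eq_add_neg]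
  rw [e0, S.cost_add X (fun k => (h.posDef k).isHermitian), Finset.mul_sum, add_assoc,
    ← Finset.sum_add_distrib, sub_eq_add_neg, ← Finset.sum_neg_distrib]
  refine add_le_add le_rfl (Finset.sum_le_sum fun m _ => ?_)
  set G := S.gradV X m
  have hG0 := frob_nonneg G
  have hun : ∀ k, ‖X.1 k * F k‖ ^ 2 ≤ δ / S.σ ^ 2 := fun k => by
    refine (pow_le_pow_left₀ (norm_nonneg _) (hF k).norm_receiver 2).trans ?_
    rw [div_pow, Real.sq_sqrt hc]
    gcongr
  have h1 : ∑ k, S.α k * frob (((S.H k)ᴴ * (X.1 k * F k))ᴴ * ((-γ) • G))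
      ≤ K * (a * (κ * (δ / S.σ ^ 2) * (γ ^ 2 * frob G))) := by
    have : ∀ k ∈ Finset.univ, S.α k * frob (((S.H k)ᴴ * (X.1 k * F k))ᴴ * ((-γ) • G))
        ≤ a * (κ * (δ / S.σ ^ 2) * (γ ^ 2 * frob G)) := fun k _ => by
      refine mul_le_mul (hR.α_le k) ?_ (frob_nonneg _) ha.le
      refine (frob_mul_le _ _).trans ?_
      rw [frob_smul, neg_sq, Matrix.l2_opNorm_conjTranspose]
      refine mul_le_mul_of_nonneg_right ?_ (by positivity)
      have h2 := Matrix.l2_opNorm_mul (S.H k)ᴴ (X.1 k * F k)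
      rw [Matrix.l2_opNorm_conjTranspose] at h2
      refine (pow_le_pow_left₀ (norm_nonneg _) h2 2).trans ?_
      rw [mul_pow]
      exact mul_le_mul (hR.norm_sq_le k) (hun k) (sq_nonneg _) hκ
    refine (Finset.sum_le_sum this).trans_eq ?_
    simp
  have h2 : ∑ k, S.α k * frob (X.1 k * F k) ≤ K * (a * (d * (δ / S.σ ^ 2))) := by
    have : ∀ k ∈ Finset.univ, S.α k * frob (X.1 k * F k) ≤ a * (d * (δ / S.σ ^ 2)) :=
      fun k _ => by
        refine mul_le_mul (hR.α_le k) ?_ (frob_nonneg _) ha.le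
        have h3 := frob_le_card_mul (X.1 k * F k)
        rw [Fintype.card_fin] at h3
        exact h3.trans (mul_le_mul_of_nonneg_left (hun k) hd.le)
    refine (Finset.sum_le_sum this).trans_eq ?_
    simp
  rw [re_trace_conjTranspose_mul_real_smul, S.re_trace_hessV X fun k => (hF k).eq, frob_smul,
    neg_sq]
  have h3 : S.σ ^ 2 / S.P * (∑ k, S.α k * frob (X.1 k * F k)) * (γ ^ 2 * frob G)
      ≤ S.σ ^ 2 / S.P * (K * (a * (d * (δ / S.σ ^ 2)))) * (γ ^ 2 * frob G) := by
    gcongr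
  have h4 : K * (a * (κ * (δ / S.σ ^ 2) * (γ ^ 2 * frob G)))
      + S.σ ^ 2 / S.P * (K * (a * (d * (δ / S.σ ^ 2)))) * (γ ^ 2 * frob G)
      = (S.Lv κ a δ * γ) * (γ / 2 * frob G) := by
    rw [System.Lv]
    field_simp
  have h5 : (S.Lv κ a δ * γ) * (γ / 2 * frob G) ≤ 1 * (γ / 2 * frob G) :=
    mul_le_mul_of_nonneg_right hγL' (by positivity)
  linarith

end Descent

/-! ### Continuity of the algorithm -/

section Continuity

variable {K M N d : ℕ} (S : System K M N d)

lemma continuous_power : Continuous (power : Beamformers K M d → ℝ) := by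
  unfold power
  fun_prop

lemma continuous_power_point : Continuous fun X : Point K M N d => power X.2.2 :=
  continuous_power.comp (by fun_prop)

lemma System.continuous_scaledMse (k : Fin K) :
    Continuous fun X : Point K M N d => S.scaledMse X.1 X.2.2 k := by
  have := continuous_power_point (K := K) (M := M) (N := N) (d := d)
  unfold System.scaledMse System.errorCov
  fun_prop

lemma System.continuous_gradU (k : Fin K) : Continuous fun X : Point K M N d => S.gradU X k := by
  have := continuous_power_point (K := K) (M := M) (N := N) (d := d)
  unfold System.gradU
  fun_prop

lemma System.continuous_gradV (k : Fin K) : Continuous fun X : Point K M N d => S.gradV X k := by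
  unfold System.gradV
  fun_prop

lemma System.continuous_stepU (γ : ℝ) : Continuous (S.stepU γ) := by
  have := S.continuous_gradU
  unfold System.stepU
  fun_prop

lemma System.continuous_stepW : Continuous S.stepW := by
  have := S.continuous_scaledMse
  unfold System.stepW
  fun_prop

lemma System.continuous_descendV (γ : ℝ) : Continuous (S.descendV γ) := by
  have := S.continuous_gradV
  unfold System.descendV
  fun_prop

lemma System.continuousAt_rescale (hP : 0 < S.P) {X : Point K M N d} (hX : 0 < power X.2.2) :
    ContinuousAt S.rescale X := by
  have h1 := (continuous_power_point (K := K) (M := M) (N := N) (d := d)).continuousAt (x := X)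
  have h2 : ContinuousAt (fun X : Point K M N d => √(S.P / power X.2.2)) X :=
    (continuousAt_const.div h1 hX.ne').sqrt
  have h3 : √(S.P / power X.2.2) ≠ 0 := (Real.sqrt_pos.mpr (by positivity)).ne'
  have h4 : ContinuousAt (fun X : Point K M N d => 1 / √(S.P / power X.2.2)) X :=
    continuousAt_const.div h2 h3
  unfold System.rescale
  fun_prop

lemma System.continuousAt_cost {X : Point K M N d} (hW : ∀ k, (X.2.1 k).PosDef) :
    ContinuousAt S.cost X := by
  unfold System.cost
  refine tendsto_finsetSum _ fun k _ => ?_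
  have h1 := S.continuous_scaledMse k
  have h2 : ContinuousAt (fun X : Point K M N d => (Matrix.det (X.2.1 k)).re) X := by fun_prop
  have h3 : ContinuousAt (fun X : Point K M N d => Real.log (Matrix.det (X.2.1 k)).re) X :=
    h2.log (det_re_pos (hW k)).ne'
  have h4 : ContinuousAt (fun X : Point K M N d =>
      (Matrix.trace (X.2.1 k * S.scaledMse X.1 X.2.2 k)).re) X := by fun_prop
  exact continuousAt_const.mul (h4.sub h3)

end Continuity

/-! ### The outer iteration -/

section Outer

variable {K M N d : ℕ} {S : System K M N d} {κ a δ c : ℝ}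

lemma System.scaledMse_of_eq_zero {U : Receivers K N d} (V : Beamformers K M d) {k : Fin K}
    (hU : U k = 0) : S.scaledMse U V k = 1 := by
  rw [System.scaledMse, S.errorCov_eq, hU]
  simp

lemma System.Admissible.scaledMse_posDef (hR : S.Regime κ a δ) {X : Point K M N d}
    (h : S.Admissible c X) (k : Fin K) : (S.scaledMse X.1 X.2.2 k).PosDef := by
  have hσ := hR.σ_pos
  rw [S.scaledMse_eq_mse hR.P_pos X.1 h.power_eq]
  exact S.errorCov_posDef (pow_pos hσ 2) _ _ _

lemma System.Admissible.stepW (hR : S.Regime κ a δ) (hcδ : c ≤ δ) {X : Point K M N d}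
    (h : S.Admissible c X) : S.Admissible 1 (S.stepW X) := by
  have hc2 : c < 2 := hcδ.trans_lt hR.lt_two
  have hE := fun k => (h.scaledMse_posDef hR k).isHermitian
  refine ⟨h.power_eq, fun k => schulz_posDef (h.posDef k) (hE k) hc2 (h.bound k),
    fun k => schulz_bound (h.posDef k) (hE k) hc2 (h.bound k),
    fun k hk => ⟨(h.inactive k hk).1, ?_⟩⟩
  have e : (S.stepW X).2.1 k = schulz (S.scaledMse X.1 X.2.2 k) (X.2.1 k) := rfl
  rw [e, System.scaledMse_of_eq_zero _ (h.inactive k hk).1, (h.inactive k hk).2, schulz, two_smul]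
  simp

lemma System.Admissible.stepW_term_le (hR : S.Regime κ a δ) (hcδ : c ≤ δ) {X : Point K M N d}
    (h : S.Admissible c X) (k : Fin K) :
    S.α k * ((Matrix.trace ((S.stepW X).2.1 k
        * S.scaledMse (S.stepW X).1 (S.stepW X).2.2 k)).re
      - Real.log (Matrix.det ((S.stepW X).2.1 k)).re)
    ≤ S.α k * ((Matrix.trace (X.2.1 k * S.scaledMse X.1 X.2.2 k)).re
      - Real.log (Matrix.det (X.2.1 k)).re) :=
  mul_le_mul_of_nonneg_left (schulz_descent (h.posDef k) (h.scaledMse_posDef hR k) hR.lt_two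
    hR.gain_eq_zero ((h.mono hcδ).bound k)) (hR.α_nonneg k)

lemma System.Admissible.cost_stepW_le (hR : S.Regime κ a δ) (hcδ : c ≤ δ) {X : Point K M N d}
    (h : S.Admissible c X) : S.cost (S.stepW X) ≤ S.cost X :=
  Finset.sum_le_sum fun k _ => h.stepW_term_le hR hcδ k

/-- If a step on `W` strictly inside the region does not decrease the cost, then every `Wₖ` is the
inverse of `Eₖ`. -/
lemma System.Admissible.mul_eq_one_of_cost_le (hR : S.Regime κ a δ) (hcδ : c < δ)
    {X : Point K M N d} (h : S.Admissible c X) (hle : S.cost X ≤ S.cost (S.stepW X)) (k : Fin K) :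
    X.2.1 k * S.scaledMse X.1 X.2.2 k = 1 := by
  rcases (hR.α_nonneg k).eq_or_lt with h0 | hpos
  · rw [System.scaledMse_of_eq_zero _ (h.inactive k h0.symm).1, (h.inactive k h0.symm).2, one_mul]
  · have heq := (Finset.sum_eq_sum_iff_of_le fun k _ => h.stepW_term_le hR hcδ.le k).mp
      (le_antisymm (h.cost_stepW_le hR hcδ.le) hle) k (Finset.mem_univ k)
    exact mul_eq_one_of_schulz_stationary (h.posDef k) (h.scaledMse_posDef hR k) hR.lt_two
      hR.gain_eq_zero hcδ (h.bound k) (mul_left_cancel₀ hpos.ne' heq).ge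

lemma System.stepW_eq_self {X : Point K M N d}
    (h : ∀ k, X.2.1 k * S.scaledMse X.1 X.2.2 k = 1) : S.stepW X = X := by
  have : (S.stepW X).2.1 = X.2.1 := by
    funext k
    have e : (S.stepW X).2.1 k = schulz (S.scaledMse X.1 X.2.2 k) (X.2.1 k) := rfl
    rw [e, schulz, mul_eq_one_comm.mp (h k), two_smul]
    simp
  exact Prod.ext rfl (Prod.ext this rfl)

/-- The step sizes are small enough: `1 / L` for descent, and each inner step raises the eigenvalue
bound by at most `η = (δ - 1) / (Ju + Jv)`. -/
structure System.StepSizes (S : System K M N d) (κ a δ γu γv η : ℝ) (Ju Jv : ℕ) : Prop where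
  γu_pos : 0 < γu
  γv_pos : 0 < γv
  γu_le : γu ≤ 1 / S.Lu κ a δ
  γv_le : γv ≤ 1 / S.Lv κ a δ
  η_pos : 0 < η
  η_lt : η < 1
  growth_u : S.Lc κ a δ * γu ^ 2 + S.Ld κ a δ * γu ≤ η
  growth_v : S.La κ a δ * γv ^ 2 + S.Lb κ a δ * γv ≤ η
  budget : 1 + Jv * η + Ju * η = δ

variable {γu γv η : ℝ} {Ju Jw Jv : ℕ}

lemma System.Admissible.iterate_stepU (hR : S.Regime κ a δ)
    (hs : S.StepSizes κ a δ γu γv η Ju Jv) (hc : 0 ≤ c) {X : Point K M N d}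
    (h : S.Admissible c X) (j : ℕ) (hj : c + j * η ≤ δ) :
    S.Admissible (c + j * η) ((S.stepU γu)^[j] X) ∧ S.cost ((S.stepU γu)^[j] X) ≤ S.cost X := by
  have hη := hs.η_pos
  induction j with
  | zero => simpa using h
  | succ j ih =>
    push_cast at hj ⊢
    have hj' : c + j * η ≤ δ := by linarith
    obtain ⟨h1, h2⟩ := ih hj'
    have hcj : 0 ≤ c + j * η := by positivity
    rw [Function.iterate_succ_apply']
    refine ⟨?_, ?_⟩
    · have := h1.stepU hR hcj hj' hs.γu_pos.le hs.growth_u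
      convert this using 1
      ring
    · have h3 := h1.cost_stepU_le hR hcj hj' hs.γu_pos.le hs.γu_le
      have h4 : 0 ≤ γu / 2 * ∑ k, frob (S.gradU ((S.stepU γu)^[j] X) k) :=
        mul_nonneg (by linarith [hs.γu_pos]) (Finset.sum_nonneg fun k _ => frob_nonneg _)
      linarith

lemma System.Admissible.iterate_stepW (hR : S.Regime κ a δ) {X : Point K M N d}
    (h : S.Admissible 1 X) (j : ℕ) :
    S.Admissible 1 (S.stepW^[j] X) ∧ S.cost (S.stepW^[j] X) ≤ S.cost X := by
  induction j with
  | zero => simpa using h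
  | succ j ih =>
    rw [Function.iterate_succ_apply']
    exact ⟨ih.1.stepW hR hR.one_lt.le, (ih.1.cost_stepW_le hR hR.one_lt.le).trans ih.2⟩

lemma System.Admissible.cost_stepV_le (hR : S.Regime κ a δ)
    (hs : S.StepSizes κ a δ γu γv η Ju Jv) (hc : 0 ≤ c) (hcδ : c ≤ δ) {X : Point K M N d}
    (h : S.Admissible c X) :
    S.cost (S.stepV γv X) ≤ S.cost X - γv / 2 * ∑ k, frob (S.gradV X k) := by
  have hpos := h.power_descendV_pos hR hc hcδ hs.γv_pos.le hs.growth_v hs.η_lt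
  rw [show S.stepV γv X = S.rescale (S.descendV γv X) from rfl, System.cost_rescale hR.P_pos hpos]
  exact h.cost_descendV_le hR hc hcδ hs.γv_pos.le hs.γv_le

lemma System.Admissible.continuousAt_stepV (hR : S.Regime κ a δ)
    (hs : S.StepSizes κ a δ γu γv η Ju Jv) (hc : 0 ≤ c) (hcδ : c ≤ δ) {X : Point K M N d}
    (h : S.Admissible c X) : ContinuousAt (S.stepV γv) X :=
  ContinuousAt.comp (S.continuousAt_rescale hR.P_pos
    (h.power_descendV_pos hR hc hcδ hs.γv_pos.le hs.growth_v hs.η_lt))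
    (S.continuous_descendV γv).continuousAt

lemma System.Admissible.iterate_stepV (hR : S.Regime κ a δ)
    (hs : S.StepSizes κ a δ γu γv η Ju Jv) (hc : 0 ≤ c) {X : Point K M N d}
    (h : S.Admissible c X) (j : ℕ) (hj : c + j * η ≤ δ) :
    S.Admissible (c + j * η) ((S.stepV γv)^[j] X) ∧ S.cost ((S.stepV γv)^[j] X) ≤ S.cost X ∧
      ContinuousAt (S.stepV γv)^[j] X := by
  have hη := hs.η_pos
  induction j with
  | zero => simpa using ⟨h, continuousAt_id⟩
  | succ j ih =>
    push_cast at hj ⊢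
    have hj' : c + j * η ≤ δ := by linarith
    obtain ⟨h1, h2, h5⟩ := ih hj'
    have hcj : 0 ≤ c + j * η := by positivity
    rw [Function.iterate_succ_apply', Function.iterate_succ']
    refine ⟨?_, ?_, (h1.continuousAt_stepV hR hs hcj hj').comp h5⟩
    · have := h1.stepV hR hcj hj' hs.γv_pos.le hs.growth_v hs.η_lt
      convert this using 1
      ring
    · have h3 := h1.cost_stepV_le hR hs hcj hj'
      have h4 : 0 ≤ γv / 2 * ∑ k, frob (S.gradV ((S.stepV γv)^[j] X) k) :=
        mul_nonneg (by linarith [hs.γv_pos]) (Finset.sum_nonneg fun k _ => frob_nonneg _)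
      linarith

lemma System.StepSizes.le_delta (hs : S.StepSizes κ a δ γu γv η Ju Jv) : 1 + Jv * η ≤ δ := by
  rw [← hs.budget]
  have := hs.η_pos
  have : 0 ≤ Ju * η := by positivity
  linarith

lemma System.StepSizes.bound_nonneg (hs : S.StepSizes κ a δ γu γv η Ju Jv) :
    0 ≤ 1 + Jv * η := by
  have := hs.η_pos
  positivity

/-- The outer iteration maps the admissible region with bound `1 + Jv η` into itself: the `Ju`
steps on `U` raise the bound to at most `δ`, the Schulz steps reset it to `1`, and the `Jv` steps
on `V` raise it to `1 + Jv η`. The cost does not increase. -/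
lemma System.Admissible.outerIteration (hR : S.Regime κ a δ)
    (hs : S.StepSizes κ a δ γu γv η Ju Jv) (hJw : 1 ≤ Jw) {X : Point K M N d}
    (h : S.Admissible (1 + Jv * η) X) :
    S.Admissible (1 + Jv * η) (S.outerIteration γu γv Ju Jw Jv X) ∧
      S.cost (S.outerIteration γu γv Ju Jw Jv X) ≤ S.cost X ∧
      ContinuousAt (S.outerIteration γu γv Ju Jw Jv) X := by
  obtain ⟨hu, hu'⟩ := h.iterate_stepU hR hs hs.bound_nonneg Ju hs.budget.le
  have hw : S.Admissible 1 (S.stepW^[Jw] ((S.stepU γu)^[Ju] X)) ∧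
      S.cost (S.stepW^[Jw] ((S.stepU γu)^[Ju] X)) ≤ S.cost ((S.stepU γu)^[Ju] X) := by
    obtain ⟨j, rfl⟩ := Nat.exists_eq_add_of_le' hJw
    rw [Function.iterate_succ_apply]
    have h1 := (hu.stepW hR hs.budget.le).iterate_stepW hR j
    exact ⟨h1.1, h1.2.trans (hu.cost_stepW_le hR hs.budget.le)⟩
  obtain ⟨hv, hv', hv''⟩ := hw.1.iterate_stepV hR hs zero_le_one Jv hs.le_delta
  refine ⟨hv, hv'.trans (hw.2.trans hu'), ?_⟩
  have h2 : Continuous fun X => S.stepW^[Jw] ((S.stepU γu)^[Ju] X) :=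
    (S.continuous_stepW.iterate Jw).comp ((S.continuous_stepU γu).iterate Ju)
  exact ContinuousAt.comp (f := fun X => S.stepW^[Jw] ((S.stepU γu)^[Ju] X))
    (g := (S.stepV γv)^[Jv]) hv'' h2.continuousAt

/-- A point whose cost is not decreased by an outer iteration is a common zero of the gradients,
with every `Wₖ` inverse to `Eₖ`. -/
lemma System.Admissible.stationary_of_cost_le (hR : S.Regime κ a δ)
    (hs : S.StepSizes κ a δ γu γv η Ju Jv) (hJu : 1 ≤ Ju) (hJw : 1 ≤ Jw) (hJv : 1 ≤ Jv)
    {X : Point K M N d} (h : S.Admissible (1 + Jv * η) X)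
    (hle : S.cost X ≤ S.cost (S.outerIteration γu γv Ju Jw Jv X)) :
    (∀ k, S.gradU X k = 0) ∧ (∀ k, X.2.1 k * S.scaledMse X.1 X.2.2 k = 1) ∧
      ∀ k, S.gradV X k = 0 := by
  have hη := hs.η_pos
  have hsum : ∀ {m n : ℕ} (G : Fin K → Matrix (Fin m) (Fin n) ℂ) {γ : ℝ}, 0 < γ →
      0 ≤ γ / 2 * ∑ k, frob (G k) ∧ (γ / 2 * ∑ k, frob (G k) ≤ 0 → ∀ k, G k = 0) :=
    fun G γ hγ => by
      have h0 : 0 ≤ ∑ k, frob (G k) := Finset.sum_nonneg fun k _ => frob_nonneg _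
      refine ⟨by positivity, fun hle k => eq_zero_of_frob_eq_zero ?_⟩
      have h1 : ∑ k, frob (G k) = 0 := by nlinarith
      exact (Finset.sum_eq_zero_iff_of_nonneg fun k _ => frob_nonneg _).mp h1 k (Finset.mem_univ k)
  have hlt : 1 + Jv * η < δ := by
    rw [← hs.budget]
    have : (1 : ℝ) ≤ Ju := by exact_mod_cast hJu
    nlinarith
  have hc := hs.bound_nonneg
  -- Later steps do not increase the cost, so the first step on `U` has to keep it.
  obtain ⟨hu, -⟩ := h.iterate_stepU hR hs hc Ju hs.budget.le
  have hwv : ∀ Y : Point K M N d, S.Admissible δ Y →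
      S.cost ((S.stepV γv)^[Jv] (S.stepW^[Jw] Y)) ≤ S.cost (S.stepW Y) := fun Y hY => by
    obtain ⟨j, rfl⟩ := Nat.exists_eq_add_of_le' hJw
    have h1 := (hY.stepW hR le_rfl).iterate_stepW hR j
    rw [Function.iterate_succ_apply]
    exact (h1.1.iterate_stepV hR hs zero_le_one Jv hs.le_delta).2.1.trans h1.2
  have hgu : ∀ k, S.gradU X k = 0 := by
    have h1 := (hwv _ (hs.budget ▸ hu)).trans (hu.cost_stepW_le hR hs.budget.le)
    have h2 : S.cost ((S.stepU γu)^[Ju] X) ≤ S.cost (S.stepU γu X) := by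
      obtain ⟨j, rfl⟩ := Nat.exists_eq_add_of_le' hJu
      rw [Function.iterate_succ_apply]
      refine ((h.stepU hR hc hs.le_delta hs.γu_pos.le hs.growth_u).iterate_stepU hR hs
        (by positivity) j ?_).2
      have := hs.budget
      push_cast at this
      linarith
    have h3 := h.cost_stepU_le hR hc hs.le_delta hs.γu_pos.le hs.γu_le
    refine (hsum (fun k => S.gradU X k) hs.γu_pos).2 ?_
    have h4 := hle.trans h1
    linarith
  have hfu : S.stepU γu X = X := by
    refine Prod.ext ?_ rfl
    funext k
    simp [System.stepU, hgu]
  have hout : S.outerIteration γu γv Ju Jw Jv X = (S.stepV γv)^[Jv] (S.stepW^[Jw] X) := by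
    rw [System.outerIteration, Function.iterate_fixed hfu]
  rw [hout] at hle
  have hWE := h.mul_eq_one_of_cost_le hR hlt
    (hle.trans (hwv X (h.mono hs.le_delta)))
  rw [Function.iterate_fixed (System.stepW_eq_self hWE)] at hle
  refine ⟨hgu, hWE, ?_⟩
  have h1 : S.Admissible 1 X := by
    have := h.stepW hR hs.le_delta
    rwa [System.stepW_eq_self hWE] at this
  have h2 : S.cost ((S.stepV γv)^[Jv] X) ≤ S.cost (S.stepV γv X) := by
    have hb := hs.le_delta
    obtain ⟨j, rfl⟩ := Nat.exists_eq_add_of_le' hJv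
    push_cast at hb
    rw [Function.iterate_succ_apply]
    refine ((h1.stepV hR zero_le_one hR.one_lt.le hs.γv_pos.le hs.growth_v hs.η_lt).iterate_stepV
      hR hs (by positivity) j ?_).2.1
    linarith
  have h3 := h1.cost_stepV_le hR hs zero_le_one hR.one_lt.le
  refine (hsum (fun k => S.gradV X k) hs.γv_pos).2 ?_
  linarith

end Outer

/-! ### Limit points -/

section Limit

variable {K M N d : ℕ} {S : System K M N d} {κ a δ c γu γv η : ℝ} {Ju Jw Jv : ℕ}

lemma isClosed_setOf_posSemidef {n : Type*} [Fintype n] :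
    IsClosed {A : Matrix n n ℂ | A.PosSemidef} := by
  have h : {A : Matrix n n ℂ | A.PosSemidef}
      = {A | Aᴴ = A} ∩ ⋂ x : n → ℂ, {A | 0 ≤ star x ⬝ᵥ (A *ᵥ x)} := by
    ext A
    simp [Matrix.posSemidef_iff_dotProduct_mulVec, Matrix.IsHermitian]
  rw [h]
  refine IsClosed.inter (isClosed_eq (by fun_prop) continuous_id) ?_
  exact isClosed_iInter fun x => isClosed_le continuous_const
    (Continuous.dotProduct continuous_const (Continuous.matrix_mulVec continuous_id
      continuous_const))

lemma re_trace_mul_nonneg {n : Type*} [Fintype n] [DecidableEq n] {W E : Matrix n n ℂ}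
    (hW : W.PosDef) (hE : E.PosSemidef) : 0 ≤ (Matrix.trace (W * E)).re := by
  obtain ⟨F, -, -, hF, -⟩ := exists_simultaneous_diagonalization hW Matrix.isHermitian_one
  rw [hF, Matrix.mul_assoc, Matrix.trace_mul_comm]
  exact (Complex.le_def.mp (hE.conjTranspose_mul_mul_same F).trace_nonneg).1

/-- A bound on the cost keeps the determinants of the weights away from zero. -/
lemma System.Admissible.exp_neg_cost_le (hR : S.Regime κ a δ) {X : Point K M N d}
    (h : S.Admissible c X) : Real.exp (-S.cost X) ≤ ∏ k, (X.2.1 k).det.re ^ S.α k := by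
  have h1 : ∀ k ∈ Finset.univ, (X.2.1 k).det.re ^ S.α k
      = Real.exp (S.α k * Real.log (X.2.1 k).det.re) := fun k _ => by
    rw [Real.rpow_def_of_pos (det_re_pos (h.posDef k)), mul_comm]
  rw [Finset.prod_congr rfl h1, ← Real.exp_sum, Real.exp_le_exp, System.cost,
    ← Finset.sum_neg_distrib]
  refine Finset.sum_le_sum fun k _ => ?_
  have h2 := mul_nonneg (hR.α_nonneg k)
    (re_trace_mul_nonneg (h.posDef k) (h.scaledMse_posDef hR k).posSemidef)
  linarith

lemma System.Admissible.of_mapClusterPt (hR : S.Regime κ a δ) {x : ℕ → Point K M N d} {C : ℝ}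
    (hx : ∀ l, S.Admissible c (x l)) (hC : ∀ l, S.cost (x l) ≤ C) {X : Point K M N d}
    (hX : MapClusterPt X Filter.atTop x) : S.Admissible c X := by
  have hmem : ∀ {s : Set (Point K M N d)}, IsClosed s → (∀ l, x l ∈ s) → X ∈ s :=
    fun hs h => hs.mem_of_mapClusterPt hX (Filter.Eventually.of_forall h)
  have hpow : power X.2.2 = S.P :=
    hmem (s := {X | power X.2.2 = S.P}) (isClosed_eq continuous_power_point continuous_const)
      fun l => (hx l).power_eq
  have hpsd : ∀ k, (X.2.1 k).PosSemidef := fun k =>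
    hmem (s := {X | (X.2.1 k).PosSemidef})
      (isClosed_setOf_posSemidef.preimage (f := fun X : Point K M N d => X.2.1 k) (by fun_prop))
      fun l => ((hx l).posDef k).posSemidef
  have hbd : ∀ k, (c • X.2.1 k - X.2.1 k * S.scaledMse X.1 X.2.2 k * X.2.1 k).PosSemidef :=
    fun k => by
      have := S.continuous_scaledMse k
      exact hmem (s := {X | (c • X.2.1 k - X.2.1 k * S.scaledMse X.1 X.2.2 k
        * X.2.1 k).PosSemidef}) (isClosed_setOf_posSemidef.preimage (f := fun X : Point K M N d =>
          c • X.2.1 k - X.2.1 k * S.scaledMse X.1 X.2.2 k * X.2.1 k) (by fun_prop))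
        fun l => (hx l).bound k
  have hin : ∀ k, S.α k = 0 → X.1 k = 0 ∧ X.2.1 k = 1 := fun k hk =>
    ⟨hmem (s := {X | X.1 k = 0}) (isClosed_eq (by fun_prop) continuous_const)
        fun l => ((hx l).inactive k hk).1,
      hmem (s := {X | X.2.1 k = 1}) (isClosed_eq (by fun_prop) continuous_const)
        fun l => ((hx l).inactive k hk).2⟩
  have hdet : Real.exp (-C) ≤ ∏ k, (X.2.1 k).det.re ^ S.α k := by
    refine hmem (s := {X | Real.exp (-C) ≤ ∏ k, (X.2.1 k).det.re ^ S.α k})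
      (isClosed_le continuous_const (continuous_finsetProd _ fun k _ =>
        (Real.continuous_rpow_const (hR.α_nonneg k)).comp (by fun_prop))) fun l => ?_
    exact le_trans (Real.exp_le_exp.mpr (neg_le_neg (hC l))) ((hx l).exp_neg_cost_le hR)
  refine ⟨hpow, fun k => ?_, hbd, hin⟩
  rcases (hR.α_nonneg k).eq_or_lt with h0 | hpos
  · rw [(hin k h0.symm).2]
    exact Matrix.PosDef.one
  · rw [(hpsd k).posDef_iff_det_ne_zero]
    intro hz
    have : ∏ k, (X.2.1 k).det.re ^ S.α k = 0 :=
      Finset.prod_eq_zero (Finset.mem_univ k) (by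
        rw [hz, Complex.zero_re, Real.zero_rpow hpos.ne'])
    rw [this] at hdet
    exact absurd hdet (not_le.mpr (Real.exp_pos _))

/-- Every limit point of the iterates is a common zero of the gradients with `Wₖ = Eₖ⁻¹`: the cost
converges to its value at the limit point, and by continuity one more outer iteration cannot
decrease it. -/
lemma System.stationary_of_mapClusterPt (hR : S.Regime κ a δ)
    (hs : S.StepSizes κ a δ γu γv η Ju Jv) (hJu : 1 ≤ Ju) (hJw : 1 ≤ Jw) (hJv : 1 ≤ Jv)
    {V₀ : Beamformers K M d} (hV₀ : power V₀ = S.P) {X : Point K M N d}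
    (hX : MapClusterPt X Filter.atTop (S.iterates γu γv Ju Jw Jv V₀)) :
    S.Admissible (1 + Jv * η) X ∧ (∀ k, S.gradU X k = 0) ∧
      (∀ k, X.2.1 k * S.scaledMse X.1 X.2.2 k = 1) ∧ ∀ k, S.gradV X k = 0 := by
  set x := S.iterates γu γv Ju Jw Jv V₀ with hxdef
  have hsucc : ∀ l, x (l + 1) = S.outerIteration γu γv Ju Jw Jv (x l) := fun l =>
    Function.iterate_succ_apply' _ _ _
  have hadm : ∀ l, S.Admissible (1 + Jv * η) (x l) := by
    intro l
    induction l with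
    | zero =>
      have h0 : S.Admissible 1 (x 0) := by
        refine ⟨hV₀, fun k => Matrix.PosDef.one, fun k => ?_, fun k _ => ⟨rfl, rfl⟩⟩
        have hE : S.scaledMse (x 0).1 (x 0).2.2 k = 1 := System.scaledMse_of_eq_zero _ rfl
        have hW : (x 0).2.1 k = 1 := rfl
        rw [hE, hW]
        simpa using Matrix.PosSemidef.zero
      refine h0.mono ?_
      have := hs.η_pos
      have : 0 ≤ Jv * η := by positivity
      linarith
    | succ l ih =>
      rw [hsucc]
      exact (ih.outerIteration hR hs hJw).1
  have hanti : Antitone fun l => S.cost (x l) := antitone_nat_of_succ_le fun l => by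
    rw [hsucc]
    exact ((hadm l).outerIteration hR hs hJw).2.1
  have hXadm : S.Admissible (1 + Jv * η) X :=
    System.Admissible.of_mapClusterPt hR hadm (fun l => hanti (Nat.zero_le l)) hX
  obtain ⟨hA, -, hcont⟩ := hXadm.outerIteration hR hs hJw
  have hle : ∀ l, S.cost X ≤ S.cost (x l) := fun l =>
    isClosed_Iic.mem_of_mapClusterPt (hX.continuousAt_comp (S.continuousAt_cost hXadm.posDef))
      (Filter.eventually_atTop.mpr ⟨l, fun m hm => hanti hm⟩)
  have hge : S.cost X ≤ S.cost (S.outerIteration γu γv Ju Jw Jv X) := by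
    have h1 : ContinuousAt (fun Y => S.cost (S.outerIteration γu γv Ju Jw Jv Y)) X :=
      ContinuousAt.comp (g := S.cost) (S.continuousAt_cost hA.posDef) hcont
    refine isClosed_Ici.mem_of_mapClusterPt (hX.continuousAt_comp h1)
      (Filter.Eventually.of_forall fun l => ?_)
    have := hle (l + 1)
    rwa [hsucc] at this
  exact ⟨hXadm, hXadm.stationary_of_cost_le hR hs hJu hJw hJv hge⟩

end Limit

/-! ### The weighted sum rate as the lower envelope of the reformulated cost -/

section Envelope

variable {K M N d : ℕ} {S : System K M N d}

lemma gram_add_smul_one_posDef {m n : Type*} [Fintype m] [DecidableEq m] [Fintype n] {v : ℝ}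
    (hv : 0 < v) {s : Finset n} (A : n → Matrix m m ℂ) (hA : ∀ k, (A k).PosSemidef) :
    (∑ k ∈ s, A k + v • (1 : Matrix m m ℂ)).PosDef := by
  refine Matrix.PosDef.posSemidef_add (Matrix.posSemidef_sum s fun k _ => hA k) ?_
  have h0 : (0 : ℂ) < (v : ℂ) := Complex.zero_lt_real.mpr hv
  have := (Matrix.PosDef.one (n := m) (R := ℂ)).smul h0
  have e : (v : ℂ) • (1 : Matrix m m ℂ) = v • 1 := by ext i j; simp
  rwa [e] at this

lemma signal_posSemidef (V : Beamformers K M d) (k m : Fin K) :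
    (S.H k * V m * (V m)ᴴ * (S.H k)ᴴ).PosSemidef := by
  have := Matrix.posSemidef_self_mul_conjTranspose (S.H k * V m)
  rwa [Matrix.conjTranspose_mul, ← Matrix.mul_assoc] at this

lemma System.interference_posDef (hσ : 0 < S.σ) (V : Beamformers K M d) (k : Fin K) :
    (S.interference V k).PosDef :=
  gram_add_smul_one_posDef (pow_pos hσ 2) _ (signal_posSemidef V k)

lemma System.receivedCov_eq_sum (v : ℝ) (V : Beamformers K M d) (k : Fin K) :
    S.receivedCov v V k = ∑ m, S.H k * V m * (V m)ᴴ * (S.H k)ᴴ + v • 1 := by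
  simp only [System.receivedCov, Matrix.mul_sum, Matrix.sum_mul, Matrix.mul_assoc]

lemma System.receivedCov_posDef (hσ : 0 < S.σ) (V : Beamformers K M d) (k : Fin K) :
    (S.receivedCov (S.σ ^ 2) V k).PosDef := by
  rw [S.receivedCov_eq_sum]
  exact gram_add_smul_one_posDef (pow_pos hσ 2) _ (signal_posSemidef V k)

lemma System.receivedCov_eq_add (V : Beamformers K M d) (k : Fin K) :
    S.receivedCov (S.σ ^ 2) V k
      = S.interference V k + S.H k * V k * (V k)ᴴ * (S.H k)ᴴ := by
  rw [S.receivedCov_eq_sum, System.interference, ← Finset.add_sum_erase _ _ (Finset.mem_univ k)]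
  abel

/-- The rate as a difference of two log-determinants. -/
lemma System.rate_eq (hσ : 0 < S.σ) (V : Beamformers K M d) (k : Fin K) :
    S.rate V k = Real.log (S.receivedCov (S.σ ^ 2) V k).det.re
      - Real.log (S.interference V k).det.re := by
  have hJ := S.interference_posDef hσ V k
  have hR := S.receivedCov_posDef hσ V k
  have hJu : IsUnit (S.interference V k).det := (Matrix.isUnit_iff_isUnit_det _).mp hJ.isUnit
  have h1 : (1 + S.H k * V k * (V k)ᴴ * (S.H k)ᴴ * (S.interference V k)⁻¹)
      * S.interference V k = S.receivedCov (S.σ ^ 2) V k := by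
    rw [Matrix.add_mul, Matrix.one_mul, Matrix.mul_assoc, Matrix.nonsing_inv_mul _ hJu,
      Matrix.mul_one, S.receivedCov_eq_add]
  have h2 : (1 + S.H k * V k * (V k)ᴴ * (S.H k)ᴴ * (S.interference V k)⁻¹).det.re
      * (S.interference V k).det.re = (S.receivedCov (S.σ ^ 2) V k).det.re := by
    rw [← h1, Matrix.det_mul, Complex.mul_re, det_im_eq_zero hJ.isHermitian]
    ring
  rw [System.rate, ← Real.log_div (det_re_pos hR).ne' (det_re_pos hJ).ne', ← h2,
    mul_div_cancel_right₀ _ (det_re_pos hJ).ne']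

/-- The error covariance of the MMSE receiver has determinant `exp (-Rₖ)`, by the
Weinstein–Aronszajn identity. -/
lemma System.log_det_mse (hσ : 0 < S.σ) {U : Receivers K N d} {V : Beamformers K M d} {k : Fin K}
    (hU : S.receivedCov (S.σ ^ 2) V k * U k = S.H k * V k) :
    Real.log (S.mse U V k).det.re = -S.rate V k := by
  have hJ := S.interference_posDef hσ V k
  have hR := S.receivedCov_posDef hσ V k
  have hE : (S.mse U V k).PosDef := S.errorCov_posDef (pow_pos hσ 2) U V k
  have h1 : S.mse U V k = 1 - (S.H k * V k)ᴴ * U k := by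
    rw [System.mse, S.errorCov_eq, Matrix.mul_assoc, hU]
    abel
  have h2 : S.receivedCov (S.σ ^ 2) V k * (1 - U k * (S.H k * V k)ᴴ) = S.interference V k := by
    rw [Matrix.mul_sub, ← Matrix.mul_assoc, hU, Matrix.mul_one, S.receivedCov_eq_add,
      Matrix.conjTranspose_mul, ← Matrix.mul_assoc, add_sub_cancel_right]
  have h3 : (S.receivedCov (S.σ ^ 2) V k).det.re * (S.mse U V k).det.re
      = (S.interference V k).det.re := by
    rw [← h2, Matrix.det_mul, ← Matrix.det_one_sub_mul_comm, ← h1, Complex.mul_re,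
      det_im_eq_zero hR.isHermitian]
    ring
  rw [S.rate_eq hσ, ← h3, Real.log_mul (det_re_pos hR).ne' (det_re_pos hE).ne']
  ring

lemma System.rate_bound (hσ : 0 < S.σ) (U : Receivers K N d) (V : Beamformers K M d) (k : Fin K)
    {W : Matrix (Fin d) (Fin d) ℂ} (hW : W.PosDef) :
    (d : ℝ) - S.rate V k ≤ (Matrix.trace (W * S.mse U V k)).re - Real.log W.det.re := by
  have hR := S.receivedCov_posDef hσ V k
  have hRu : IsUnit (S.receivedCov (S.σ ^ 2) V k).det :=
    (Matrix.isUnit_iff_isUnit_det _).mp hR.isUnit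
  set U' : Receivers K N d := fun _ => (S.receivedCov (S.σ ^ 2) V k)⁻¹ * (S.H k * V k) with hU'
  have hRU : S.receivedCov (S.σ ^ 2) V k * U' k = S.H k * V k := by
    rw [hU', ← Matrix.mul_assoc, Matrix.mul_nonsing_inv _ hRu, Matrix.one_mul]
  obtain ⟨F, -, -, hF, -⟩ := exists_simultaneous_diagonalization hW Matrix.isHermitian_one
  have h1 := S.re_trace_errorCov_add (S.σ ^ 2) (U := U') (U' := U) V (k := k) (D := U k - U' k)
    (by abel) hW.isHermitian
  rw [S.re_trace_receivedCov _ _ _ _ hF, hRU, sub_self, Matrix.zero_mul, Matrix.mul_zero,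
    Matrix.trace_zero, Complex.zero_re, mul_zero, add_zero] at h1
  have h2 := card_add_log_det_le hW (S.errorCov_posDef (pow_pos hσ 2) U' V k)
  have h3 := S.log_det_mse hσ hRU
  rw [System.mse] at h3 ⊢
  rw [Fintype.card_fin, h3] at h2
  have h4 := frob_nonneg ((stack V)ᴴ * (S.H k)ᴴ * ((U k - U' k) * F))
  have h5 := frob_nonneg ((U k - U' k) * F)
  have h6 : 0 ≤ S.σ ^ 2 * frob ((U k - U' k) * F) := by positivity
  linarith

lemma System.rate_bound_eq (hσ : 0 < S.σ) {U : Receivers K N d} {V : Beamformers K M d} {k : Fin K}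
    {W : Matrix (Fin d) (Fin d) ℂ} (hW : W.PosDef)
    (hU : S.receivedCov (S.σ ^ 2) V k * U k = S.H k * V k) (hWE : W * S.mse U V k = 1) :
    (Matrix.trace (W * S.mse U V k)).re - Real.log W.det.re = (d : ℝ) - S.rate V k := by
  have hE : (S.mse U V k).PosDef := S.errorCov_posDef (pow_pos hσ 2) U V k
  rw [trace_sub_log_det_eq hW hE hWE, S.log_det_mse hσ hU, Fintype.card_fin]
  ring

lemma System.envelope_le (hα : ∀ k, 0 ≤ S.α k) (hσ : 0 < S.σ) {X : Point K M N d}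
    (hW : ∀ k, (X.2.1 k).PosDef) :
    d * ∑ k, S.α k - S.weightedSumRate X.2.2 ≤ S.wmmseCost X := by
  rw [System.weightedSumRate, System.wmmseCost, Finset.mul_sum, ← Finset.sum_sub_distrib]
  refine Finset.sum_le_sum fun k _ => ?_
  have := mul_le_mul_of_nonneg_left (S.rate_bound hσ X.1 X.2.2 k (hW k)) (hα k)
  linarith

/-- `X` attains the envelope: users of positive priority have the MMSE receiver and the inverse
error covariance as weight. -/
def System.Matched (S : System K M N d) (X : Point K M N d) : Prop :=
  ∀ k, S.α k = 0 ∨ (S.receivedCov (S.σ ^ 2) X.2.2 k * X.1 k = S.H k * X.2.2 k ∧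
    X.2.1 k * S.mse X.1 X.2.2 k = 1)

lemma System.envelope_eq (hσ : 0 < S.σ) {X : Point K M N d} (hW : ∀ k, (X.2.1 k).PosDef)
    (hX : S.Matched X) : S.wmmseCost X = d * ∑ k, S.α k - S.weightedSumRate X.2.2 := by
  rw [System.weightedSumRate, System.wmmseCost, Finset.mul_sum, ← Finset.sum_sub_distrib]
  refine Finset.sum_congr rfl fun k _ => ?_
  rcases hX k with h0 | ⟨h1, h2⟩
  · rw [h0]; ring
  · rw [S.rate_bound_eq hσ (hW k) h1 h2]; ring

lemma System.wmmseCost_eq_cost_add (X : Point K M N d) :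
    S.wmmseCost X = S.cost X + S.σ ^ 2 * (1 - power X.2.2 / S.P)
      * ∑ k, S.α k * (Matrix.trace (X.2.1 k * (X.1 k)ᴴ * X.1 k)).re := by
  rw [System.wmmseCost, System.cost, Finset.mul_sum, ← Finset.sum_add_distrib]
  refine Finset.sum_congr rfl fun k _ => ?_
  have h1 : S.mse X.1 X.2.2 k = S.scaledMse X.1 X.2.2 k
      + (S.σ ^ 2 * (1 - power X.2.2 / S.P)) • ((X.1 k)ᴴ * X.1 k) := by
    rw [System.mse, System.scaledMse, System.errorCov, System.errorCov, add_assoc _ (_ • _),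
      ← add_smul]
    congr 2
    ring
  rw [h1, Matrix.mul_add, Matrix.trace_add, Complex.add_re, Matrix.mul_smul, re_trace_real_smul,
    Matrix.mul_assoc]
  ring

end Envelope

/-! ### Differentiability and Fermat's rule -/

section EntrywiseDifferentiability

variable {E : Type*} [NormedAddCommGroup E] [NormedSpace ℝ E] {l m n : Type*} {x : E}

/-- A matrix-valued function with differentiable entries. -/
def EntrywiseDifferentiableAt (A : E → Matrix m n ℂ) (x : E) : Prop :=
  ∀ i j, DifferentiableAt ℝ (fun y => A y i j) x

namespace EntrywiseDifferentiableAt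

variable {A A' : E → Matrix m n ℂ} {B : E → Matrix n l ℂ} {C : E → Matrix n n ℂ}

lemma const (A : Matrix m n ℂ) : EntrywiseDifferentiableAt (fun _ => A) x :=
  fun _ _ => differentiableAt_const _

lemma add (hA : EntrywiseDifferentiableAt A x) (hA' : EntrywiseDifferentiableAt A' x) :
    EntrywiseDifferentiableAt (fun y => A y + A' y) x :=
  fun i j => (hA i j).add (hA' i j)

lemma sub (hA : EntrywiseDifferentiableAt A x) (hA' : EntrywiseDifferentiableAt A' x) :
    EntrywiseDifferentiableAt (fun y => A y - A' y) x :=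
  fun i j => (hA i j).sub (hA' i j)

lemma const_smul (r : ℝ) (hA : EntrywiseDifferentiableAt A x) :
    EntrywiseDifferentiableAt (fun y => r • A y) x :=
  fun i j => (hA i j).const_smul r

lemma sum {ι : Type*} {s : Finset ι} {A : ι → E → Matrix m n ℂ}
    (hA : ∀ k, EntrywiseDifferentiableAt (A k) x) :
    EntrywiseDifferentiableAt (fun y => ∑ k ∈ s, A k y) x := fun i j => by
  simp only [Matrix.sum_apply]
  exact DifferentiableAt.fun_sum fun k _ => hA k i j

lemma mul [Fintype n] (hA : EntrywiseDifferentiableAt A x) (hB : EntrywiseDifferentiableAt B x) :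
    EntrywiseDifferentiableAt (fun y => A y * B y) x := fun i j => by
  simp only [Matrix.mul_apply]
  exact DifferentiableAt.fun_sum fun k _ => (hA i k).mul (hB k j)

lemma conjTranspose (hA : EntrywiseDifferentiableAt A x) :
    EntrywiseDifferentiableAt (fun y => (A y)ᴴ) x := fun i j =>
  Complex.conjCLE.differentiableAt.comp x (hA j i)

lemma re_trace [Fintype n] (hC : EntrywiseDifferentiableAt C x) :
    DifferentiableAt ℝ (fun y => (Matrix.trace (C y)).re) x := by
  refine Complex.reCLM.differentiableAt.comp x ?_
  simp only [Matrix.trace, Matrix.diag_apply]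
  exact DifferentiableAt.fun_sum fun k _ => hC k k

lemma re_det [Fintype n] [DecidableEq n] (hC : EntrywiseDifferentiableAt C x) :
    DifferentiableAt ℝ (fun y => (Matrix.det (C y)).re) x := by
  refine Complex.reCLM.differentiableAt.comp x ?_
  simp only [Matrix.det_apply']
  exact DifferentiableAt.fun_sum fun p _ => (differentiableAt_const _).mul
    (HasFDerivAt.finsetProd fun k _ => (hC (p k) k).hasFDerivAt).differentiableAt

lemma log_det [Fintype n] [DecidableEq n] (hC : EntrywiseDifferentiableAt C x) (hx : (C x).PosDef) :
    DifferentiableAt ℝ (fun y => Real.log (Matrix.det (C y)).re) x :=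
  hC.re_det.log (det_re_pos hx).ne'

end EntrywiseDifferentiableAt

end EntrywiseDifferentiability

section Stationarity

-- The entrywise sup norm induces the product topology that stationarity refers to.
attribute [local instance] Matrix.normedAddCommGroup Matrix.normedSpace

variable {K M N d : ℕ} {S : System K M N d}

lemma entrywiseDifferentiableAt_beamformer (V : Beamformers K M d) (k : Fin K) :
    EntrywiseDifferentiableAt (fun V : Beamformers K M d => V k) V := fun i j => by
  fun_prop

lemma System.differentiableAt_weightedSumRate (hσ : 0 < S.σ) (V : Beamformers K M d) :
    DifferentiableAt ℝ S.weightedSumRate V := by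
  have hV := entrywiseDifferentiableAt_beamformer V
  have hs : ∀ k m : Fin K, EntrywiseDifferentiableAt
      (fun V : Beamformers K M d => S.H k * V m * (V m)ᴴ * (S.H k)ᴴ) V := fun k m =>
    (((EntrywiseDifferentiableAt.const _).mul (hV m)).mul (hV m).conjTranspose).mul
      (EntrywiseDifferentiableAt.const _)
  have h1 : S.weightedSumRate = fun V : Beamformers K M d => ∑ k, S.α k *
      (Real.log (S.receivedCov (S.σ ^ 2) V k).det.re
        - Real.log (S.interference V k).det.re) := by
    funext V
    exact Finset.sum_congr rfl fun k _ => by rw [S.rate_eq hσ]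
  rw [h1]
  refine DifferentiableAt.fun_sum fun k _ => (differentiableAt_const _).mul (.sub ?_ ?_)
  · refine EntrywiseDifferentiableAt.log_det ?_ (S.receivedCov_posDef hσ V k)
    simp only [S.receivedCov_eq_sum]
    exact (EntrywiseDifferentiableAt.sum (hs k)).add (EntrywiseDifferentiableAt.const _)
  · refine EntrywiseDifferentiableAt.log_det ?_ (S.interference_posDef hσ V k)
    exact (EntrywiseDifferentiableAt.sum (hs k)).add (EntrywiseDifferentiableAt.const _)

lemma System.differentiableAt_wmmseCost {X : Point K M N d} (hW : ∀ k, (X.2.1 k).PosDef) :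
    DifferentiableAt ℝ S.wmmseCost X := by
  have hu : ∀ k, EntrywiseDifferentiableAt (fun X : Point K M N d => X.1 k) X :=
    fun k i j => by fun_prop
  have hw : ∀ k, EntrywiseDifferentiableAt (fun X : Point K M N d => X.2.1 k) X :=
    fun k i j => by fun_prop
  have hv : ∀ k, EntrywiseDifferentiableAt (fun X : Point K M N d => X.2.2 k) X :=
    fun k i j => by fun_prop
  have hc : ∀ {m n : ℕ} (A : Matrix (Fin m) (Fin n) ℂ),
      EntrywiseDifferentiableAt (fun _ : Point K M N d => A) X :=
    fun A => EntrywiseDifferentiableAt.const A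
  refine DifferentiableAt.fun_sum fun k _ => (differentiableAt_const _).mul (.sub ?_ ?_)
  · refine EntrywiseDifferentiableAt.re_trace ((hw k).mul ?_)
    have hz := (((hu k).conjTranspose.mul (hc (S.H k))).mul (hv k))
    refine (((hc 1).sub hz).mul ((hc 1).sub hz).conjTranspose |>.add
      (EntrywiseDifferentiableAt.sum fun m => ?_)).add
      (((hu k).conjTranspose.mul (hu k)).const_smul _)
    exact (((((hu k).conjTranspose.mul (hc (S.H k))).mul (hv m)).mul (hv m).conjTranspose).mul
      (hc (S.H k)ᴴ)).mul (hu k)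
  · exact EntrywiseDifferentiableAt.log_det (hw k) (hW k)

/-- Envelope theorem: at a matched point the derivatives of the reformulated cost and of the
negative weighted sum rate agree in every direction that keeps the weights Hermitian, because their
difference is minimal there. -/
lemma System.fderiv_wmmseCost_eq (hα : ∀ k, 0 ≤ S.α k) (hσ : 0 < S.σ) {X : Point K M N d}
    (hW : ∀ k, (X.2.1 k).PosDef) (hX : S.Matched X) {Y : Point K M N d}
    (hY : ∀ k, (Y.2.1 k).IsHermitian) :
    fderiv ℝ S.wmmseCost X (Y - X)
      = fderiv ℝ (fun V => -S.weightedSumRate V) X.2.2 (Y.2.2 - X.2.2) := by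
  have h1 := (S.differentiableAt_wmmseCost hW).hasFDerivAt.hasLineDerivAt (Y - X)
  have h2 := (S.differentiableAt_weightedSumRate hσ X.2.2).fun_neg.hasFDerivAt.hasLineDerivAt
    (Y.2.2 - X.2.2)
  have h3 := HasDerivAt.sub h1 h2
  have hmin : IsLocalMin (fun t : ℝ => S.wmmseCost (X + t • (Y - X))
      - -S.weightedSumRate (X.2.2 + t • (Y.2.2 - X.2.2))) 0 := by
    have hpd : ∀ k, ∀ᶠ t : ℝ in nhds 0, (X.2.1 k + t • (Y.2.1 k - X.2.1 k)).PosDef := fun k =>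
      eventually_posDef_add_smul (hW k) ((hY k).sub (hW k).isHermitian)
    filter_upwards [Filter.eventually_all.mpr hpd] with t ht
    have h4 := S.envelope_le hα hσ (X := X + t • (Y - X)) ht
    have h5 := S.envelope_eq hσ hW hX
    have h6 : (X + t • (Y - X)).2.2 = X.2.2 + t • (Y.2.2 - X.2.2) := rfl
    rw [h6] at h4
    simp only [zero_smul, add_zero]
    linarith
  exact sub_eq_zero.mp (hmin.hasDerivAt_eq_zero h3)

lemma convex_setOf_power_le (P : ℝ) : Convex ℝ {V : Beamformers K M d | power V ≤ P} := by
  intro V hV V' hV' a b ha hb hab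
  have h1 := sqrt_power_add_le (a • V) (b • V')
  have h2 : power (a • V) = a ^ 2 * power V := power_smul a V
  have h3 : power (b • V') = b ^ 2 * power V' := power_smul b V'
  rw [h2, h3, Real.sqrt_mul (sq_nonneg _), Real.sqrt_mul (sq_nonneg _), Real.sqrt_sq ha,
    Real.sqrt_sq hb] at h1
  have h4 : √(power V) ≤ √P := Real.sqrt_le_sqrt hV
  have h5 : √(power V') ≤ √P := Real.sqrt_le_sqrt hV'
  have h6 : √(power (a • V + b • V')) ≤ √P := by
    calc _ ≤ a * √P + b * √P := h1.trans (by gcongr)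
      _ = √P := by rw [← add_mul, hab, one_mul]
  have hP : 0 ≤ P := (power_nonneg V).trans hV
  exact (Real.sqrt_le_sqrt_iff hP).mp h6

/-- First-order condition for a minimum over a convex set. -/
lemma fderiv_nonneg_of_isMinOn {E : Type*} [NormedAddCommGroup E] [NormedSpace ℝ E] {f : E → ℝ}
    {s : Set E} (hs : Convex ℝ s) {x y : E} (hx : x ∈ s) (hy : y ∈ s)
    (hf : DifferentiableAt ℝ f x) (hmin : IsMinOn f s x) : 0 ≤ fderiv ℝ f x (y - x) := by
  refine hmin.localize.hasFDerivWithinAt_nonneg hf.hasFDerivAt.hasFDerivWithinAt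
    (mem_posTangentConeAt_of_segment_subset ?_)
  rw [add_sub_cancel]
  exact hs.segment_subset hx hy

/-- A matched point is stationary for the reformulated problem as soon as its beamformers are
stationary for the weighted sum rate. -/
lemma System.isStationaryWMMSE_of_matched (hα : ∀ k, 0 ≤ S.α k) (hσ : 0 < S.σ)
    {X : Point K M N d} (hW : ∀ k, (X.2.1 k).PosDef) (hX : S.Matched X)
    (hV : S.IsStationaryWSR X.2.2) : S.IsStationaryWMMSE X := by
  refine ⟨hW, ⟨fun k => (hW k).posSemidef, hV.1⟩, S.differentiableAt_wmmseCost hW, fun Y hY => ?_⟩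
  have h := S.fderiv_wmmseCost_eq hα hσ hW hX (Y := Y) fun k => (hY.1 k).isHermitian
  exact h ▸ hV.2.2 Y.2.2 hY.2

/-- A matched point of full power with vanishing gradient in `V` gives a stationary point of the
weighted sum rate: its beamformers minimise the reformulated cost over the power constraint. -/
lemma System.isStationaryWSR_of_matched (hα : ∀ k, 0 ≤ S.α k) (hσ : 0 < S.σ) (hP : 0 < S.P)
    {X : Point K M N d} (hW : ∀ k, (X.2.1 k).PosDef) (hX : S.Matched X)
    (hp : power X.2.2 = S.P) (hV : ∀ k, S.gradV X k = 0) : S.IsStationaryWSR X.2.2 := by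
  have hd := S.differentiableAt_wmmseCost hW
  refine ⟨hp.le, (S.differentiableAt_weightedSumRate hσ X.2.2).fun_neg, fun V hVP => ?_⟩
  have h := S.fderiv_wmmseCost_eq hα hσ hW hX (Y := (X.1, X.2.1, V)) fun k => (hW k).isHermitian
  have hs : Convex ℝ ({X.1} ×ˢ {X.2.1} ×ˢ {V | power V ≤ S.P} : Set (Point K M N d)) :=
    (convex_singleton _).prod ((convex_singleton _).prod (convex_setOf_power_le _))
  have h0 := fderiv_nonneg_of_isMinOn (x := X) (y := (X.1, X.2.1, V)) hs
    ⟨rfl, rfl, hp.le⟩ ⟨rfl, rfl, hVP⟩ hd ?_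
  · exact h ▸ h0
  rintro ⟨U', W', V'⟩ ⟨h1, h2, h3⟩
  obtain rfl : U' = X.1 := h1
  obtain rfl : W' = X.2.1 := h2
  have h3' : power V' ≤ S.P := h3
  have h4 := S.cost_le_of_gradV_eq_zero hα hP hW hV V'
  have h5 := S.wmmseCost_eq_cost_add X
  have h6 := S.wmmseCost_eq_cost_add (X.1, X.2.1, V')
  rw [hp, div_self hP.ne', sub_self, mul_zero, zero_mul, add_zero] at h5
  have h7 : 0 ≤ ∑ k, S.α k * (Matrix.trace (X.2.1 k * (X.1 k)ᴴ * X.1 k)).re :=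
    Finset.sum_nonneg fun k _ => mul_nonneg (hα k) (by
      rw [Matrix.mul_assoc]
      exact re_trace_mul_nonneg (hW k) (Matrix.posSemidef_conjTranspose_mul_self _))
  have h8 : 0 ≤ 1 - power V' / S.P := by
    rw [sub_nonneg, div_le_one hP]; exact h3'
  have h9 : 0 ≤ S.σ ^ 2 * (1 - power V' / S.P)
      * ∑ k, S.α k * (Matrix.trace (X.2.1 k * (X.1 k)ᴴ * X.1 k)).re := by positivity
  change S.wmmseCost X ≤ S.wmmseCost (X.1, X.2.1, V')
  rw [h5, h6]
  exact h4.trans (le_add_of_nonneg_right h9)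

end Stationarity

/-! ### Matched points -/

section Main

variable {K M N d : ℕ} {S : System K M N d} {κ a δ γu γv : ℝ} {Ju Jw Jv : ℕ}

lemma exists_of_power_pos {V : Beamformers K M d} (hV : 0 < power V) : 1 ≤ K ∧ 1 ≤ d := by
  constructor
  · by_contra h
    obtain rfl : K = 0 := by omega
    simp [power] at hV
  · by_contra h
    obtain rfl : d = 0 := by omega
    simp [power_eq_sum_frob, frob_eq_sum] at hV

lemma System.Regime.stepSizes (hR : S.Regime κ a δ) (hJu : 1 ≤ Ju) (hJv : 1 ≤ Jv)
    (hu : 0 < γu) (hu' : γu ≤ min (1 / S.Lu κ a δ) (S.νu κ a δ Ju Jv))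
    (hv : 0 < γv) (hv' : γv ≤ min (1 / S.Lv κ a δ) (S.νv κ a δ Ju Jv)) :
    S.StepSizes κ a δ γu γv ((δ - 1) / ((Ju : ℝ) + Jv)) Ju Jv := by
  have h1 : (1 : ℝ) ≤ Ju := by exact_mod_cast hJu
  have h2 : (1 : ℝ) ≤ Jv := by exact_mod_cast hJv
  have hJ : 0 < (Ju : ℝ) + Jv := by linarith
  have hδ1 := hR.one_lt
  have hδ2 := hR.lt_two
  have hη : 0 < (δ - 1) / ((Ju : ℝ) + Jv) := div_pos (by linarith) hJ
  have hLd : 0 ≤ S.Ld κ a δ := le_trans (by positivity) hR.sqrt_Lc_le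
  have hLb : 0 ≤ S.Lb κ a δ := le_trans (by positivity) hR.sqrt_La_le
  exact
    { γu_pos := hu
      γv_pos := hv
      γu_le := hu'.trans (min_le_left _ _)
      γv_le := hv'.trans (min_le_left _ _)
      η_pos := hη
      η_lt := by rw [div_lt_one hJ]; linarith
      growth_u := quadratic_le_of_le_root hR.Lc_pos hLd hη.le hu.le (hu'.trans (min_le_right _ _))
      growth_v := quadratic_le_of_le_root hR.La_pos hLb hη.le hv.le (hv'.trans (min_le_right _ _))
      budget := by field_simp; ring }

/-- A zero of the gradient in `U` is the MMSE receiver, for users of positive priority. -/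
lemma System.matched_of_gradU_eq_zero (hP : 0 < S.P) {X : Point K M N d}
    (hp : power X.2.2 = S.P) (hW : ∀ k, (X.2.1 k).PosDef) (hU : ∀ k, S.gradU X k = 0)
    (hWE : ∀ k, X.2.1 k * S.scaledMse X.1 X.2.2 k = 1) : S.Matched X := by
  intro k
  by_cases h0 : S.α k = 0
  · exact Or.inl h0
  refine Or.inr ⟨?_, by rw [← S.scaledMse_eq_mse hP X.1 hp]; exact hWE k⟩
  have hv : power X.2.2 / S.P * S.σ ^ 2 = S.σ ^ 2 := by rw [hp, div_self hP.ne', one_mul]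
  have h1 := hU k
  rw [S.gradU_eq_receivedCov, hv, smul_eq_zero] at h1
  have h2 := h1.resolve_left (mul_ne_zero two_ne_zero h0)
  have hWd : IsUnit (X.2.1 k).det := (Matrix.isUnit_iff_isUnit_det _).mp (hW k).isUnit
  have h3 := congrArg (· * (X.2.1 k)⁻¹) h2
  simp only [Matrix.mul_assoc, Matrix.mul_nonsing_inv _ hWd, Matrix.mul_one,
    Matrix.zero_mul] at h3
  exact sub_eq_zero.mp h3

lemma System.exists_matched (hσ : 0 < S.σ) (V : Beamformers K M d) :
    ∃ (U : Receivers K N d) (W : Weights K d), (∀ k, (W k).PosDef) ∧ S.Matched (U, W, V) := by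
  have hRu : ∀ k, IsUnit (S.receivedCov (S.σ ^ 2) V k).det := fun k =>
    (Matrix.isUnit_iff_isUnit_det _).mp (S.receivedCov_posDef hσ V k).isUnit
  set U : Receivers K N d := fun k => (S.receivedCov (S.σ ^ 2) V k)⁻¹ * (S.H k * V k) with hU
  have hE : ∀ k, (S.mse U V k).PosDef := fun k => S.errorCov_posDef (pow_pos hσ 2) U V k
  refine ⟨U, fun k => (S.mse U V k)⁻¹, fun k => (hE k).inv, fun k => Or.inr ⟨?_, ?_⟩⟩
  · change S.receivedCov (S.σ ^ 2) V k * U k = S.H k * V k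
    rw [hU, ← Matrix.mul_assoc, Matrix.mul_nonsing_inv _ (hRu k), Matrix.one_mul]
  · exact Matrix.nonsing_inv_mul _ ((Matrix.isUnit_iff_isUnit_det _).mp (hE k).isUnit)

end Main

end WMMSE

theorem theorem2 {K M N d : ℕ} (S : WMMSE.System K M N d)
    (hα : ∀ k, 0 ≤ S.α k) (hσ : 0 < S.σ) (hP : 0 < S.P) :
    (∀ (κ a δ γu γv : ℝ) (Ju Jw Jv : ℕ) (V₀ : WMMSE.Beamformers K M d),
      (∀ k, WMMSE.spectralNorm (S.H k) ^ 2 ≤ κ) →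
      (∀ k, S.α k ≤ a) →
      1 < δ → δ < 2 → δ - δ ^ 2 - Real.log (2 - δ) = 0 →
      1 ≤ Ju → 1 ≤ Jw → 1 ≤ Jv →
      0 < γu → γu ≤ min (1 / S.Lu κ a δ) (S.νu κ a δ Ju Jv) →
      0 < γv → γv ≤ min (1 / S.Lv κ a δ) (S.νv κ a δ Ju Jv) →
      WMMSE.power V₀ = S.P →
      ∀ (U : WMMSE.Receivers K N d) (W : WMMSE.Weights K d) (V : WMMSE.Beamformers K M d),
        MapClusterPt (U, W, V) Filter.atTop (S.iterates γu γv Ju Jw Jv V₀) →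
        S.IsStationaryWMMSE (U, W, V) ∧ S.IsStationaryWSR V) ∧
    (∀ V : WMMSE.Beamformers K M d, S.IsStationaryWSR V →
      ∃ (U : WMMSE.Receivers K N d) (W : WMMSE.Weights K d),
        S.IsStationaryWMMSE (U, W, V)) := by
  refine ⟨?_, fun V hV => ?_⟩
  · intro κ a δ γu γv Ju Jw Jv V₀ hκ ha hδ1 hδ2 hδ hJu hJw hJv hu hu' hv hv' hV₀ U W V hlim
    obtain ⟨hK, hd⟩ := WMMSE.exists_of_power_pos (V := V₀) (by rw [hV₀]; exact hP)
    have ha0 : 0 ≤ a := (hα ⟨0, hK⟩).trans (ha ⟨0, hK⟩)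
    -- For `a = 0` the bound `1 / Lu` is `1 / 0 = 0`, which leaves no positive step size.
    have hapos : 0 < a := by
      rcases ha0.eq_or_lt with h0 | h
      · have h1 := hu.trans_le (hu'.trans (min_le_left _ _))
        simp [WMMSE.System.Lu, ← h0] at h1
      · exact h
    have hR : S.Regime κ a δ :=
      { norm_sq_le := hκ
        α_nonneg := hα
        α_le := ha
        σ_pos := hσ
        P_pos := hP
        κ_nonneg := (sq_nonneg _).trans (hκ ⟨0, hK⟩)
        a_pos := hapos
        users_pos := hK
        streams_pos := hd
        one_lt := hδ1
        lt_two := hδ2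
        gain_eq_zero := hδ }
    have hs := hR.stepSizes hJu hJv hu hu' hv hv'
    obtain ⟨hX, hgu, hWE, hgv⟩ := S.stationary_of_mapClusterPt hR hs hJu hJw hJv hV₀ hlim
    have hm := S.matched_of_gradU_eq_zero hP hX.power_eq hX.posDef hgu hWE
    have hwsr := S.isStationaryWSR_of_matched hα hσ hP hX.posDef hm hX.power_eq hgv
    exact ⟨S.isStationaryWMMSE_of_matched hα hσ hX.posDef hm hwsr, hwsr⟩
  · obtain ⟨U, W, hW, hm⟩ := S.exists_matched hσ V
    exact ⟨U, W, S.isStationaryWMMSE_of_matched hα hσ (X := (U, W, V)) hW hm hV⟩
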